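/- Let $k$ be a field of characteristic $0$ and let $\mathcal C$ be a $k$-linear abelian braided monoidal category (tensor unit $\mathbf 1$, braiding $c$) whose tensor product is $k$-linear and right exact in each argument, and such that: (PF) $\mathcal C$ has a projective generator $P$ (every object is a quotient of some $P^{\oplus m}$) with $\mathcal C(P,P)$ finite-dimensional over $k$; (C) $\mathcal C$ is equipped with a contravariant $k$-linear functor $(-)^*$, natural isomorphisms $\delta_U:U\to U^{**}$ with $(\delta_U)^*=(\delta_{U^*})^{-1}$, and isomorphisms $\pi_{U,V}:\mathcal C(U,V^*)\to\mathcal C(U\otimes V,\mathbf 1^*)$ natural in $U$ and $V$. A Deligne product of $\mathcal C$ with itself is a $k$-linear abelian category $\mathcal C\boxtimes\mathcal C$ with a functor $\boxtimes:\mathcal C\times\mathcal C\to\mathcal C\boxtimes\mathcal C$, $k$-linear and right exact in each argument, such that for every $k$-linear abelian category $\mathcal B$ precomposition with $\boxtimes$ is an equivalence from the category of $k$-linear right exact functors $\mathcal C\boxtimes\mathcal C\to\mathcal B$ to the category of functors $\mathcal C\times\mathcal C\to\mathcal B$ that are $k$-linear and right exact in each argument. Such a product exists, and on each such product the following structures exist: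 * a monoidal structure whose tensor product is $k$-linear and right exact in each argument and for which $\boxtimes$ is strong monoidal, so that $(A\boxtimes U)\otimes(B\boxtimes V)\cong(A\otimes B)\boxtimes(U\otimes V)$ and the tensor unit is $\mathbf 1\boxtimes\mathbf 1$; the resulting monoidal category is the one underlying $\mathcal C\boxtimes\mathcal C^{\mathrm{rev}}$; * the tensor product functor $T:\mathcal C\boxtimes\mathcal C^{\mathrm{rev}}\to\mathcal C$, the $k$-linear right exact functor with $T(A\boxtimes B)\cong A\otimes B$, with the strong monoidal structure $T_2:T(X)\otimes T(Y)\to T(X\otimes Y)$, $T_0:\mathbf 1\to T(\mathbf 1\boxtimes\mathbf 1)$ which on product objects is $(A\otimes B)\otimes(U\otimes V)\to(A\otimes U)\otimes(B\otimes V)$ given by $\mathrm{id}_A\otimes c_{U,B}^{-1}\otimes\mathrm{id}_V$ (up to associators), $T_0$ being the inverse unit isomorphism; * the contravariant functor $(-)^*$ on $\mathcal C\boxtimes\mathcal C^{\mathrm{rev}}$ induced by that of $\mathcal C$: $k$-linear, right exact as a functor to the opposite category, with $(A\boxtimes B)^*\cong A^*\boxtimes B^*$ naturally; * an object $R_{\mathbf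 1^*}$ that represents the functor $X\mapsto\mathcal C(T(X),\mathbf 1^*)$. For any choice of these structures, set $$R(U)=\big((U^*\boxtimes\mathbf 1)\otimes(R_{\mathbf 1^*})^*\big)^*,\qquad R(f)=\big((f^*\boxtimes\mathrm{id}_{\mathbf 1})\otimes\mathrm{id}_{(R_{\mathbf 1^*})^*}\big)^* .$$ Then the functor $R:\mathcal C\to\mathcal C\boxtimes\mathcal C^{\mathrm{rev}}$ is a right adjoint of $T$. Consequently, for every adjunction $T\dashv R$ with unit $\eta$ and counit $\varepsilon$, $R$ is lax monoidal with structure maps $R_0=R(T_0^{-1})\circ\eta_{\mathbf 1\boxtimes\mathbf 1}$ and $R_{2;U,V}=R\big((\varepsilon_U\otimes\varepsilon_V)\circ T_2^{-1}\big)\circ\eta_{R(U)\otimes R(V)}$. If $(A,\mu)$ is an (associative, not necessarily unital) algebra in $\mathcal C$, then $R(A)$ with multiplication $R(\mu)\circ R_{2;A,A}$ is an algebra in $\mathcal C\boxtimes\mathcal C^{\mathrm{rev}}$; if $\iota$ is a unit of $A$, then $R(\iota)\circ R_0$ is a unit of $R(A)$; and $R$ sends algebra homomorphisms to algebra homomorphisms.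 -/

import Mathlib

open CategoryTheory CategoryTheory.Limits CategoryTheory.MonoidalCategory Opposite

universe w v u v₁ u₁ v₂ u₂ v₃ u₃

noncomputable section

namespace DeligneAdjoint

/-! ### Linear, right exact functors -/

/-- The opposite of a `k`-linear category is `k`-linear. -/
instance oppositeLinear (k : Type w) [Semiring k] (C : Type u) [Category.{v} C] [Preadditive C]
    [Linear k C] : Linear k Cᵒᵖ where
  homModule X Y :=
    { smul := fun r f => (r • f.unop).op
      one_smul := fun f => Quiver.Hom.unop_inj (one_smul k f.unop)
      mul_smul := fun r s f => Quiver.Hom.unop_inj (mul_smul r s f.unop)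
      smul_zero := fun r => Quiver.Hom.unop_inj (smul_zero (A := Y.unop ⟶ X.unop) r)
      smul_add := fun r f g => Quiver.Hom.unop_inj (smul_add r f.unop g.unop)
      add_smul := fun r s f => Quiver.Hom.unop_inj (add_smul r s f.unop)
      zero_smul := fun f => Quiver.Hom.unop_inj (zero_smul k f.unop) }
  smul_comp _ _ _ r f g := Quiver.Hom.unop_inj (Linear.comp_smul _ _ _ g.unop r f.unop)
  comp_smul _ _ _ f r g := Quiver.Hom.unop_inj (Linear.smul_comp _ _ _ r g.unop f.unop)

section Functors

variable (k : Type w) [Field k]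
variable {A : Type u₁} [Category.{v₁} A] [Abelian A] [Linear k A]
variable {B : Type u₂} [Category.{v₂} B] [Abelian B] [Linear k B]
variable {E : Type u₃} [Category.{v₃} E] [Abelian E] [Linear k E]

/-- A functor between `k`-linear abelian categories is `k`-linear and right exact. -/
structure IsLinearRightExact (F : A ⥤ E) : Prop where
  additive : F.Additive
  linear : F.Linear k
  rightExact : PreservesFiniteColimits F

/-- A functor on `A × B` is `k`-linear and right exact in each of its two arguments. -/
structure IsMultiRightExact (G : A × B ⥤ E) : Prop where
  fixLeft : ∀ a : A, IsLinearRightExact k (Prod.sectR a B ⋙ G)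
  fixRight : ∀ b : B, IsLinearRightExact k (Prod.sectL A b ⋙ G)

variable {k} in
theorem IsLinearRightExact.comp {F : A ⥤ B} {G : B ⥤ E}
    (hF : IsLinearRightExact k F) (hG : IsLinearRightExact k G) :
    IsLinearRightExact k (F ⋙ G) := by
  obtain ⟨_, _, _⟩ := hF
  obtain ⟨_, _, _⟩ := hG
  exact ⟨inferInstance, inferInstance, comp_preservesFiniteColimits F G⟩

variable (A E) in
/-- `Fun_{k, r.ex.}(A, E)`: linear right exact functors and all natural transformations. -/
abbrev RexFun :=
  ObjectProperty.FullSubcategory (fun F : A ⥤ E => IsLinearRightExact k F)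

variable (A B E) in
/-- `Fun_{mult, r.ex.}(A × B, E)`: functors that are linear and right exact in each argument, and
all natural transformations. -/
abbrev MultRexFun :=
  ObjectProperty.FullSubcategory (fun G : A × B ⥤ E => IsMultiRightExact k G)

end Functors

section Deligne

variable (k : Type w) [Field k]
variable {A B D : Type u} [Category.{v} A] [Category.{v} B] [Category.{v} D]
variable [Abelian A] [Linear k A] [Abelian B] [Linear k B] [Abelian D] [Linear k D]

variable {k} in
/-- The functor `F ↦ box ⋙ F` from `Fun_{k, r.ex.}(D, E)` to `Fun_{mult, r.ex.}(A × B, E)`. -/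
def precomposition {box : A × B ⥤ D} (hbox : IsMultiRightExact k box)
    (E : Type u) [Category.{v} E] [Abelian E] [Linear k E] :
    RexFun k D E ⥤ MultRexFun k A B E :=
  ObjectProperty.lift _
    (ObjectProperty.ι _ ⋙ (Functor.whiskeringLeft (A × B) D E).obj box)
    (fun F => ⟨fun a => (hbox.fixLeft a).comp F.property,
      fun b => (hbox.fixRight b).comp F.property⟩)

/-- `(D, box)` is a Deligne product of the `k`-linear abelian categories `A` and `B`. -/
structure IsDeligneProduct (box : A × B ⥤ D) : Prop where
  multiRightExact : IsMultiRightExact k box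
  isEquivalence : ∀ (E : Type u) [Category.{v} E] [Abelian E] [Linear k E],
    (precomposition multiRightExact E).IsEquivalence

end Deligne

/-- An extension of a functor `G` on `A × B` along `box : A × B ⥤ D` to a linear right exact functor
on `D`. If `(D, box)` is a Deligne product then such an extension is unique up to a unique
isomorphism compatible with `iso`; this is the functor on `D` which is induced by `G`. -/
structure Extension (k : Type w) [Field k]
    {A : Type u₁} [Category.{v₁} A] {B : Type u₂} [Category.{v₂} B]
    {D : Type u} [Category.{v} D] [Abelian D] [Linear k D]
    {E : Type u₃} [Category.{v₃} E] [Abelian E] [Linear k E]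
    (box : A × B ⥤ D) (G : A × B ⥤ E) where
  functor : D ⥤ E
  isLinearRightExact : IsLinearRightExact k functor
  iso : box ⋙ functor ≅ G

/-! ### The conditions on the category -/

/-- Condition (PF): there is a projective generator whose endomorphism space is finite-dimensional. -/
def ConditionPF (k : Type w) [Field k] (C : Type u) [Category.{v} C] [Abelian C] [Linear k C] :
    Prop :=
  haveI : HasFiniteBiproducts C := Abelian.hasFiniteBiproducts
  ∃ P : C, Projective P ∧ FiniteDimensional k (P ⟶ P) ∧
    ∀ U : C, ∃ (m : ℕ) (f : (⨁ fun _ : Fin m => P) ⟶ U), Epi f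

/-- The tensor product is right exact in each argument. -/
def RightExactTensor (C : Type u) [Category.{v} C] [MonoidalCategory C] : Prop :=
  ∀ X : C, PreservesFiniteColimits (tensorLeft X) ∧ PreservesFiniteColimits (tensorRight X)

/-- Condition (C): conjugates. The bijections `π` are automatically `k`-linear, by naturality. -/
structure Conjugates (k : Type w) [Field k] (C : Type u) [Category.{v} C] [Abelian C] [Linear k C]
    [MonoidalCategory C] where
  /-- the contragredient functor `U ↦ U^*` -/
  star : Cᵒᵖ ⥤ C
  star_additive : star.Additive
  star_linear : star.Linear k
  /-- `δ_U : U ≅ U^{**}` -/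
  δ : 𝟭 C ≅ star.rightOp ⋙ star
  /-- `(δ_U)^* = (δ_{U^*})⁻¹ : U^{***} ⟶ U^*` -/
  star_δ : ∀ U : C, star.map (δ.hom.app U).op = δ.inv.app (star.obj (op U))
  /-- `π_{U,V} : C(U, V^*) ≅ C(U ⊗ V, 1^*)` -/
  π : ∀ U V : C, (U ⟶ star.obj (op V)) ≃ (U ⊗ V ⟶ star.obj (op (𝟙_ C)))
  π_natural_left : ∀ {U U' : C} (V : C) (a : U' ⟶ U) (q : U ⟶ star.obj (op V)),
    π U' V (a ≫ q) = a ▷ V ≫ π U V q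
  π_natural_right : ∀ (U : C) {V V' : C} (b : V' ⟶ V) (q : U ⟶ star.obj (op V)),
    π U V' (q ≫ star.map b.op) = U ◁ b ≫ π U V q

/-! ### Algebras -/

section Algebras

variable {M : Type u} [Category.{v} M] [MonoidalCategory M]

/-- `(A, m)` is an (associative, not necessarily unital) algebra. -/
def IsAlgebra {A : M} (m : A ⊗ A ⟶ A) : Prop :=
  A ◁ m ≫ m = (α_ A A A).inv ≫ m ▷ A ≫ m

/-- `e` is a unit for the multiplication `m`. -/
def IsAlgebraUnit {A : M} (m : A ⊗ A ⟶ A) (e : 𝟙_ M ⟶ A) : Prop :=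
  e ▷ A ≫ m = (λ_ A).hom ∧ A ◁ e ≫ m = (ρ_ A).hom

/-- `f` is a homomorphism of algebras. -/
def IsAlgebraHom {A A' : M} (m : A ⊗ A ⟶ A) (m' : A' ⊗ A' ⟶ A') (f : A ⟶ A') : Prop :=
  m ≫ f = (f ⊗ₘ f) ≫ m'

end Algebras

/-! ### The structure of `C ⊠ C^rev` -/

section Product

variable (k : Type w) [Field k]
variable {C : Type u} [Category.{v} C] [Abelian C] [Linear k C] [MonoidalCategory C]
variable {D : Type u} [Category.{v} D] [Abelian D] [Linear k D]

/-- The monoidal structure of `D` is the one induced from `C` on the Deligne product: its tensor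
product is linear and right exact in each argument, and `box` is strong monoidal for the factorwise
tensor product of `C × C`, so that `(A ⊠ U) ⊗ (B ⊠ V) ≅ (A ⊗ B) ⊠ (U ⊗ V)` and `1 ≅ 1 ⊠ 1`. -/
structure ProductTensor (box : C × C ⥤ D) [MonoidalCategory D] where
  preadditive : MonoidalPreadditive D
  linear : MonoidalLinear k D
  rightExact : RightExactTensor D
  [boxMonoidal : box.Monoidal]

/-- The isomorphism `(A ⊗ B) ⊗ (U ⊗ V) ⟶ (A ⊗ U) ⊗ (B ⊗ V)` given by the inverse braiding
`c_{U,B}⁻¹`. -/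
def interchange [BraidedCategory C] (A B U V : C) : (A ⊗ B) ⊗ (U ⊗ V) ⟶ (A ⊗ U) ⊗ (B ⊗ V) :=
  (α_ A B (U ⊗ V)).hom ≫
    A ◁ ((α_ B U V).inv ≫ (β_ U B).inv ▷ V ≫ (α_ U B V).hom) ≫ (α_ A U (B ⊗ V)).inv

open Functor.LaxMonoidal in
/-- The tensor product functor `T : C ⊠ C^rev ⥤ C`, the linear right exact functor with
`T (A ⊠ B) ≅ A ⊗ B`, together with its strong monoidal structure: on product objects `T₂` is
`interchange`, and `T₀` is the inverse unit isomorphism. -/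
structure TensorFunctor [BraidedCategory C] {box : C × C ⥤ D} [MonoidalCategory D]
    (S : ProductTensor k box) extends Extension k box (tensor C) where
  monoidal : functor.Monoidal
  T₂_eq : letI := S.boxMonoidal
    ∀ A B U V : C,
      μ functor (box.obj (A, B)) (box.obj (U, V)) ≫ functor.map (μ box (A, B) (U, V)) ≫
        iso.hom.app (A ⊗ U, B ⊗ V) =
      (iso.hom.app (A, B) ⊗ₘ iso.hom.app (U, V)) ≫ interchange A B U V
  T₀_eq : letI := S.boxMonoidal
    ε functor ≫ functor.map (ε box) ≫ iso.hom.app (𝟙_ C, 𝟙_ C) = (λ_ (𝟙_ C)).inv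

/-- The functor `(A, B) ↦ A^* ⊠ B^*`, seen as a covariant functor to the opposite category. -/
def boxStar (K : Conjugates k C) (box : C × C ⥤ D) : C × C ⥤ Dᵒᵖ :=
  ((prodOpEquiv C (D := C)).functor ⋙ K.star.prod K.star ⋙ box).rightOp

/-- The involution of `C ⊠ C^rev` induced by that of `C`: the linear right exact functor
`D ⥤ Dᵒᵖ` with `(A ⊠ B)^* ≅ A^* ⊠ B^*`. -/
abbrev ProductStar (K : Conjugates k C) (box : C × C ⥤ D) :=
  Extension k box (boxStar k K box)

variable {k} in
/-- The contragredient functor `X ↦ X^*` underlying the induced involution of `C ⊠ C^rev`. -/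
abbrev ProductStar.star {K : Conjugates k C} {box : C × C ⥤ D} (σ : ProductStar k K box) :
    Dᵒᵖ ⥤ D :=
  σ.functor.leftOp

variable {k} in
/-- `R₁` represents the functor `X ↦ C(T(X), 1^*)`. -/
abbrev Represents (K : Conjugates k C) (T : D ⥤ C) (R₁ : D) :=
  (T.op ⋙ yoneda.obj (K.star.obj (op (𝟙_ C)))).RepresentableBy R₁

variable {k} in
/-- The functor `R(U) = ((U^* ⊠ 1) ⊗ R₁^*)^*`, `R(f) = ((f^* ⊠ id) ⊗ id)^*`. -/
def rightAdjointFunctor (K : Conjugates k C) {box : C × C ⥤ D} [MonoidalCategory D]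
    (σ : ProductStar k K box) (R₁ : D) : C ⥤ D :=
  K.star.rightOp ⋙
    (Prod.sectL C (𝟙_ C) ⋙ box ⋙ tensorRight (σ.star.obj (op R₁))).op ⋙ σ.star

end Product

end DeligneAdjoint

end

/-! A right exact functor out of an abelian category with a projective generator `Q` is determined
by its value at `Q` with the action of `End Q`, and every object with such an action arises
(Eilenberg–Watts: `F(U)` plays the role of `Hom(Q, U) ⊗_{End Q} F(Q)`). Natural transformations are
likewise the equivariant maps at `Q`. These facts are `IsProjGen.exists_functor`,
`IsProjGen.exists_ext` and `IsProjGen.natTrans_ext`.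

They give a usable criterion, `IsBox`, for a Deligne product: the pair of projective generators goes
to a projective generator, and `End P ⊗ End P' → End (P ⊠ P')` is bijective. Finitely generated
modules over `(End P)ᵐᵒᵖ ⊗ (End P')ᵐᵒᵖ` satisfy it, and since Deligne products are equivalent, every
Deligne product does. On any of them a structure is then built by extending a functor from product
objects, one variable at a time, and its coherence laws need only be checked on product objects,
where they are laws of `C`. This yields the tensor product, `T` with its strong monoidal structure,
and the involution.

The involution needs more than right exactness. Bootstrapping from the generator gives the formula
`Hom(U ⊠ V, U' ⊠ V') = Hom(U, U') ⊗ Hom(V, V')` (`IsBox.homMap_bijective`). As tensoring over a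
field is exact, `⊠` is exact in each variable, so `A^* ⊠ B^*` is right exact as a functor to the
opposite category. Representing the dual of `Hom(P, -)` yields injective cogenerators, and with them
the opposite of a Deligne product is again a Deligne product (`IsBox.exists_isBox_boxOp`). Hence the
involution is an equivalence, and `X ≅ X^{**}`.

The same Hom formula carries `π` over to the product: `Hom(X, Y^*) ≅ Hom(X ⊗ Y, 1^* ⊠ 1^*)`
(`IsBox.exists_starPi`). The adjunction is then the chain `C(T X, U) ≅ C(T X ⊗ U^*, 1^*) ≅ C(T(X ⊗
(U^* ⊠ 1)), 1^*) ≅ Hom(X ⊗ (U^* ⊠ 1), R₁) ≅ Hom(X ⊗ (U^* ⊠ 1) ⊗ R₁^*, 1^* ⊠ 1^*) ≅ Hom(X, ((U^* ⊠ 1)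
⊗ R₁^*)^*)`, which uses `δ`, `π`, the strong monoidality of `T`, the representing property, `R₁ ≅
R₁^{**}` and `π` on the product. The rest is formal: a right adjoint of a strong monoidal functor is
lax monoidal, and lax monoidal functors preserve algebras. -/

noncomputable section

namespace DeligneAdjoint

attribute [local instance] Abelian.hasFiniteBiproducts

open scoped TensorProduct

set_option linter.unusedSectionVars false

/-! ### Right exact functors out of a category with a projective generator -/

section ProjGen

variable {X : Type u₁} [Category.{v₁} X] [Abelian X]
variable {E : Type u₂} [Category.{v₂} E] [Abelian E]

/-- `Q` is a projective generator: projective, and every object is a quotient of some `Q^n`. -/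
structure IsProjGen (Q : X) : Prop where
  projective : Projective Q
  exists_epi : ∀ U : X, ∃ (n : ℕ) (f : (⨁ fun _ : Fin n => Q) ⟶ U), Epi f

variable {Q : X}

theorem IsProjGen.presentation (hQ : IsProjGen Q) (U : X) :
    ∃ (m n : ℕ) (r : (⨁ fun _ : Fin m => Q) ⟶ ⨁ fun _ : Fin n => Q)
      (p : (⨁ fun _ : Fin n => Q) ⟶ U) (w : r ≫ p = 0),
      (ShortComplex.mk r p w).Exact ∧ Epi p := by
  obtain ⟨n, p, hp⟩ := hQ.exists_epi U
  obtain ⟨m, e, he⟩ := hQ.exists_epi (kernel p)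
  refine ⟨m, n, e ≫ kernel.ι p, p, by simp, ?_, hp⟩
  -- Covering `kernel p` by a power of `Q` does not change exactness: the comparison with the kernel
  -- sequence is epi, iso and mono on its three terms.
  let φ : ShortComplex.mk (e ≫ kernel.ι p) p (by simp) ⟶
      ShortComplex.mk (kernel.ι p) p (kernel.condition p) :=
    { τ₁ := e, τ₂ := 𝟙 _, τ₃ := 𝟙 _ }
  have : Epi φ.τ₁ := he
  have : IsIso φ.τ₂ := inferInstanceAs (IsIso (𝟙 _))
  have : Mono φ.τ₃ := inferInstanceAs (Mono (𝟙 _))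
  exact (ShortComplex.exact_iff_of_epi_of_isIso_of_mono φ).2 (ShortComplex.exact_kernel p)

theorem map_exact_epi (F : X ⥤ E) [F.Additive] [PreservesFiniteColimits F] {S : ShortComplex X}
    (hS : S.Exact) (hg : Epi S.g) : (S.map F).Exact ∧ Epi (F.map S.g) :=
  ((Functor.preservesFiniteColimits_tfae F).out 3 1 :).1 inferInstance S ⟨hS, hg⟩

theorem sum_map_power (F : X ⥤ E) [F.Additive] (n : ℕ) :
    ∑ i : Fin n, F.map (biproduct.π (fun _ : Fin n => Q) i) ≫
      F.map (biproduct.ι (fun _ : Fin n => Q) i) = 𝟙 _ := by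
  simp only [← F.map_comp, ← F.map_sum, biproduct.total, F.map_id]

theorem hom_ext_power (F : X ⥤ E) [F.Additive] {n : ℕ} {W : E}
    {s s' : F.obj (⨁ fun _ : Fin n => Q) ⟶ W}
    (h : ∀ f : Q ⟶ ⨁ fun _ : Fin n => Q, F.map f ≫ s = F.map f ≫ s') : s = s' := by
  rw [← Category.id_comp s, ← Category.id_comp s', ← sum_map_power F n]
  simp only [Preadditive.sum_comp, Category.assoc, h]

/-- Morphisms out of `F U` can be tested on the images of the maps `Q ⟶ U`, because `F` keeps a
cover `Q^n ⟶ U` epi and the identity of `F(Q^n)` is the sum of the `F(π_i) ≫ F(ι_i)`. Most later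
uniqueness arguments rest on this. -/
theorem IsProjGen.hom_ext (hQ : IsProjGen Q) (F : X ⥤ E) [F.Additive]
    [F.PreservesEpimorphisms] {U : X} {W : E} {s s' : F.obj U ⟶ W}
    (h : ∀ f : Q ⟶ U, F.map f ≫ s = F.map f ≫ s') : s = s' := by
  obtain ⟨n, p, hp⟩ := hQ.exists_epi U
  rw [← cancel_epi (F.map p)]
  refine hom_ext_power F fun f => ?_
  rw [← F.map_comp_assoc, ← F.map_comp_assoc, h]

theorem IsProjGen.factor (hQ : IsProjGen Q) {U V : X} (p : U ⟶ V) [Epi p] (f : Q ⟶ V) :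
    ∃ g : Q ⟶ U, g ≫ p = f :=
  have := hQ.projective
  ⟨Projective.factorThru f p, Projective.factorThru_comp f p⟩

/-- Present `U` as a cokernel of `Q^m ⟶ Q^n` and apply `t` coordinatewise on `Q^n`. Equivariance
makes the result kill the relations, so it descends along the cokernel `F(Q^n) ⟶ F(U)`. Only `F`,
not `F'`, has to be right exact. -/
theorem IsProjGen.exists_ext (hQ : IsProjGen Q) (F F' : X ⥤ E) [F.Additive]
    [PreservesFiniteColimits F] [F'.Additive] (t : F.obj Q ⟶ F'.obj Q)
    (ht : ∀ a : Q ⟶ Q, F.map a ≫ t = t ≫ F'.map a) (U : X) :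
    ∃ s : F.obj U ⟶ F'.obj U, ∀ f : Q ⟶ U, F.map f ≫ s = t ≫ F'.map f := by
  obtain ⟨m, n, r, p, w, hex, hp⟩ := hQ.presentation U
  obtain ⟨hex', hp'⟩ := map_exact_epi F hex hp
  let s₀ : F.obj (⨁ fun _ : Fin n => Q) ⟶ F'.obj U :=
    ∑ i, F.map (biproduct.π (fun _ : Fin n => Q) i) ≫ t ≫
      F'.map (biproduct.ι (fun _ : Fin n => Q) i ≫ p)
  have hs₀ : ∀ g : Q ⟶ ⨁ fun _ : Fin n => Q, F.map g ≫ s₀ = t ≫ F'.map (g ≫ p) := by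
    intro g
    have : g = ∑ i, (g ≫ biproduct.π (fun _ : Fin n => Q) i) ≫
        biproduct.ι (fun _ : Fin n => Q) i := by
      simp only [Category.assoc, ← Preadditive.comp_sum, biproduct.total, Category.comp_id]
    conv_rhs => rw [this]
    simp only [s₀, Preadditive.comp_sum, Preadditive.sum_comp, Functor.map_sum, Category.assoc]
    refine Finset.sum_congr rfl fun i _ => ?_
    rw [← F.map_comp_assoc, reassoc_of% (ht (g ≫ biproduct.π (fun _ : Fin n => Q) i)),
      ← F'.map_comp, Category.assoc]
  have h0 : F.map r ≫ s₀ = 0 := by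
    refine hom_ext_power F fun f => ?_
    rw [← F.map_comp_assoc, hs₀, Category.assoc, w]
    simp
  have : Epi ((ShortComplex.mk r p w).map F).g := hp'
  obtain ⟨s, hs⟩ : ∃ s : F.obj U ⟶ F'.obj U, F.map p ≫ s = s₀ :=
    ⟨hex'.desc s₀ h0, hex'.g_desc s₀ h0⟩
  refine ⟨s, fun f => ?_⟩
  obtain ⟨g, rfl⟩ := hQ.factor p f
  rw [F.map_comp, Category.assoc, hs, hs₀]

/-- The natural transformation determined by its value on a projective generator. -/
def IsProjGen.ext (hQ : IsProjGen Q) (F F' : X ⥤ E) [F.Additive]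
    [PreservesFiniteColimits F] [F'.Additive] (t : F.obj Q ⟶ F'.obj Q)
    (ht : ∀ a : Q ⟶ Q, F.map a ≫ t = t ≫ F'.map a) : F ⟶ F' where
  app U := (hQ.exists_ext F F' t ht U).choose
  naturality U V f := by
    refine hQ.hom_ext F fun g => ?_
    rw [← F.map_comp_assoc, (hQ.exists_ext F F' t ht V).choose_spec,
      ← Category.assoc, (hQ.exists_ext F F' t ht U).choose_spec, Category.assoc, F'.map_comp]

@[simp]
theorem IsProjGen.ext_app (hQ : IsProjGen Q) (F F' : X ⥤ E) [F.Additive]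
    [PreservesFiniteColimits F] [F'.Additive] (t : F.obj Q ⟶ F'.obj Q)
    (ht : ∀ a : Q ⟶ Q, F.map a ≫ t = t ≫ F'.map a) : (hQ.ext F F' t ht).app Q = t := by
  have := (hQ.exists_ext F F' t ht Q).choose_spec (𝟙 Q)
  simpa [IsProjGen.ext] using this

theorem IsProjGen.natTrans_ext (hQ : IsProjGen Q) {F F' : X ⥤ E} [F.Additive]
    [PreservesFiniteColimits F] {α β : F ⟶ F'} (h : α.app Q = β.app Q) : α = β := by
  ext U
  refine hQ.hom_ext F fun f => ?_
  rw [α.naturality, β.naturality, h]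

theorem IsProjGen.isIso_of_isIso_app (hQ : IsProjGen Q) {F F' : X ⥤ E} [F.Additive]
    [PreservesFiniteColimits F] [F'.Additive] [PreservesFiniteColimits F'] (α : F ⟶ F')
    (h : IsIso (α.app Q)) : IsIso α := by
  refine ⟨hQ.ext F' F (inv (α.app Q)) (fun a => ?_), hQ.natTrans_ext ?_, hQ.natTrans_ext ?_⟩
  · rw [IsIso.comp_inv_eq, Category.assoc, IsIso.eq_inv_comp, α.naturality]
  · simp
  · simp

/-! ### Construction of right exact functors from a module object -/

variable {Z : E} (Θ : (Q ⟶ Q) →+ (Z ⟶ Z))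

/-- `τ : X(Q, U) → E(Z, W)` is the universal `End Q`-equivariant additive map. -/
structure IsUniv {U : X} {W : E} (τ : (Q ⟶ U) →+ (Z ⟶ W)) : Prop where
  equi : ∀ (a : Q ⟶ Q) (q : Q ⟶ U), τ (a ≫ q) = Θ a ≫ τ q
  desc : ∀ (Y : E) (σ : (Q ⟶ U) →+ (Z ⟶ Y)), (∀ (a : Q ⟶ Q) (q : Q ⟶ U), σ (a ≫ q) = Θ a ≫ σ q) →
    ∃ s : W ⟶ Y, ∀ q, τ q ≫ s = σ q
  hom_ext : ∀ {Y : E} {s s' : W ⟶ Y}, (∀ q, τ q ≫ s = τ q ≫ s') → s = s'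

variable {Θ}

/-- The universal target `W` stands for `Hom(Q, U) ⊗_{End Q} Z`. For `U = Q^n` it is `Z^n`, the
inclusions `ι_i` serving as a basis of the free `End Q`-module `Hom(Q, Q^n)`. -/
theorem isUniv_power (hid : Θ (𝟙 Q) = 𝟙 Z) (hmul : ∀ a b, Θ (a ≫ b) = Θ a ≫ Θ b) (n : ℕ) :
    ∃ τ : (Q ⟶ ⨁ fun _ : Fin n => Q) →+ (Z ⟶ ⨁ fun _ : Fin n => Z), IsUniv Θ τ := by
  let τ : (Q ⟶ ⨁ fun _ : Fin n => Q) →+ (Z ⟶ ⨁ fun _ : Fin n => Z) :=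
    AddMonoidHom.mk' (fun q => biproduct.lift fun i => Θ (q ≫ biproduct.π _ i)) (fun a b => by
      apply biproduct.hom_ext; intro i; simp)
  have hτ : ∀ q i, τ q ≫ biproduct.π _ i = Θ (q ≫ biproduct.π _ i) := fun q i => by simp [τ]
  have hτι : ∀ i, τ (biproduct.ι (fun _ : Fin n => Q) i) =
      biproduct.ι (fun _ : Fin n => Z) i := fun i => by
    apply biproduct.hom_ext; intro j
    rw [hτ]
    by_cases h : i = j
    · subst h; simp [hid]
    · rw [biproduct.ι_π_ne _ h, biproduct.ι_π_ne _ h, map_zero]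
  refine ⟨τ, ⟨fun a q => ?_, fun Y σ hσ =>
    ⟨biproduct.desc fun i => σ (biproduct.ι (fun _ : Fin n => Q) i), fun q => ?_⟩,
    fun {Y s s'} h => ?_⟩⟩
  · apply biproduct.hom_ext; intro i; simp [hτ, hmul]
  · have : q = ∑ i, (q ≫ biproduct.π (fun _ : Fin n => Q) i) ≫ 
        biproduct.ι (fun _ : Fin n => Q) i := by
      simp only [Category.assoc, ← Preadditive.comp_sum, biproduct.total, Category.comp_id]
    conv_rhs => rw [this]
    simp only [map_sum, hσ]
    rw [biproduct.desc_eq, Preadditive.comp_sum]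
    refine Finset.sum_congr rfl fun i _ => ?_
    rw [← Category.assoc, hτ]
  · apply biproduct.hom_ext'; intro i
    simpa [hτι] using h (biproduct.ι (fun _ : Fin n => Q) i)

/-- Since `Q` is projective, `Hom(Q, S.X₃)` is the cokernel of `Hom(Q, S.X₁) → Hom(Q, S.X₂)`, so the
universal target for `S.X₃` is the cokernel of the induced map of universal targets. -/
theorem isUniv_coker (hQ : IsProjGen Q) {S : ShortComplex X} (hS : S.Exact) (hg : Epi S.g)
    {W₁ W₂ : E} {τ₁ : (Q ⟶ S.X₁) →+ (Z ⟶ W₁)} {τ₂ : (Q ⟶ S.X₂) →+ (Z ⟶ W₂)}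
    (h₁ : IsUniv Θ τ₁) (h₂ : IsUniv Θ τ₂) :
    ∃ (W : E) (τ : (Q ⟶ S.X₃) →+ (Z ⟶ W)), IsUniv Θ τ := by
  have := hQ.projective
  obtain ⟨r, hr⟩ := h₁.desc W₂ (AddMonoidHom.mk' (fun q => τ₂ (q ≫ S.f)) (by simp))
    (by simp [h₂.equi])
  have hr' : ∀ q, τ₁ q ≫ r = τ₂ (q ≫ S.f) := hr
  -- Two lifts of the same map differ by something factoring through `S.f`; hence the choice of lift
  -- in the definition of `τ` is immaterial.
  have key : ∀ {Y : E} (s : W₂ ⟶ Y), r ≫ s = 0 → ∀ q q' : Q ⟶ S.X₂, q ≫ S.g = q' ≫ S.g →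
      τ₂ q ≫ s = τ₂ q' ≫ s := by
    intro Y s hs q q' h
    obtain ⟨b, hb⟩ : ∃ b : Q ⟶ S.X₁, b ≫ S.f = q - q' :=
      ⟨hS.liftFromProjective (q - q') (by simp [h]), hS.liftFromProjective_comp _ _⟩
    rw [← sub_eq_zero, ← Preadditive.sub_comp, ← map_sub, ← hb, ← hr', Category.assoc, hs,
      comp_zero]
  have hlift : ∀ q : Q ⟶ S.X₃, Projective.factorThru q S.g ≫ S.g = q :=
    fun q => Projective.factorThru_comp q S.g
  let τ : (Q ⟶ S.X₃) →+ (Z ⟶ cokernel r) :=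
    AddMonoidHom.mk' (fun q => τ₂ (Projective.factorThru q S.g) ≫ cokernel.π r) (fun a b => by
      rw [← Preadditive.add_comp, ← map_add]
      apply key _ (cokernel.condition r)
      simp [hlift])
  have hτ : ∀ q, τ (q ≫ S.g) = τ₂ q ≫ cokernel.π r := fun q =>
    key _ (cokernel.condition r) _ _ (hlift _)
  refine ⟨cokernel r, τ, ⟨fun a q => ?_, fun Y σ hσ => ?_, fun {Y s s'} h => ?_⟩⟩
  · obtain ⟨q, rfl⟩ := hQ.factor S.g q
    rw [hτ, ← Category.assoc, hτ, h₂.equi, Category.assoc]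
  · obtain ⟨s, hs⟩ := h₂.desc Y (AddMonoidHom.mk' (fun q => σ (q ≫ S.g)) (by simp))
      (by simp [hσ])
    have hs' : ∀ q, τ₂ q ≫ s = σ (q ≫ S.g) := hs
    refine ⟨cokernel.desc r s (h₁.hom_ext fun q => ?_), fun q => ?_⟩
    · rw [← Category.assoc, hr', hs']; simp
    · obtain ⟨q, rfl⟩ := hQ.factor S.g q
      rw [hτ, Category.assoc, cokernel.π_desc, hs']
  · rw [← cancel_epi (cokernel.π r)]
    refine h₂.hom_ext fun q => ?_
    rw [← Category.assoc, ← Category.assoc, ← hτ, h]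

theorem exists_isUniv (hQ : IsProjGen Q) (hid : Θ (𝟙 Q) = 𝟙 Z)
    (hmul : ∀ a b, Θ (a ≫ b) = Θ a ≫ Θ b) (U : X) :
    ∃ (W : E) (τ : (Q ⟶ U) →+ (Z ⟶ W)), IsUniv Θ τ := by
  obtain ⟨m, n, r, p, w, hex, hp⟩ := hQ.presentation U
  obtain ⟨τ₁, h₁⟩ := isUniv_power hid hmul m
  obtain ⟨τ₂, h₂⟩ := isUniv_power hid hmul n
  exact isUniv_coker hQ hex hp h₁ h₂

/-- An additive right exact functor with prescribed value on a projective generator. -/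
theorem IsProjGen.exists_functor (hQ : IsProjGen Q) (Θ : (Q ⟶ Q) →+ (Z ⟶ Z))
    (hid : Θ (𝟙 Q) = 𝟙 Z) (hmul : ∀ a b, Θ (a ≫ b) = Θ a ≫ Θ b) :
    ∃ (F : X ⥤ E) (e : F.obj Q ≅ Z), F.Additive ∧ PreservesFiniteColimits F ∧
      ∀ a : Q ⟶ Q, F.map a ≫ e.hom = e.hom ≫ Θ a := by
  choose W τ hτ using exists_isUniv hQ hid hmul
  have hmap : ∀ {U V : X} (f : U ⟶ V), ∃ s : W U ⟶ W V, ∀ q, τ U q ≫ s = τ V (q ≫ f) := by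
    intro U V f
    exact (hτ U).desc (W V) (AddMonoidHom.mk' (fun q => τ V (q ≫ f)) (by simp))
      (by simp [(hτ V).equi])
  choose map hm using @hmap
  let F : X ⥤ E :=
    { obj := W
      map := fun f => map f
      map_id := fun U => (hτ U).hom_ext fun q => by simp [hm]
      map_comp := fun {U V V'} f g => (hτ U).hom_ext fun q => by
        rw [hm, ← Category.assoc (τ U q), hm, hm, Category.assoc] }
  have : F.Additive := ⟨fun {U V f g} => (hτ U).hom_ext fun q => by
    change τ U q ≫ map (f + g) = τ U q ≫ (map f + map g)
    simp [hm]⟩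
  have hF : ∀ {U V : X} (f : U ⟶ V) (q : Q ⟶ U), τ U q ≫ F.map f = τ V (q ≫ f) :=
    fun f q => hm f q
  -- `Θ` is itself an equivariant map on `Hom(Q, Q)`; the morphism it induces out of `W Q` is the
  -- inverse.
  have hiso : IsIso (τ Q (𝟙 Q)) := by
    obtain ⟨s, hs⟩ := (hτ Q).desc Z Θ hmul
    refine ⟨s, by rw [hs, hid], (hτ Q).hom_ext fun q => ?_⟩
    rw [← Category.assoc, hs, ← (hτ Q).equi, Category.comp_id, Category.comp_id]
  refine ⟨F, (asIso (τ Q (𝟙 Q))).symm, inferInstance, ?_, fun a => ?_⟩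
  -- Right exactness: a map out of `F(S.X₂)` that kills `F(S.f)` descends, by lifting maps `Q ⟶
  -- S.X₃` through `S.g` and using the universal property of `W S.X₃`.
  · refine ((Functor.preservesFiniteColimits_tfae F).out 0 3 :).1 fun S hS => ?_
    have := hS.epi_g
    have := hQ.projective
    have hcok : ∀ {Y : E} (s : W S.X₂ ⟶ Y), F.map S.f ≫ s = 0 →
        ∃ s' : W S.X₃ ⟶ Y, F.map S.g ≫ s' = s := by
      intro Y s hs
      have key : ∀ q q' : Q ⟶ S.X₂, q ≫ S.g = q' ≫ S.g → τ _ q ≫ s = τ _ q' ≫ s := by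
        intro q q' h
        obtain ⟨b, hb⟩ : ∃ b : Q ⟶ S.X₁, b ≫ S.f = q - q' :=
          ⟨hS.exact.liftFromProjective (q - q') (by simp [h]),
            hS.exact.liftFromProjective_comp _ _⟩
        rw [← sub_eq_zero, ← Preadditive.sub_comp, ← map_sub, ← hb, ← hF, Category.assoc, hs,
          comp_zero]
      have hlift : ∀ q : Q ⟶ S.X₃, Projective.factorThru q S.g ≫ S.g = q :=
        fun q => Projective.factorThru_comp q S.g
      obtain ⟨s', hs'⟩ := (hτ S.X₃).desc Y
        (AddMonoidHom.mk' (fun q => τ _ (Projective.factorThru q S.g) ≫ s) (fun a b => by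
          rw [← Preadditive.add_comp, ← map_add]
          apply key
          simp [hlift])) (fun a q => by
            change τ _ _ ≫ s = Θ a ≫ τ _ _ ≫ s
            rw [← Category.assoc, ← (hτ _).equi]
            apply key
            simp [hlift])
      refine ⟨s', (hτ _).hom_ext fun q => ?_⟩
      rw [← Category.assoc, hF, hs']
      exact key _ _ (hlift _)
    have : Epi (F.map S.g) := by
      refine ⟨fun {Y} s s' h => (hτ S.X₃).hom_ext fun q => ?_⟩
      obtain ⟨q, rfl⟩ := hQ.factor S.g q
      rw [← hF, Category.assoc, Category.assoc, h]
    refine ⟨?_, this⟩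
    refine ShortComplex.exact_of_g_is_cokernel _ ?_
    refine CokernelCofork.IsColimit.ofπ _ _ (fun s hs => (hcok s hs).choose)
      (fun s hs => (hcok s hs).choose_spec) (fun s hs m hm => ?_)
    exact (cancel_epi (F.map S.g)).1 (hm.trans (hcok s hs).choose_spec.symm)
  · rw [Iso.symm_hom, asIso_inv, IsIso.comp_inv_eq, Category.assoc, IsIso.eq_inv_comp, hF,
      ← (hτ Q).equi, Category.id_comp, Category.comp_id]

end ProjGen

/-! ### Additivity and colimits of right exact functors -/

section Rex

variable {X : Type u₁} [Category.{v₁} X] [Abelian X]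
variable {E : Type u₂} [Category.{v₂} E] [Abelian E]

theorem additive_of_preservesFiniteColimits (F : X ⥤ E) [PreservesFiniteColimits F] :
    F.Additive := by
  have : F.PreservesZeroMorphisms := inferInstance
  have : PreservesBinaryBiproducts F :=
    preservesBinaryBiproducts_of_preservesBinaryCoproducts F
  exact Functor.additive_of_preservesBinaryBiproducts F

attribute [local instance] additive_of_preservesFiniteColimits

/-- A colimit of right exact functors is right exact. -/
theorem preservesFiniteColimits_pt {J : Type} [SmallCategory J] [FinCategory J]
    {K : J ⥤ X ⥤ E} (c : Cocone K) (hc : IsColimit c)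
    (h : ∀ j, PreservesFiniteColimits (K.obj j)) : PreservesFiniteColimits c.pt := by
  -- The colimit of `K` is `K.flip ⋙ colim`: the first factor is right exact pointwise, and `colim`
  -- preserves colimits as a left adjoint.
  have : PreservesFiniteColimits K.flip :=
    preservesFiniteColimits_of_evaluation _ fun j => h j
  let e : K.flip ⋙ colim ≅ c.pt :=
    NatIso.ofComponents
      (fun j => (colimit.isColimit (K.flip.obj j)).coconePointUniqueUpToIso
        (isColimitOfPreserves ((evaluation _ _).obj j) hc))
      (fun {i j} f => by
        refine colimit.hom_ext fun k => ?_
        have h₁ : ∀ (i) (k), colimit.ι (K.flip.obj i) k ≫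
            ((colimit.isColimit (K.flip.obj i)).coconePointUniqueUpToIso
              (isColimitOfPreserves ((evaluation _ _).obj i) hc)).hom = (c.ι.app k).app i :=
          fun i k => IsColimit.comp_coconePointUniqueUpToIso_hom _ _ _
        have h₂ : colimit.ι (K.flip.obj i) k ≫ (K.flip ⋙ colim).map f =
            (K.obj k).map f ≫ colimit.ι (K.flip.obj j) k := ι_colimMap _ _
        rw [← Category.assoc, h₂, Category.assoc, h₁, ← Category.assoc, h₁]
        exact (c.ι.app k).naturality f)
  have : PreservesFiniteColimits (K.flip ⋙ colim) := comp_preservesFiniteColimits _ _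
  exact preservesFiniteColimits_of_natIso e

end Rex

attribute [local instance] additive_of_preservesFiniteColimits

/-! ### Functors right exact in each of two variables -/

section Two

variable {X : Type u₁} [Category.{v₁} X] [Abelian X]
variable {Y : Type u₂} [Category.{v₂} Y] [Abelian Y]
variable {E : Type u₃} [Category.{v₃} E] [Abelian E]

/-- A functor of two variables is right exact in each variable. -/
structure IsBirex (H : X ⥤ Y ⥤ E) : Prop where
  left : ∀ U : X, PreservesFiniteColimits (H.obj U)
  right : ∀ V : Y, PreservesFiniteColimits (H.flip.obj V)

theorem IsBirex.preserves {H : X ⥤ Y ⥤ E} (h : IsBirex H) : PreservesFiniteColimits H :=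
  preservesFiniteColimits_of_evaluation _ fun V => h.right V

/-- A presentation of `U` makes `H U` a cokernel of a map between powers of `H P`, and colimits of
right exact functors are right exact. -/
theorem IsProjGen.preserves_obj {P : X} (hP : IsProjGen P) (H : X ⥤ Y ⥤ E)
    [PreservesFiniteColimits H] (h : PreservesFiniteColimits (H.obj P)) (U : X) :
    PreservesFiniteColimits (H.obj U) := by
  have hpow : ∀ n : ℕ, PreservesFiniteColimits (H.obj (⨁ fun _ : Fin n => P)) := fun n =>
    preservesFiniteColimits_pt _
      (isColimitOfPreserves H (biproduct.isColimit (fun _ : Fin n => P))) fun ⟨_⟩ => h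
  obtain ⟨m, n, r, p, w, hex, hp⟩ := hP.presentation U
  refine preservesFiniteColimits_pt _ (isColimitOfPreserves H hex.gIsCokernel) ?_
  rintro (_ | _)
  · exact hpow m
  · exact hpow n

variable {P : X} {P' : Y}

theorem isIso_of_isIso_app₂ (hP : IsProjGen P) (hP' : IsProjGen P')
    {H H' : X ⥤ Y ⥤ E} (h : IsBirex H) (h' : IsBirex H') (α : H ⟶ H')
    (hα : IsIso ((α.app P).app P')) : IsIso α := by
  have := h.preserves
  have := h.left P
  have := h'.preserves
  have := h'.left P
  exact hP.isIso_of_isIso_app α (hP'.isIso_of_isIso_app _ hα)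

/-- The one-variable extension is used twice: first in `Y` at the fixed object `P`, then in `X` for
functors with values in `Y ⥤ E`. -/
theorem exists_natTrans₂ (hP : IsProjGen P) (hP' : IsProjGen P')
    {H H' : X ⥤ Y ⥤ E} (h : IsBirex H) (h' : IsBirex H')
    (t : (H.obj P).obj P' ⟶ (H'.obj P).obj P')
    (ht : ∀ a : P ⟶ P, (H.map a).app P' ≫ t = t ≫ (H'.map a).app P')
    (ht' : ∀ b : P' ⟶ P', (H.obj P).map b ≫ t = t ≫ (H'.obj P).map b) :
    ∃ α : H ⟶ H', (α.app P).app P' = t := by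
  have := h.preserves
  have := h.left P
  have := h'.preserves
  have := h'.left P
  let β : H.obj P ⟶ H'.obj P := hP'.ext _ _ t ht'
  refine ⟨hP.ext H H' β fun a => hP'.natTrans_ext ?_, ?_⟩
  · simpa [β] using ht a
  · simp [β]

/-- The action `Θ'` yields `F : Y ⥤ E` with `F(P') ≅ Z`. Because `Θ` commutes with `Θ'`, it acts on
`F` by natural transformations, so the one-variable construction applies again with values in `Y ⥤
E`. -/
theorem exists_functor₂ (hP : IsProjGen P) (hP' : IsProjGen P')
    {Z : E} (Θ : (P ⟶ P) →+ (Z ⟶ Z)) (hid : Θ (𝟙 P) = 𝟙 Z)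
    (hmul : ∀ a b, Θ (a ≫ b) = Θ a ≫ Θ b)
    (Θ' : (P' ⟶ P') →+ (Z ⟶ Z)) (hid' : Θ' (𝟙 P') = 𝟙 Z)
    (hmul' : ∀ a b, Θ' (a ≫ b) = Θ' a ≫ Θ' b)
    (hcomm : ∀ a b, Θ a ≫ Θ' b = Θ' b ≫ Θ a) :
    ∃ (H : X ⥤ Y ⥤ E) (e : (H.obj P).obj P' ≅ Z), IsBirex H ∧
      (∀ a : P ⟶ P, (H.map a).app P' ≫ e.hom = e.hom ≫ Θ a) ∧
      (∀ b : P' ⟶ P', (H.obj P).map b ≫ e.hom = e.hom ≫ Θ' b) := by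
  obtain ⟨F, e₀, _, _, hF⟩ := hP'.exists_functor Θ' hid' hmul'
  have hF' : ∀ b, F.map b = e₀.hom ≫ Θ' b ≫ e₀.inv := fun b => by
    rw [← Category.assoc, ← hF]; simp
  let ψ (a : P ⟶ P) : F ⟶ F := hP'.ext F F (e₀.hom ≫ Θ a ≫ e₀.inv) (fun b => by
    simp only [hF', Category.assoc, Iso.inv_hom_id_assoc]
    rw [reassoc_of% (hcomm a b)])
  have hψ : ∀ a, (ψ a).app P' = e₀.hom ≫ Θ a ≫ e₀.inv := fun a => hP'.ext_app _ _ _ _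
  let Ψ : (P ⟶ P) →+ (F ⟶ F) := AddMonoidHom.mk' ψ (fun a b => hP'.natTrans_ext (by
    simp [hψ]))
  obtain ⟨H, e₁, _, _, hH⟩ := hP.exists_functor Ψ
    (hP'.natTrans_ext (by simp [Ψ, hψ, hid]))
    (fun a b => hP'.natTrans_ext (by simp [Ψ, hψ, hmul]))
  refine ⟨H, e₁.app P' ≪≫ e₀, ⟨fun U => ?_, fun V => ?_⟩, fun a => ?_, fun b => ?_⟩
  · exact hP.preserves_obj H (preservesFiniteColimits_of_natIso e₁.symm) U
  · exact comp_preservesFiniteColimits H ((evaluation Y E).obj V)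
  · have := congr_arg (fun α => NatTrans.app α P' ≫ e₀.hom) (hH a)
    simpa [Ψ, hψ] using this
  · have := e₁.hom.naturality b
    simp only [Iso.trans_hom, Iso.app_hom, Category.assoc]
    rw [reassoc_of% this, hF]

end Two

/-! ### Functors on a product category tested on a pair of generators -/

section Multi

theorem map_mkHom_comp {A : Type u₁} [Category.{v₁} A] {B : Type u₂} [Category.{v₂} B]
    {E : Type u₃} [Category.{v₃} E] (G : A × B ⥤ E) {U U' U'' : A} {V V' V'' : B}
    (f : U ⟶ U') (f' : U' ⟶ U'') (g : V ⟶ V') (g' : V' ⟶ V'') :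
    G.map (Prod.mkHom f g) ≫ G.map (Prod.mkHom f' g') =
      G.map (Prod.mkHom (f ≫ f') (g ≫ g')) :=
  (G.map_comp _ _).symm

variable {k : Type w} [Field k]
variable {A : Type u₁} [Category.{v₁} A] [Abelian A]
variable {B : Type u₂} [Category.{v₂} B] [Abelian B]
variable {E : Type u₃} [Category.{v₃} E] [Abelian E]

theorem IsMultiRightExact.isBirex [Linear k A] [Linear k B] [Linear k E] {G : A × B ⥤ E}
    (hG : IsMultiRightExact k G) : IsBirex (Functor.curry.obj G) where
  left U := (hG.fixLeft U).rightExact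
  right V := (hG.fixRight V).rightExact

variable {P : A} {P' : B}

theorem hom_ext_box (hP : IsProjGen P) (hP' : IsProjGen P') {G : A × B ⥤ E}
    (hG : IsBirex (Functor.curry.obj G)) {U : A} {V : B} {W : E} {s s' : G.obj (U, V) ⟶ W}
    (h : ∀ (f : P ⟶ U) (g : P' ⟶ V), G.map (Prod.mkHom f g) ≫ s = G.map (Prod.mkHom f g) ≫ s') :
    s = s' := by
  have := hG.left U
  have := hG.right P'
  refine hP'.hom_ext ((Functor.curry.obj G).obj U) fun g => ?_
  refine hP.hom_ext ((Functor.curry.obj G).flip.obj P') fun f => ?_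
  have hfg : ((Functor.curry.obj G).flip.obj P').map f ≫ ((Functor.curry.obj G).obj U).map g =
      G.map (Prod.mkHom f g) := by
    simp [← G.map_comp, Prod.mkHom]
  rw [← Category.assoc, ← Category.assoc, hfg, h]

theorem natTrans_ext_box (hP : IsProjGen P) (hP' : IsProjGen P') {G G' : A × B ⥤ E}
    (hG : IsBirex (Functor.curry.obj G)) {α β : G ⟶ G'} (h : α.app (P, P') = β.app (P, P')) :
    α = β := by
  ext ⟨U, V⟩
  refine hom_ext_box hP hP' hG fun f g => ?_
  rw [α.naturality, β.naturality, h]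

theorem exists_iso_box (hP : IsProjGen P) (hP' : IsProjGen P') {G G' : A × B ⥤ E}
    (hG : IsBirex (Functor.curry.obj G)) (hG' : IsBirex (Functor.curry.obj G'))
    (t : G.obj (P, P') ≅ G'.obj (P, P'))
    (ht : ∀ (a : P ⟶ P) (b : P' ⟶ P'),
      G.map (Prod.mkHom a b) ≫ t.hom = t.hom ≫ G'.map (Prod.mkHom a b)) :
    Nonempty (G ≅ G') := by
  obtain ⟨α, hα⟩ := exists_natTrans₂ hP hP' hG hG' t.hom (fun a => ht a (𝟙 _))
    (fun b => ht (𝟙 _) b)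
  have : IsIso α := isIso_of_isIso_app₂ hP hP' hG hG' α (by rw [hα]; infer_instance)
  exact ⟨Functor.fullyFaithfulCurry.preimageIso (asIso α)⟩

end Multi

/-! ### Linearity and the map on tensor products of Hom spaces -/

section Linear

variable {k : Type w} [Field k]
variable {A : Type u₁} [Category.{v₁} A] [Abelian A] [Linear k A]
variable {B : Type u₂} [Category.{v₂} B] [Abelian B] [Linear k B]
variable {E : Type u₃} [Category.{v₃} E] [Abelian E] [Linear k E]

theorem IsProjGen.linear {P : A} (hP : IsProjGen P) (F : A ⥤ E) [PreservesFiniteColimits F]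
    (h : ∀ c : k, F.map (c • 𝟙 P) = c • 𝟙 (F.obj P)) : F.Linear k where
  map_smul {U V} f c := hP.hom_ext F fun g => by
    have h₁ : g ≫ (c • f) = (c • 𝟙 P) ≫ g ≫ f := by simp
    rw [← F.map_comp, h₁, F.map_comp, h]
    simp

/-- A scalar on `U` or `V`, precomposed with a map from a generator, slides onto the generator; so
linearity has to be known only for scalar endomorphisms of `P` and `P'`. -/
theorem isMultiRightExact_of_gen {P : A} {P' : B} (hP : IsProjGen P) (hP' : IsProjGen P')
    {G : A × B ⥤ E} (hG : IsBirex (Functor.curry.obj G))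
    (h : ∀ c : k, G.map (Prod.mkHom (c • 𝟙 P) (𝟙 P')) = c • 𝟙 _)
    (h' : ∀ c : k, G.map (Prod.mkHom (𝟙 P) (c • 𝟙 P')) = c • 𝟙 _) : IsMultiRightExact k G := by
  have e₁ : ∀ {U U' : A} {V V' : B} (f : P ⟶ U) (a : U ⟶ U') (g : P' ⟶ V) (b : V ⟶ V') (c : k),
      G.map (Prod.mkHom f g) ≫ G.map (Prod.mkHom (c • a) b) =
      c • (G.map (Prod.mkHom f g) ≫ G.map (Prod.mkHom a b)) := by
    intro U U' V V' f a g b c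
    have : Prod.mkHom f g ≫ Prod.mkHom (c • a) b =
      Prod.mkHom (c • 𝟙 P) (𝟙 P') ≫ Prod.mkHom f g ≫ Prod.mkHom a b := by
      simp [Prod.mkHom]
    rw [← G.map_comp, this, G.map_comp, h, G.map_comp, Linear.smul_comp, Category.id_comp]
  have e₂ : ∀ {U U' : A} {V V' : B} (f : P ⟶ U) (a : U ⟶ U') (g : P' ⟶ V) (b : V ⟶ V') (c : k),
      G.map (Prod.mkHom f g) ≫ G.map (Prod.mkHom a (c • b)) =
      c • (G.map (Prod.mkHom f g) ≫ G.map (Prod.mkHom a b)) := by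
    intro U U' V V' f a g b c
    have : Prod.mkHom f g ≫ Prod.mkHom a (c • b) =
      Prod.mkHom (𝟙 P) (c • 𝟙 P') ≫ Prod.mkHom f g ≫ Prod.mkHom a b := by
      simp [Prod.mkHom]
    rw [← G.map_comp, this, G.map_comp, h', G.map_comp, Linear.smul_comp, Category.id_comp]
  constructor
  · intro a
    have : PreservesFiniteColimits (Prod.sectR a B ⋙ G) := hG.left a
    refine ⟨inferInstance, ⟨fun {V V'} b c => hom_ext_box hP hP' hG fun f g => ?_⟩, this⟩
    exact (e₂ f (𝟙 a) g b c).trans (Linear.comp_smul _ _ _ _ _ _).symm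
  · intro b
    have : PreservesFiniteColimits (Prod.sectL A b ⋙ G) := hG.right b
    refine ⟨inferInstance, ⟨fun {V V'} a c => hom_ext_box hP hP' hG fun f g => ?_⟩, this⟩
    exact (e₁ f a g (𝟙 b) c).trans (Linear.comp_smul _ _ _ _ _ _).symm

section

variable {G : A × B ⥤ E} {U U' : A} {V V' : B}

theorem map_mkHom_left (G : A × B ⥤ E) (f : U ⟶ U') (g : V ⟶ V') :
    G.map (Prod.mkHom f g) = G.map (Prod.mkHom f (𝟙 V)) ≫ G.map (Prod.mkHom (𝟙 U') g) := by
  simp [map_mkHom_comp]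

theorem IsMultiRightExact.map_add_left (hG : IsMultiRightExact k G) (f f' : U ⟶ U')
    (g : V ⟶ V') : G.map (Prod.mkHom (f + f') g) =
      G.map (Prod.mkHom f g) + G.map (Prod.mkHom f' g) := by
  have := (hG.fixRight V).additive
  have h : G.map (Prod.mkHom (f + f') (𝟙 V)) =
      G.map (Prod.mkHom f (𝟙 V)) + G.map (Prod.mkHom f' (𝟙 V)) :=
    (Prod.sectL A V ⋙ G).map_add
  rw [map_mkHom_left, h, Preadditive.add_comp, ← map_mkHom_left, ← map_mkHom_left]

theorem IsMultiRightExact.map_smul_left (hG : IsMultiRightExact k G) (c : k) (f : U ⟶ U')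
    (g : V ⟶ V') : G.map (Prod.mkHom (c • f) g) = c • G.map (Prod.mkHom f g) := by
  have := (hG.fixRight V).additive
  have := (hG.fixRight V).linear
  have h : G.map (Prod.mkHom (c • f) (𝟙 V)) = c • G.map (Prod.mkHom f (𝟙 V)) :=
    (Prod.sectL A V ⋙ G).map_smul c f
  rw [map_mkHom_left, h, Linear.smul_comp, ← map_mkHom_left]

theorem IsMultiRightExact.map_add_right (hG : IsMultiRightExact k G) (f : U ⟶ U')
    (g g' : V ⟶ V') : G.map (Prod.mkHom f (g + g')) =
      G.map (Prod.mkHom f g) + G.map (Prod.mkHom f g') := by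
  have := (hG.fixLeft U').additive
  have h : G.map (Prod.mkHom (𝟙 U') (g + g')) =
      G.map (Prod.mkHom (𝟙 U') g) + G.map (Prod.mkHom (𝟙 U') g') :=
    (Prod.sectR U' B ⋙ G).map_add
  rw [map_mkHom_left, h, Preadditive.comp_add, ← map_mkHom_left, ← map_mkHom_left]

theorem IsMultiRightExact.map_smul_right (hG : IsMultiRightExact k G) (c : k) (f : U ⟶ U')
    (g : V ⟶ V') : G.map (Prod.mkHom f (c • g)) = c • G.map (Prod.mkHom f g) := by
  have := (hG.fixLeft U').additive
  have := (hG.fixLeft U').linear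
  have h : G.map (Prod.mkHom (𝟙 U') (c • g)) = c • G.map (Prod.mkHom (𝟙 U') g) :=
    (Prod.sectR U' B ⋙ G).map_smul c g
  rw [map_mkHom_left, h, Linear.comp_smul, ← map_mkHom_left]

end

/-- The linear map `A(U, U') ⊗ B(V, V') → E(G(U, V), G(U', V'))` of a multilinear functor `G`. -/
def homMap {G : A × B ⥤ E} (hG : IsMultiRightExact k G) (U U' : A) (V V' : B) :
    (U ⟶ U') ⊗[k] (V ⟶ V') →ₗ[k] (G.obj (U, V) ⟶ G.obj (U', V')) :=
  TensorProduct.lift (LinearMap.mk₂ k (fun f g => G.map (Prod.mkHom f g))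
    hG.map_add_left hG.map_smul_left hG.map_add_right hG.map_smul_right)

@[simp]
theorem homMap_tmul {G : A × B ⥤ E} (hG : IsMultiRightExact k G) {U U' : A} {V V' : B}
    (f : U ⟶ U') (g : V ⟶ V') : homMap hG U U' V V' (f ⊗ₜ g) = G.map (Prod.mkHom f g) := rfl

end Linear

/-! ### A criterion for Deligne products -/

section Good

variable {k : Type w} [Field k]
variable {A : Type u₁} [Category.{v₁} A] [Abelian A] [Linear k A]
variable {B : Type u₂} [Category.{v₂} B] [Abelian B] [Linear k B]
variable {D : Type u₃} [Category.{v₃} D] [Abelian D] [Linear k D]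

/-- `box` is multilinear right exact, sends the pair of projective generators `(P, P')` to a
projective generator, and `End P ⊗ End P' → End (P ⊠ P')` is bijective. -/
structure IsBox (k : Type w) [Field k] [Linear k A] [Linear k B] [Linear k D]
    (P : A) (P' : B) (box : A × B ⥤ D) : Prop where
  left : IsProjGen P
  right : IsProjGen P'
  multi : IsMultiRightExact k box
  gen : IsProjGen (box.obj (P, P'))
  bij : Function.Bijective (homMap multi P P P' P')

variable {P : A} {P' : B} {box : A × B ⥤ D}
variable {E : Type u} [Category.{v} E] [Abelian E]

/-- Surjectivity in `bij` writes every endomorphism of `P ⊠ P'` as a finite sum of morphisms `a ⊠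
b`. -/
theorem IsBox.induction (h : IsBox k P P' box)
    {p : (box.obj (P, P') ⟶ box.obj (P, P')) → Prop}
    (hp : ∀ a b, p (box.map (Prod.mkHom a b))) (hadd : ∀ x y, p x → p y → p (x + y))
    (a : box.obj (P, P') ⟶ box.obj (P, P')) : p a := by
  obtain ⟨x, rfl⟩ := h.bij.2 a
  induction x with
  | zero =>
    have : box.map (Prod.mkHom (0 : P ⟶ P) (0 : P' ⟶ P')) = 0 :=
      (homMap_tmul h.multi _ _).symm.trans (by rw [TensorProduct.zero_tmul, map_zero])
    rw [map_zero, ← this]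
    exact hp 0 0
  | add x y hx hy => rw [map_add]; exact hadd _ _ hx hy
  | tmul a b => exact hp a b

theorem IsMultiRightExact.isBirex_comp (h : IsMultiRightExact k box) (F : D ⥤ E)
    [PreservesFiniteColimits F] : IsBirex (Functor.curry.obj (box ⋙ F)) where
  left U := by
    have := (h.fixLeft U).rightExact
    exact comp_preservesFiniteColimits (Prod.sectR U B ⋙ box) F
  right V := by
    have := (h.fixRight V).rightExact
    exact comp_preservesFiniteColimits (Prod.sectL A V ⋙ box) F

/-- Naturality of `α` gives equivariance of its component at `(P, P')` for the `a ⊠ b`, hence for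
all of `End (P ⊠ P')`. The extension from the generator agrees with `α` because it does so at `(P,
P')`. -/
theorem IsBox.exists_natTrans (h : IsBox k P P' box) {F F' : D ⥤ E}
    [PreservesFiniteColimits F] [PreservesFiniteColimits F'] (α : box ⋙ F ⟶ box ⋙ F') :
    ∃ β : F ⟶ F', Functor.whiskerLeft box β = α := by
  refine ⟨h.gen.ext F F' (α.app (P, P')) (h.induction (fun a b => α.naturality _) ?_), ?_⟩
  · intro x y hx hy
    rw [F.map_add, F'.map_add, Preadditive.add_comp, hx, hy, Preadditive.comp_add]
  · refine natTrans_ext_box h.left h.right (h.multi.isBirex_comp F) ?_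
    simp

theorem IsBox.natTrans_ext (h : IsBox k P P' box) {F F' : D ⥤ E}
    [PreservesFiniteColimits F] {α β : F ⟶ F'}
    (hαβ : Functor.whiskerLeft box α = Functor.whiskerLeft box β) : α = β :=
  h.gen.natTrans_ext (congr_app hαβ (P, P'))

theorem IsBox.nonempty_iso (h : IsBox k P P' box) {F F' : D ⥤ E}
    [PreservesFiniteColimits F] [PreservesFiniteColimits F'] (α : box ⋙ F ≅ box ⋙ F') :
    Nonempty {β : F ≅ F' // Functor.whiskerLeft box β.hom = α.hom} := by
  obtain ⟨β, hβ⟩ := h.exists_natTrans α.hom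
  have : IsIso β := h.gen.isIso_of_isIso_app β (by
    have : β.app (box.obj (P, P')) = α.hom.app (P, P') := congr_app hβ (P, P')
    rw [this]; infer_instance)
  exact ⟨asIso β, hβ⟩

/-- Through the inverse of `bij`, the action of `End P ⊗ End P'` on `G(P, P')` becomes an action of
`End (P ⊠ P')`, which determines a right exact functor `F`. The equivariant isomorphism at `(P, P')`
then spreads to `box ⋙ F ≅ G`. -/
theorem IsBox.nonempty_extension [Linear k E] (h : IsBox k P P' box) {G : A × B ⥤ E}
    (hG : IsMultiRightExact k G) : Nonempty (Extension k box G) := by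
  have := h.gen
  let e := LinearEquiv.ofBijective _ h.bij
  have he : ∀ x, homMap h.multi P P P' P' x = e x := fun _ => rfl
  let θ : (box.obj (P, P') ⟶ box.obj (P, P')) →ₗ[k] (G.obj (P, P') ⟶ G.obj (P, P')) :=
    homMap hG P P P' P' ∘ₗ e.symm.toLinearMap
  have hθ : ∀ a b, θ (box.map (Prod.mkHom a b)) = G.map (Prod.mkHom a b) := by
    intro a b
    have : e.symm (box.map (Prod.mkHom a b)) = a ⊗ₜ b := by
      rw [LinearEquiv.symm_apply_eq]; rfl
    simp [θ, this]
  have hid : θ (𝟙 _) = 𝟙 _ := by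
    have := hθ (𝟙 _) (𝟙 _)
    simpa using this
  have hmul : ∀ a b, θ (a ≫ b) = θ a ≫ θ b := by
    intro a b
    refine h.induction (p := fun a => θ (a ≫ b) = θ a ≫ θ b) (fun a₁ a₂ => ?_)
      (fun x y hx hy => by simp [hx, hy]) a
    refine h.induction (p := fun b => θ (_ ≫ b) = _ ≫ θ b) (fun b₁ b₂ => ?_)
      (fun x y hx hy => by simp [hx, hy]) b
    rw [map_mkHom_comp, hθ, hθ, hθ, map_mkHom_comp]
  obtain ⟨F, e₀, _, _, hF⟩ := h.gen.exists_functor θ.toAddMonoidHom hid hmul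
  have hlin : F.Linear k := h.gen.linear F fun c => by
    have h₁ := hF (c • 𝟙 _)
    have h₂ : θ.toAddMonoidHom (c • 𝟙 _) = c • 𝟙 _ := by
      change θ _ = _
      rw [map_smul, hid]
    rw [h₂, Linear.comp_smul, Category.comp_id] at h₁
    rw [← cancel_mono e₀.hom, h₁, Linear.smul_comp, Category.id_comp]
  obtain ⟨i⟩ := exists_iso_box h.left h.right (h.multi.isBirex_comp F) hG.isBirex e₀
    (fun a b => (hF _).trans (congr_arg (e₀.hom ≫ ·) (hθ a b)))
  exact ⟨⟨F, ⟨inferInstance, hlin, inferInstance⟩, i⟩⟩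

end Good

/-! ### The criterion yields a Deligne product and passes to every other one -/

section Deligne

variable {k : Type w} [Field k]
variable {A B D : Type u} [Category.{v} A] [Category.{v} B] [Category.{v} D]
variable [Abelian A] [Linear k A] [Abelian B] [Linear k B] [Abelian D] [Linear k D]
variable {P : A} {P' : B} {box : A × B ⥤ D}

theorem IsBox.isDeligneProduct (h : IsBox k P P' box) : IsDeligneProduct k box where
  multiRightExact := h.multi
  isEquivalence E _ _ _ :=
    { faithful := ⟨fun {F F'} f g hfg => by
        have := F.property.rightExact
        apply ObjectProperty.hom_ext
        exact h.natTrans_ext (congr_arg (fun α => α.hom) hfg)⟩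
      full := ⟨fun {F F'} f => by
        have := F.property.rightExact
        have := F'.property.rightExact
        obtain ⟨β, hβ⟩ := h.exists_natTrans (F := F.obj) (F' := F'.obj) f.hom
        exact ⟨ObjectProperty.homMk β, ObjectProperty.hom_ext _ hβ⟩⟩
      essSurj := ⟨fun G => by
        obtain ⟨e⟩ := h.nonempty_extension G.property
        exact ⟨⟨e.functor, e.isLinearRightExact⟩, ⟨ObjectProperty.isoMk _ e.iso⟩⟩⟩ }

theorem IsProjGen.of_iso {X : Type u₁} [Category.{v₁} X] [Abelian X] {Q Q' : X}
    (hQ : IsProjGen Q) (e : Q ≅ Q') : IsProjGen Q' where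
  projective := have := hQ.projective; Projective.of_iso e inferInstance
  exists_epi U := by
    obtain ⟨n, p, _⟩ := hQ.exists_epi U
    exact ⟨n, (biproduct.mapIso fun _ => e.symm).hom ≫ p, inferInstance⟩

theorem IsProjGen.map_equivalence {X : Type u₁} [Category.{v₁} X] [Abelian X] {Y : Type u₂}
    [Category.{v₂} Y] [Abelian Y] {Q : X} (hQ : IsProjGen Q) (F : X ⥤ Y) [F.IsEquivalence] :
    IsProjGen (F.obj Q) where
  projective := (F.asEquivalence.map_projective_iff Q).2 hQ.projective
  exists_epi U := by
    obtain ⟨n, p, _⟩ := hQ.exists_epi (F.objPreimage U)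
    have : F.Additive := Functor.additive_of_preserves_binary_products F
    exact ⟨n, (F.mapBiproduct _).inv ≫ F.map p ≫ (F.objObjPreimageIso U).hom, inferInstance⟩

/-- Any two Deligne products of the same categories are equivalent. -/
theorem IsBox.of_isDeligneProduct {D₀ : Type u} [Category.{v} D₀] [Abelian D₀] [Linear k D₀]
    {box₀ : A × B ⥤ D₀} (h : IsBox k P P' box₀) (hD : IsDeligneProduct k box) :
    IsBox k P P' box := by
  obtain ⟨F, hF, i⟩ := h.nonempty_extension hD.multiRightExact
  have := (hD.isEquivalence D).full
  have := (hD.isEquivalence D).faithful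
  obtain ⟨⟨G, hG⟩, ⟨j⟩⟩ := (hD.isEquivalence D₀).essSurj.mem_essImage ⟨box₀, h.multi⟩
  have j' : box ⋙ G ≅ box₀ := (ObjectProperty.ι _).mapIso j
  have := hF.additive
  have := hF.linear
  have := hF.rightExact
  have := hG.rightExact
  have := comp_preservesFiniteColimits F G
  -- `F` and `G` extend `box` and `box₀` along each other. One composite is identified with the
  -- identity by the criterion for `D₀`, the other by full faithfulness of precomposition with
  -- `box`.
  obtain ⟨u, -⟩ := h.nonempty_iso (F := F ⋙ G) (F' := 𝟭 D₀) (Functor.isoWhiskerRight i G ≪≫ j')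
  let c : (precomposition hD.multiRightExact D).obj ⟨G ⋙ F, hG.comp hF⟩ ≅
      (precomposition hD.multiRightExact D).obj
        ⟨𝟭 D, ⟨inferInstance, inferInstance, inferInstance⟩⟩ :=
    ObjectProperty.isoMk _ (Functor.isoWhiskerRight j' F ≪≫ i)
  let c' : G ⋙ F ≅ 𝟭 D := (ObjectProperty.ι _).mapIso (Functor.preimageIso _ c)
  have : F.IsEquivalence := (CategoryTheory.Equivalence.mk F G u.symm c').isEquivalence_functor
  refine ⟨h.left, h.right, hD.multiRightExact,
    (h.gen.map_equivalence F).of_iso (i.app (P, P')), ?_⟩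
  have key : ⇑(homMap hD.multiRightExact P P P' P') =
      ((i.app (P, P')).homCongr (i.app (P, P')) ∘ F.map) ∘ homMap h.multi P P P' P' := by
    funext x
    induction x with
    | zero => simp
    | add x y hx hy => simp [hx, hy]
    | tmul a b =>
      have := i.hom.naturality (Prod.mkHom a b)
      simp only [homMap_tmul]
      exact ((Iso.inv_comp_eq (i.app (P, P'))).2 this).symm
  rw [key]
  exact ((Equiv.bijective _).comp ((Functor.FullyFaithful.ofFullyFaithful F).map_bijective _ _)).comp
    h.bij

end Deligne

/-! ### Finitely generated modules over a noetherian algebra -/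

section Model

section Regular

variable (k : Type w) [Field k] (R : Type v) [Ring R] [Algebra k R] [IsNoetherianRing R]

/-- Right multiplication on the left regular module. -/
def rightMul : R →ₗ[k] (FGModuleCat.of R R ⟶ FGModuleCat.of R R) where
  toFun b := FGModuleCat.ofHom (LinearMap.toSpanSingleton R R b)
  map_add' a b := FGModuleCat.hom_ext (LinearMap.ext fun x => mul_add x a b)
  map_smul' c a := FGModuleCat.hom_ext (LinearMap.ext fun x =>
    (mul_smul_comm c x a).trans (Algebra.smul_def c (x * a)))

theorem rightMul_one : rightMul k R 1 = 𝟙 _ :=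
  FGModuleCat.hom_ext (LinearMap.ext fun x => mul_one x)

theorem rightMul_mul (a b : R) : rightMul k R (a * b) = rightMul k R a ≫ rightMul k R b :=
  FGModuleCat.hom_ext (LinearMap.ext fun x => (mul_assoc x a b).symm)

/-- An endomorphism of the left regular module is right multiplication by its value at `1`. In
diagrammatic order this identifies `End R` with `R` itself, without passing to the opposite ring. -/
theorem rightMul_bijective : Function.Bijective (rightMul k R) := by
  constructor
  · intro a b h
    have := congr_arg (fun f => f.hom.hom (1 : R)) h
    exact (one_mul a).symm.trans (this.trans (one_mul b))
  · intro f
    refine ⟨f.hom.hom (1 : R), FGModuleCat.hom_ext (LinearMap.ext fun x => ?_)⟩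
    have := f.hom.hom.map_smul x (1 : R)
    rw [smul_eq_mul, mul_one] at this
    exact this.symm

theorem FGModuleCat.epi_iff {R : Type v} [Ring R] [IsNoetherianRing R] {M N : FGModuleCat.{v} R}
    (f : M ⟶ N) : Epi f ↔ Function.Surjective f.hom.hom := by
  have h := ModuleCat.epi_iff_surjective ((forget₂ (FGModuleCat R) (ModuleCat R)).map f)
  constructor
  · intro _
    exact h.1 inferInstance
  · intro hf
    have := h.2 hf
    exact (forget₂ (FGModuleCat R) (ModuleCat R)).epi_of_epi_map this

theorem isProjGen_regular : IsProjGen (FGModuleCat.of.{v} R R) where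
  projective := by
    constructor
    intro E X f e he
    obtain ⟨y, hy⟩ := (FGModuleCat.epi_iff e).1 he (f.hom.hom (1 : R))
    refine ⟨FGModuleCat.ofHom (LinearMap.toSpanSingleton R E y),
      FGModuleCat.hom_ext (LinearMap.ext fun x => ?_)⟩
    change e.hom.hom ((x : R) • y) = f.hom.hom x
    have := f.hom.hom.map_smul x (1 : R)
    rw [smul_eq_mul, mul_one] at this
    rw [map_smul, hy]
    exact this.symm
  exists_epi U := by
    obtain ⟨n, f, hf⟩ := Module.Finite.exists_fin (R := R) (M := U)
    refine ⟨n, biproduct.desc fun i =>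
      FGModuleCat.ofHom (LinearMap.toSpanSingleton R U (f i)), (FGModuleCat.epi_iff _).2 ?_⟩
    rw [← LinearMap.range_eq_top, eq_top_iff, ← hf, Submodule.span_le]
    rintro _ ⟨i, rfl⟩
    refine ⟨(biproduct.ι (fun _ : Fin n => FGModuleCat.of R R) i).hom.hom (1 : R), ?_⟩
    have := congr_arg (fun g => g.hom.hom (1 : R)) (biproduct.ι_desc
      (fun i => FGModuleCat.ofHom (LinearMap.toSpanSingleton R U (f i))) i)
    refine this.trans (one_smul R (f i))

end Regular

/-! ### A copy of the module category in the required universe -/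

section Small

variable (R : Type v) [Ring R] [IsNoetherianRing R]

/-- A quotient of a finite free module. -/
def quotientModule (x : ULift.{max u v} (Σ n : ℕ, Submodule R (Fin n → R))) : FGModuleCat.{v} R :=
  FGModuleCat.of R ((Fin x.down.1 → R) ⧸ x.down.2)

/-- A small model of the category of finitely generated modules. -/
abbrev SmallFG : Type (max u v) := InducedCategory (FGModuleCat.{v} R) (quotientModule.{v, u} R)

instance : (inducedFunctor (quotientModule.{v, u} R)).EssSurj where
  mem_essImage M := by
    obtain ⟨n, f, hf⟩ := Module.Finite.exists_fin' R M
    exact ⟨⟨⟨n, LinearMap.ker f⟩⟩,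
      ⟨(LinearMap.quotKerEquivOfSurjective f hf).toFGModuleCatIso⟩⟩

instance : (inducedFunctor (quotientModule.{v, u} R)).IsEquivalence where

instance : HasFiniteProducts (SmallFG.{v, u} R) :=
  ⟨fun _ => Adjunction.hasLimitsOfShape_of_equivalence (inducedFunctor (quotientModule.{v, u} R))⟩

instance : Abelian (SmallFG.{v, u} R) :=
  abelianOfEquivalence (inducedFunctor (quotientModule.{v, u} R))

theorem exists_smallFG (k : Type w) [Field k] [Algebra k R] :
    ∃ (Q : SmallFG.{v, u} R) (φ : R →ₗ[k] (Q ⟶ Q)), IsProjGen Q ∧ Function.Bijective φ ∧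
      φ 1 = 𝟙 Q ∧ ∀ a b, φ (a * b) = φ a ≫ φ b := by
  let F := (inducedFunctor (quotientModule.{v, u} R)).inv
  have : F.Additive := Functor.additive_of_preserves_binary_products F
  have : F.Linear k := @Equivalence.inverseLinear k _ _ _ _ _ _ _ _ _
    (inducedFunctor (quotientModule.{v, u} R)).asEquivalence
    (inferInstanceAs ((inducedFunctor (quotientModule.{v, u} R)).Linear k))
  refine ⟨F.obj (FGModuleCat.of R R), F.mapLinearMap k ∘ₗ rightMul k R,
    (isProjGen_regular R).map_equivalence F, ?_, ?_, ?_⟩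
  · exact ((Functor.FullyFaithful.ofFullyFaithful F).map_bijective _ _).comp
      (rightMul_bijective k R)
  · simp [rightMul_one]
  · intro a b
    simp [rightMul_mul]

end Small

end Model

/-! ### Existence of the Deligne product -/

section Existence

variable {k : Type w} [Field k]
variable {A B : Type (max u v)} [Category.{v} A] [Category.{v} B]
variable [Abelian A] [Linear k A] [Abelian B] [Linear k B]

/-- The Deligne product of two finite `k`-linear abelian categories. -/
theorem exists_isBox {P : A} {P' : B} (hP : IsProjGen P) (hP' : IsProjGen P')
    [FiniteDimensional k (P ⟶ P)] [FiniteDimensional k (P' ⟶ P')] :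
    ∃ (D : Type (max u v)) (_ : Category.{v} D) (_ : Abelian D) (_ : Linear k D)
      (box : A × B ⥤ D), IsBox k P P' box := by
  have : Module.Finite k (End P) := inferInstanceAs (FiniteDimensional k (P ⟶ P))
  have : Module.Finite k (End P') := inferInstanceAs (FiniteDimensional k (P' ⟶ P'))
  have : Module.Finite k (End P)ᵐᵒᵖ := Module.Finite.equiv (MulOpposite.opLinearEquiv k)
  have : Module.Finite k (End P')ᵐᵒᵖ := Module.Finite.equiv (MulOpposite.opLinearEquiv k)
  -- Multiplication in `End P` is composition in the classical order; the opposite ring turns it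
  -- into `≫`, matching `φ`. The regular module `Q` of `R` is to become `P ⊠ P'`, with the two
  -- factors of `R` giving commuting actions of `End P` and `End P'`.
  let R := (End P)ᵐᵒᵖ ⊗[k] (End P')ᵐᵒᵖ
  have : IsNoetherianRing R := IsNoetherianRing.of_finite k R
  obtain ⟨Q, φ, hQ, hφ, hone, hmul⟩ := exists_smallFG.{w, v, u} R k
  let i : (P ⟶ P) ≃ₗ[k] (End P)ᵐᵒᵖ := MulOpposite.opLinearEquiv (M := End P) k
  let i' : (P' ⟶ P') ≃ₗ[k] (End P')ᵐᵒᵖ := MulOpposite.opLinearEquiv (M := End P') k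
  have hi : i (𝟙 P) = 1 := rfl
  have hi' : i' (𝟙 P') = 1 := rfl
  have him : ∀ a b, i (a ≫ b) = i a * i b := fun a b => rfl
  have him' : ∀ a b, i' (a ≫ b) = i' a * i' b := fun a b => rfl
  let θ : (P ⟶ P) →ₗ[k] (Q ⟶ Q) :=
    φ ∘ₗ (TensorProduct.mk k (End P)ᵐᵒᵖ (End P')ᵐᵒᵖ).flip 1 ∘ₗ i.toLinearMap
  let θ' : (P' ⟶ P') →ₗ[k] (Q ⟶ Q) :=
    φ ∘ₗ (TensorProduct.mk k (End P)ᵐᵒᵖ (End P')ᵐᵒᵖ) 1 ∘ₗ i'.toLinearMap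
  have hθ : ∀ a, θ a = φ (i a ⊗ₜ 1) := fun a => rfl
  have hθ' : ∀ b, θ' b = φ (1 ⊗ₜ i' b) := fun b => rfl
  obtain ⟨H, e, hH, he, he'⟩ := exists_functor₂ hP hP' θ.toAddMonoidHom hone
    (fun a b => by
      change θ _ = θ _ ≫ θ _
      rw [hθ, hθ, hθ, ← hmul, him, Algebra.TensorProduct.tmul_mul_tmul, one_mul])
    θ'.toAddMonoidHom hone
    (fun a b => by
      change θ' _ = θ' _ ≫ θ' _
      rw [hθ', hθ', hθ', ← hmul, him', Algebra.TensorProduct.tmul_mul_tmul, one_mul])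
    (fun a b => by
      change θ _ ≫ θ' _ = θ' _ ≫ θ _
      rw [hθ, hθ', ← hmul, ← hmul, Algebra.TensorProduct.tmul_mul_tmul,
        Algebra.TensorProduct.tmul_mul_tmul, one_mul, one_mul, mul_one, mul_one])
  have he : ∀ a : P ⟶ P, (H.map a).app P' ≫ e.hom = e.hom ≫ φ (i a ⊗ₜ 1) := he
  have he' : ∀ b : P' ⟶ P', (H.obj P).map b ≫ e.hom = e.hom ≫ φ (1 ⊗ₜ i' b) := he'
  let box : A × B ⥤ SmallFG.{v, u} R := Functor.uncurry.obj H
  have hbox : IsBirex (Functor.curry.obj box) := by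
    rw [Functor.curry_obj_uncurry_obj]; exact hH
  have hmap : ∀ a b, box.map (Prod.mkHom a b) ≫ e.hom = e.hom ≫ φ (i a ⊗ₜ i' b) := by
    intro a b
    change ((H.map a).app P' ≫ (H.obj P).map b) ≫ e.hom = _
    rw [Category.assoc, he', reassoc_of% (he a), ← hmul, Algebra.TensorProduct.tmul_mul_tmul,
      one_mul, mul_one]
  have hmulti : IsMultiRightExact k box := by
    refine isMultiRightExact_of_gen hP hP' hbox (fun c => ?_) (fun c => ?_)
    · have := hmap (c • 𝟙 P) (𝟙 P')
      rw [map_smul, ← TensorProduct.smul_tmul', hi, hi', map_smul,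
        ← Algebra.TensorProduct.one_def, hone, Linear.comp_smul, Category.comp_id] at this
      rw [← cancel_mono e.hom]
      refine this.trans ?_
      rw [Linear.smul_comp]
      exact congr_arg (c • ·) (Category.id_comp _).symm
    · have := hmap (𝟙 P) (c • 𝟙 P')
      rw [map_smul, TensorProduct.tmul_smul, hi, hi', map_smul,
        ← Algebra.TensorProduct.one_def, hone, Linear.comp_smul, Category.comp_id] at this
      rw [← cancel_mono e.hom]
      refine this.trans ?_
      rw [Linear.smul_comp]
      exact congr_arg (c • ·) (Category.id_comp _).symm
  refine ⟨SmallFG.{v, u} R, inferInstance, inferInstance, inferInstance, box, hP, hP', hmulti,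
    hQ.of_iso e.symm, ?_⟩
  have key : ⇑(homMap hmulti P P P' P') =
      (e.symm.homCongr e.symm ∘ φ) ∘ TensorProduct.congr i i' := by
    funext x
    induction x with
    | zero => simp
    | add x y hx hy => simp [hx, hy]
    | tmul a b =>
      have := hmap a b
      simp only [homMap_tmul]
      rw [← Iso.eq_comp_inv] at this
      refine this.trans ?_
      simp
  rw [key]
  exact ((Equiv.bijective _).comp hφ).comp (LinearEquiv.bijective _)

end Existence

/-- Serves to build natural isomorphisms with identity components between functors whose objects
agree only by definition. -/
theorem natural_refl {X : Type u₁} [Category.{v₁} X] {U V : X} {f g : U ⟶ V} (h : f = g) :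
    f ≫ (Iso.refl V).hom = (Iso.refl U).hom ≫ g := by
  simp [h]

/-! ### Linear right exact functors with values in functor categories -/

section FunctorCategory

variable {k : Type w} [Field k]
variable {X : Type u₁} [Category.{v₁} X] [Abelian X] [Linear k X]
variable {Y : Type u₂} [Category.{v₂} Y]
variable {E : Type u₃} [Category.{v₃} E] [Abelian E] [Linear k E]

theorem IsLinearRightExact.of_iso {F F' : X ⥤ E} (hF : IsLinearRightExact k F) (e : F ≅ F') :
    IsLinearRightExact k F' := by
  have := hF.rightExact
  have := hF.linear
  have : PreservesFiniteColimits F' := preservesFiniteColimits_of_natIso e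
  refine ⟨inferInstance, ⟨fun {U V} f c => ?_⟩, this⟩
  rw [← cancel_epi (e.hom.app U), ← e.hom.naturality, F.map_smul, Linear.comp_smul,
    Linear.smul_comp, e.hom.naturality]

theorem isLinearRightExact_of_evaluation (F : X ⥤ Y ⥤ E)
    (h : ∀ y, IsLinearRightExact k (F ⋙ (evaluation Y E).obj y)) : IsLinearRightExact k F := by
  have : PreservesFiniteColimits F :=
    preservesFiniteColimits_of_evaluation _ fun y => (h y).rightExact
  refine ⟨inferInstance, ⟨fun {U V} f c => NatTrans.ext (funext fun y => ?_)⟩, this⟩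
  exact (h y).linear.map_smul f c

theorem IsLinearRightExact.comp_evaluation {F : X ⥤ Y ⥤ E} (hF : IsLinearRightExact k F) (y : Y) :
    IsLinearRightExact k (F ⋙ (evaluation Y E).obj y) := by
  have := hF.rightExact
  have := hF.linear
  have : PreservesFiniteColimits (F ⋙ (evaluation Y E).obj y) := comp_preservesFiniteColimits _ _
  exact ⟨inferInstance, ⟨fun f c => congr_app (F.map_smul c f) y⟩, this⟩

theorem IsProjGen.isLinearRightExact_obj {Y : Type u₂} [Category.{v₂} Y] [Abelian Y] [Linear k Y]
    {P : X} (hP : IsProjGen P) (H : X ⥤ Y ⥤ E) [PreservesFiniteColimits H]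
    (h : IsLinearRightExact k (H.obj P)) (U : X) : IsLinearRightExact k (H.obj U) := by
  have := hP.preserves_obj H h.rightExact U
  refine ⟨inferInstance, ⟨fun {V V'} f c => ?_⟩, this⟩
  have : PreservesFiniteColimits (H ⋙ (evaluation Y E).obj V) := comp_preservesFiniteColimits _ _
  refine hP.hom_ext (H ⋙ (evaluation Y E).obj V) fun g => ?_
  change (H.map g).app V ≫ (H.obj U).map (c • f) = (H.map g).app V ≫ (c • (H.obj U).map f)
  rw [← (H.map g).naturality, h.linear.map_smul, Linear.smul_comp, (H.map g).naturality,
    Linear.comp_smul]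

theorem IsMultiRightExact.of_iso {A : Type u₁} [Category.{v₁} A] [Abelian A] [Linear k A]
    {B : Type u₂} [Category.{v₂} B] [Abelian B] [Linear k B] {G G' : A × B ⥤ E}
    (hG : IsMultiRightExact k G) (e : G ≅ G') : IsMultiRightExact k G' where
  fixLeft a := (hG.fixLeft a).of_iso (Functor.isoWhiskerLeft _ e)
  fixRight b := (hG.fixRight b).of_iso (Functor.isoWhiskerLeft _ e)

end FunctorCategory

/-! ### Extending the tensor product to a bifunctor -/

section Tensor

variable {k : Type w} [Field k]
variable {C : Type u} [Category.{v} C] [Abelian C] [Linear k C] [MonoidalCategory C]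
variable [MonoidalPreadditive C] [MonoidalLinear k C]
variable {D : Type u} [Category.{v} D] [Abelian D] [Linear k D]

/-- A bifunctor on `D` with `L a ⊗ L b ≅ L (a ⊗ b)` naturally in `a` and `b`. -/
structure TensorExtension {M : Type u₁} [Category.{v₁} M] [MonoidalCategory M]
    (L : M ⥤ D) where
  H : D ⥤ D ⥤ D
  m : ∀ a b : M, (H.obj (L.obj a)).obj (L.obj b) ≅ L.obj (a ⊗ b)
  m_left : ∀ {a a' : M} (f : a ⟶ a') (b : M),
    (H.map (L.map f)).app (L.obj b) ≫ (m a' b).hom = (m a b).hom ≫ L.map (f ▷ b)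
  m_right : ∀ (a : M) {b b' : M} (f : b ⟶ b'),
    (H.obj (L.obj a)).map (L.map f) ≫ (m a b').hom = (m a b).hom ≫ L.map (a ◁ f)

theorem RightExactTensor.tensorLeft (hrex : RightExactTensor C) (U : C) :
    IsLinearRightExact k (tensorLeft U) :=
  ⟨inferInstance, inferInstance, (hrex U).1⟩

theorem RightExactTensor.tensorRight (hrex : RightExactTensor C) (U : C) :
    IsLinearRightExact k (tensorRight U) :=
  ⟨inferInstance, inferInstance, (hrex U).2⟩

/-- The functor `(a, b) ↦ box (a ⊗ b)` is extended along `box` in one variable, with values in a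
functor category, then flipped and extended in the other. -/
theorem IsBox.nonempty_tensorExtension {P : C} {box : C × C ⥤ D} (h : IsBox k P P box)
    (hrex : RightExactTensor C) : ∃ T : TensorExtension box,
      (∀ X, IsLinearRightExact k (T.H.obj X)) ∧ ∀ Y, IsLinearRightExact k (T.H.flip.obj Y) := by
  let G : C × C ⥤ C × C ⥤ D := curriedTensor (C × C) ⋙ (Functor.whiskeringRight _ _ D).obj box
  have hG : IsMultiRightExact k G := by
    constructor
    · intro a
      refine isLinearRightExact_of_evaluation _ fun c => ?_
      exact ((hrex.tensorRight c.2).comp (h.multi.fixLeft (a ⊗ c.1))).of_iso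
        (NatIso.ofComponents (fun _ => Iso.refl _) fun f => natural_refl (by
          change box.map (Prod.mkHom (𝟙 (a ⊗ c.1)) (f ▷ c.2)) = box.map (Prod.mkHom (𝟙 a ▷ c.1) (f ▷ c.2))
          simp))
    · intro a
      refine isLinearRightExact_of_evaluation _ fun c => ?_
      exact ((hrex.tensorRight c.1).comp (h.multi.fixRight (a ⊗ c.2))).of_iso
        (NatIso.ofComponents (fun _ => Iso.refl _) fun f => natural_refl (by
          change box.map (Prod.mkHom (f ▷ c.1) (𝟙 (a ⊗ c.2))) = box.map (Prod.mkHom (f ▷ c.1) (𝟙 a ▷ c.2))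
          simp))
  have hG' : ∀ a, IsMultiRightExact k (G.obj a) := fun a =>
    ⟨fun c => ((hrex.tensorLeft a.2).comp (h.multi.fixLeft (a.1 ⊗ c))).of_iso
        (NatIso.ofComponents (fun _ => Iso.refl _) fun f => natural_refl (by
          change box.map (Prod.mkHom (𝟙 (a.1 ⊗ c)) (a.2 ◁ f)) = box.map (Prod.mkHom (a.1 ◁ 𝟙 c) (a.2 ◁ f))
          simp)),
      fun c => ((hrex.tensorLeft a.1).comp (h.multi.fixRight (a.2 ⊗ c))).of_iso
        (NatIso.ofComponents (fun _ => Iso.refl _) fun f => natural_refl (by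
          change box.map (Prod.mkHom (a.1 ◁ f) (𝟙 (a.2 ⊗ c))) = box.map (Prod.mkHom (a.1 ◁ f) (a.2 ◁ 𝟙 c))
          simp))⟩
  obtain ⟨F₁, hF₁, i₁⟩ := h.nonempty_extension hG
  have := hF₁.rightExact
  have hF₁' : IsMultiRightExact k (F₁.obj (box.obj (P, P))) :=
    (hG' (P, P)).of_iso (i₁.app (P, P)).symm
  -- The second extension requires right exactness in `b` for every `X` of `D`, not only for product
  -- objects; it propagates from the generator.
  have hF₁X : ∀ X, IsMultiRightExact k (F₁.obj X) := by
    intro X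
    constructor
    · intro a
      have := comp_preservesFiniteColimits F₁
        ((Functor.whiskeringLeft _ _ D).obj (Prod.sectR a C))
      exact h.gen.isLinearRightExact_obj
        (F₁ ⋙ (Functor.whiskeringLeft _ _ D).obj (Prod.sectR a C)) (hF₁'.fixLeft a) X
    · intro a
      have := comp_preservesFiniteColimits F₁
        ((Functor.whiskeringLeft _ _ D).obj (Prod.sectL C a))
      exact h.gen.isLinearRightExact_obj
        (F₁ ⋙ (Functor.whiskeringLeft _ _ D).obj (Prod.sectL C a)) (hF₁'.fixRight a) X
  have hF₁flip : IsMultiRightExact k F₁.flip :=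
    ⟨fun a => isLinearRightExact_of_evaluation _ fun X => (hF₁X X).fixLeft a,
      fun a => isLinearRightExact_of_evaluation _ fun X => (hF₁X X).fixRight a⟩
  obtain ⟨F₂, hF₂, i₂⟩ := h.nonempty_extension hF₁flip
  have := hF₂.rightExact
  refine ⟨⟨F₂.flip, fun a b => (i₂.app b).app (box.obj a) ≪≫ (i₁.app a).app b, ?_, ?_⟩,
    fun X => hF₂.comp_evaluation X, fun Y => ?_⟩
  · intro a a' f b
    have h₁ : (F₂.obj (box.obj b)).map (box.map f) ≫ (i₂.hom.app b).app _ =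
        (i₂.hom.app b).app _ ≫ (F₁.map (box.map f)).app b :=
      (i₂.hom.app b).naturality (box.map f)
    have h₂ := congr_app (i₁.hom.naturality f) b
    change (F₂.obj (box.obj b)).map (box.map f) ≫ (i₂.hom.app b).app _ ≫ (i₁.hom.app a').app b =
      ((i₂.hom.app b).app _ ≫ (i₁.hom.app a).app b) ≫ _
    refine ((reassoc_of% h₁) _).trans ?_
    rw [Category.assoc]
    exact congr_arg (_ ≫ ·) h₂
  · intro a b b' f
    have h₁ : (F₂.map (box.map f)).app _ ≫ (i₂.hom.app b').app _ =
        (i₂.hom.app b).app _ ≫ (F₁.obj (box.obj a)).map f :=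
      congr_app (i₂.hom.naturality f) (box.obj a)
    have h₂ := (i₁.hom.app a).naturality f
    change (F₂.map (box.map f)).app _ ≫ (i₂.hom.app b').app _ ≫ (i₁.hom.app a).app b' =
      ((i₂.hom.app b).app _ ≫ (i₁.hom.app a).app b) ≫ _
    refine ((reassoc_of% h₁) _).trans ?_
    rw [Category.assoc]
    exact congr_arg (_ ≫ ·) h₂
  · refine h.gen.isLinearRightExact_obj F₂ ?_ Y
    exact (hF₁.comp_evaluation (P, P)).of_iso (i₂.app (P, P)).symm

end Tensor

/-! ### Pentagon and triangle reduced to a generator -/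

/-- The laws of a monoidal category except for the pentagon and the triangle. -/
structure TensorLaws (D : Type u) [Category.{v} D] [MonoidalCategoryStruct D] : Prop where
  tensorHom_def : ∀ {X₁ Y₁ X₂ Y₂ : D} (f : X₁ ⟶ Y₁) (g : X₂ ⟶ Y₂), f ⊗ₘ g = f ▷ X₂ ≫ Y₁ ◁ g
  whiskerLeft_id : ∀ X Y : D, X ◁ 𝟙 Y = 𝟙 (X ⊗ Y)
  whiskerLeft_comp : ∀ (X : D) {Y Z W : D} (f : Y ⟶ Z) (g : Z ⟶ W),
    X ◁ (f ≫ g) = X ◁ f ≫ X ◁ g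
  id_whiskerRight : ∀ X Y : D, 𝟙 X ▷ Y = 𝟙 (X ⊗ Y)
  comp_whiskerRight : ∀ {X Y Z : D} (f : X ⟶ Y) (g : Y ⟶ Z) (W : D),
    (f ≫ g) ▷ W = f ▷ W ≫ g ▷ W
  whisker_exchange : ∀ {W X Y Z : D} (f : W ⟶ X) (g : Y ⟶ Z), W ◁ g ≫ f ▷ Z = f ▷ Y ≫ X ◁ g
  associator_left : ∀ {X X' : D} (f : X ⟶ X') (Y Z : D),
    (f ▷ Y) ▷ Z ≫ (α_ X' Y Z).hom = (α_ X Y Z).hom ≫ f ▷ (Y ⊗ Z)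
  associator_mid : ∀ (X : D) {Y Y' : D} (f : Y ⟶ Y') (Z : D),
    (X ◁ f) ▷ Z ≫ (α_ X Y' Z).hom = (α_ X Y Z).hom ≫ X ◁ (f ▷ Z)
  associator_right : ∀ (X Y : D) {Z Z' : D} (f : Z ⟶ Z'),
    (X ⊗ Y) ◁ f ≫ (α_ X Y Z').hom = (α_ X Y Z).hom ≫ X ◁ (Y ◁ f)
  leftUnitor : ∀ {X Y : D} (f : X ⟶ Y), 𝟙_ D ◁ f ≫ (λ_ Y).hom = (λ_ X).hom ≫ f
  rightUnitor : ∀ {X Y : D} (f : X ⟶ Y), f ▷ 𝟙_ D ≫ (ρ_ Y).hom = (ρ_ X).hom ≫ f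

namespace TensorLaws

variable {D : Type u} [Category.{v} D] [MonoidalCategoryStruct D]

/-- `X ⊗ -` as a functor. -/
def left (h : TensorLaws D) (X : D) : D ⥤ D where
  obj Y := X ⊗ Y
  map f := X ◁ f
  map_id := h.whiskerLeft_id X
  map_comp := h.whiskerLeft_comp X

/-- `- ⊗ Y` as a functor. -/
def right (h : TensorLaws D) (Y : D) : D ⥤ D where
  obj X := X ⊗ Y
  map f := f ▷ Y
  map_id X := h.id_whiskerRight X Y
  map_comp f g := h.comp_whiskerRight f g Y

/-- Both sides of the pentagon are natural in each variable by the laws alone. This lemma and its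
three successors allow the variables to be moved off the generator one after another. -/
theorem pentagon_naturality₁ (h : TensorLaws D) {X X' : D} (f : X ⟶ X') (Y Z W : D) :
    ((f ▷ Y) ▷ Z) ▷ W ≫ (α_ X' Y Z).hom ▷ W ≫ (α_ X' (Y ⊗ Z) W).hom ≫ X' ◁ (α_ Y Z W).hom =
        ((α_ X Y Z).hom ▷ W ≫ (α_ X (Y ⊗ Z) W).hom ≫ X ◁ (α_ Y Z W).hom) ≫
          f ▷ (Y ⊗ Z ⊗ W) ∧
      ((f ▷ Y) ▷ Z) ▷ W ≫ (α_ (X' ⊗ Y) Z W).hom ≫ (α_ X' Y (Z ⊗ W)).hom =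
        ((α_ (X ⊗ Y) Z W).hom ≫ (α_ X Y (Z ⊗ W)).hom) ≫ f ▷ (Y ⊗ Z ⊗ W) := by
  constructor
  · simp only [Category.assoc]
    rw [← Category.assoc, ← h.comp_whiskerRight, h.associator_left, h.comp_whiskerRight,
      Category.assoc, ((reassoc_of% h.associator_left f (Y ⊗ Z) W) _), ← h.whisker_exchange]
  · simp only [Category.assoc]
    rw [((reassoc_of% h.associator_left (f ▷ Y) Z W) _), h.associator_left]

theorem pentagon_naturality₂ (h : TensorLaws D) (X : D) {Y Y' : D} (f : Y ⟶ Y') (Z W : D) :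
    ((X ◁ f) ▷ Z) ▷ W ≫ (α_ X Y' Z).hom ▷ W ≫ (α_ X (Y' ⊗ Z) W).hom ≫ X ◁ (α_ Y' Z W).hom =
        ((α_ X Y Z).hom ▷ W ≫ (α_ X (Y ⊗ Z) W).hom ≫ X ◁ (α_ Y Z W).hom) ≫
          X ◁ (f ▷ (Z ⊗ W)) ∧
      ((X ◁ f) ▷ Z) ▷ W ≫ (α_ (X ⊗ Y') Z W).hom ≫ (α_ X Y' (Z ⊗ W)).hom =
        ((α_ (X ⊗ Y) Z W).hom ≫ (α_ X Y (Z ⊗ W)).hom) ≫ X ◁ (f ▷ (Z ⊗ W)) := by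
  constructor
  · simp only [Category.assoc]
    rw [← Category.assoc, ← h.comp_whiskerRight, h.associator_mid, h.comp_whiskerRight,
      Category.assoc, ((reassoc_of% h.associator_mid X (f ▷ Z) W) _), ← h.whiskerLeft_comp,
      h.associator_left, h.whiskerLeft_comp]
  · simp only [Category.assoc]
    rw [((reassoc_of% h.associator_left (X ◁ f) Z W) _), h.associator_mid]

theorem pentagon_naturality₃ (h : TensorLaws D) (X Y : D) {Z Z' : D} (f : Z ⟶ Z') (W : D) :
    ((X ⊗ Y) ◁ f) ▷ W ≫ (α_ X Y Z').hom ▷ W ≫ (α_ X (Y ⊗ Z') W).hom ≫ X ◁ (α_ Y Z' W).hom =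
        ((α_ X Y Z).hom ▷ W ≫ (α_ X (Y ⊗ Z) W).hom ≫ X ◁ (α_ Y Z W).hom) ≫
          X ◁ (Y ◁ (f ▷ W)) ∧
      ((X ⊗ Y) ◁ f) ▷ W ≫ (α_ (X ⊗ Y) Z' W).hom ≫ (α_ X Y (Z' ⊗ W)).hom =
        ((α_ (X ⊗ Y) Z W).hom ≫ (α_ X Y (Z ⊗ W)).hom) ≫ X ◁ (Y ◁ (f ▷ W)) := by
  constructor
  · simp only [Category.assoc]
    rw [← Category.assoc, ← h.comp_whiskerRight, h.associator_right, h.comp_whiskerRight,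
      Category.assoc, ((reassoc_of% h.associator_mid X (Y ◁ f) W) _), ← h.whiskerLeft_comp,
      h.associator_mid, h.whiskerLeft_comp]
  · simp only [Category.assoc]
    rw [((reassoc_of% h.associator_mid (X ⊗ Y) f W) _), h.associator_right]

theorem pentagon_naturality₄ (h : TensorLaws D) (X Y Z : D) {W W' : D} (f : W ⟶ W') :
    ((X ⊗ Y) ⊗ Z) ◁ f ≫ (α_ X Y Z).hom ▷ W' ≫ (α_ X (Y ⊗ Z) W').hom ≫ X ◁ (α_ Y Z W').hom =
        ((α_ X Y Z).hom ▷ W ≫ (α_ X (Y ⊗ Z) W).hom ≫ X ◁ (α_ Y Z W).hom) ≫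
          X ◁ (Y ◁ (Z ◁ f)) ∧
      ((X ⊗ Y) ⊗ Z) ◁ f ≫ (α_ (X ⊗ Y) Z W').hom ≫ (α_ X Y (Z ⊗ W')).hom =
        ((α_ (X ⊗ Y) Z W).hom ≫ (α_ X Y (Z ⊗ W)).hom) ≫ X ◁ (Y ◁ (Z ◁ f)) := by
  constructor
  · simp only [Category.assoc]
    rw [((reassoc_of% h.whisker_exchange (α_ X Y Z).hom f) _),
      ((reassoc_of% h.associator_right X (Y ⊗ Z) f) _), ← h.whiskerLeft_comp,
      h.associator_right, h.whiskerLeft_comp]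
  · simp only [Category.assoc]
    rw [((reassoc_of% h.associator_right (X ⊗ Y) Z f) _), h.associator_right]

variable [Abelian D]

/-- The tensor product is right exact in each variable. -/
structure RightExact (h : TensorLaws D) : Prop where
  left : ∀ X : D, PreservesFiniteColimits (h.left X)
  right : ∀ X : D, PreservesFiniteColimits (h.right X)

/-- The source of the pentagon is right exact in each variable, so maps out of it are tested on maps
from `Q`. Replacing `Q` by an arbitrary object in one slot at a time passes from `Q, Q, Q, Q` to `X,
Y, Z, W`. -/
theorem pentagon_of_gen {h : TensorLaws D} (hr : h.RightExact) {Q : D} (hQ : IsProjGen Q)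
    (hp : (α_ Q Q Q).hom ▷ Q ≫ (α_ Q (Q ⊗ Q) Q).hom ≫ Q ◁ (α_ Q Q Q).hom =
      (α_ (Q ⊗ Q) Q Q).hom ≫ (α_ Q Q (Q ⊗ Q)).hom) (X Y Z W : D) :
    (α_ X Y Z).hom ▷ W ≫ (α_ X (Y ⊗ Z) W).hom ≫ X ◁ (α_ Y Z W).hom =
      (α_ (X ⊗ Y) Z W).hom ≫ (α_ X Y (Z ⊗ W)).hom := by
  have := hr.left
  have := hr.right
  have h₁ : ∀ X : D, (α_ X Q Q).hom ▷ Q ≫ (α_ X (Q ⊗ Q) Q).hom ≫ X ◁ (α_ Q Q Q).hom =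
      (α_ (X ⊗ Q) Q Q).hom ≫ (α_ X Q (Q ⊗ Q)).hom := fun X => by
    have := comp_preservesFiniteColimits (h.right Q) (h.right Q)
    have := comp_preservesFiniteColimits (h.right Q ⋙ h.right Q) (h.right Q)
    refine hQ.hom_ext ((h.right Q ⋙ h.right Q) ⋙ h.right Q) fun f => ?_
    have e := h.pentagon_naturality₁ f Q Q Q
    rw [hp] at e
    exact e.1.trans e.2.symm
  have h₂ : ∀ X Y : D, (α_ X Y Q).hom ▷ Q ≫ (α_ X (Y ⊗ Q) Q).hom ≫ X ◁ (α_ Y Q Q).hom =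
      (α_ (X ⊗ Y) Q Q).hom ≫ (α_ X Y (Q ⊗ Q)).hom := fun X Y => by
    have := comp_preservesFiniteColimits (h.left X) (h.right Q)
    have := comp_preservesFiniteColimits (h.left X ⋙ h.right Q) (h.right Q)
    refine hQ.hom_ext ((h.left X ⋙ h.right Q) ⋙ h.right Q) fun f => ?_
    have e := h.pentagon_naturality₂ X f Q Q
    rw [h₁] at e
    exact e.1.trans e.2.symm
  have h₃ : ∀ X Y Z : D, (α_ X Y Z).hom ▷ Q ≫ (α_ X (Y ⊗ Z) Q).hom ≫ X ◁ (α_ Y Z Q).hom =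
      (α_ (X ⊗ Y) Z Q).hom ≫ (α_ X Y (Z ⊗ Q)).hom := fun X Y Z => by
    have := comp_preservesFiniteColimits (h.left (X ⊗ Y)) (h.right Q)
    refine hQ.hom_ext (h.left (X ⊗ Y) ⋙ h.right Q) fun f => ?_
    have e := h.pentagon_naturality₃ X Y f Q
    rw [h₂] at e
    exact e.1.trans e.2.symm
  refine hQ.hom_ext (h.left ((X ⊗ Y) ⊗ Z)) fun f => ?_
  have e := h.pentagon_naturality₄ X Y Z f
  rw [h₃] at e
  exact e.1.trans e.2.symm

theorem triangle_of_gen {h : TensorLaws D} (hr : h.RightExact) {Q : D} (hQ : IsProjGen Q)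
    (hp : (α_ Q (𝟙_ D) Q).hom ≫ Q ◁ (λ_ Q).hom = (ρ_ Q).hom ▷ Q) (X Y : D) :
    (α_ X (𝟙_ D) Y).hom ≫ X ◁ (λ_ Y).hom = (ρ_ X).hom ▷ Y := by
  have := hr.left
  have := hr.right
  have h₁ : ∀ X : D, (α_ X (𝟙_ D) Q).hom ≫ X ◁ (λ_ Q).hom = (ρ_ X).hom ▷ Q := fun X => by
    have := comp_preservesFiniteColimits (h.right (𝟙_ D)) (h.right Q)
    refine hQ.hom_ext (h.right (𝟙_ D) ⋙ h.right Q) fun f => ?_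
    change (f ▷ 𝟙_ D) ▷ Q ≫ _ = (f ▷ 𝟙_ D) ▷ Q ≫ _
    rw [((reassoc_of% h.associator_left f (𝟙_ D) Q) _), ← h.whisker_exchange,
      ← h.comp_whiskerRight, h.rightUnitor, h.comp_whiskerRight, ← Category.assoc, hp]
  refine hQ.hom_ext (h.left (X ⊗ 𝟙_ D)) fun f => ?_
  change (X ⊗ 𝟙_ D) ◁ f ≫ _ = (X ⊗ 𝟙_ D) ◁ f ≫ _
  rw [((reassoc_of% h.associator_right X (𝟙_ D) f) _), ← h.whiskerLeft_comp, h.leftUnitor,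
    h.whiskerLeft_comp, ← Category.assoc, h₁, h.whisker_exchange]

end TensorLaws

/-! ### Coherence transported along a compatible functor -/

section Strong

variable {D : Type u} [Category.{v} D] [MonoidalCategoryStruct D]
variable {M : Type u₁} [Category.{v₁} M] [MonoidalCategory M]

/-- A functor which is compatible with the tensor products, associators and unitors. -/
structure StrongData (L : M ⥤ D) where
  e : 𝟙_ D ≅ L.obj (𝟙_ M)
  m : ∀ a b : M, L.obj a ⊗ L.obj b ≅ L.obj (a ⊗ b)
  m_left : ∀ {a a' : M} (f : a ⟶ a') (b : M),
    L.map f ▷ L.obj b ≫ (m a' b).hom = (m a b).hom ≫ L.map (f ▷ b)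
  m_right : ∀ (a : M) {b b' : M} (f : b ⟶ b'),
    L.obj a ◁ L.map f ≫ (m a b').hom = (m a b).hom ≫ L.map (a ◁ f)
  associator : ∀ a b c : M,
    (α_ (L.obj a) (L.obj b) (L.obj c)).hom ≫ L.obj a ◁ (m b c).hom ≫ (m a (b ⊗ c)).hom =
      (m a b).hom ▷ L.obj c ≫ (m (a ⊗ b) c).hom ≫ L.map (α_ a b c).hom
  leftUnitor : ∀ a : M,
    (λ_ (L.obj a)).hom = e.hom ▷ L.obj a ≫ (m (𝟙_ M) a).hom ≫ L.map (λ_ a).hom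
  rightUnitor : ∀ a : M,
    (ρ_ (L.obj a)).hom = L.obj a ◁ e.hom ≫ (m a (𝟙_ M)).hom ≫ L.map (ρ_ a).hom

variable {L : M ⥤ D}

/-- After composition with the invertible structure maps into `L (a ⊗ b ⊗ c ⊗ d)`, both sides become
a common map followed by `L` of the two sides of the pentagon in `M`. -/
theorem StrongData.pentagon (S : StrongData L) (h : TensorLaws D) (a b c d : M) :
    (α_ (L.obj a) (L.obj b) (L.obj c)).hom ▷ L.obj d ≫
        (α_ (L.obj a) (L.obj b ⊗ L.obj c) (L.obj d)).hom ≫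
          L.obj a ◁ (α_ (L.obj b) (L.obj c) (L.obj d)).hom =
      (α_ (L.obj a ⊗ L.obj b) (L.obj c) (L.obj d)).hom ≫
        (α_ (L.obj a) (L.obj b) (L.obj c ⊗ L.obj d)).hom := by
  have hl : ∀ (X : D) {Y Z : D} (i : Y ≅ Z), IsIso (X ◁ i.hom) := fun X Y Z i =>
    ⟨X ◁ i.inv, by rw [← h.whiskerLeft_comp, i.hom_inv_id, h.whiskerLeft_id],
      by rw [← h.whiskerLeft_comp, i.inv_hom_id, h.whiskerLeft_id]⟩
  have := hl (L.obj b) (S.m c d)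
  have : IsIso (L.obj a ◁ (L.obj b ◁ (S.m c d).hom)) :=
    hl (L.obj a) (asIso (L.obj b ◁ (S.m c d).hom))
  have := hl (L.obj a) (S.m b (c ⊗ d))
  rw [← cancel_mono (L.obj a ◁ (L.obj b ◁ (S.m c d).hom)),
    ← cancel_mono (L.obj a ◁ (S.m b (c ⊗ d)).hom), ← cancel_mono (S.m a (b ⊗ c ⊗ d)).hom]
  simp only [Category.assoc]
  trans ((S.m a b).hom ▷ L.obj c) ▷ L.obj d ≫ (S.m (a ⊗ b) c).hom ▷ L.obj d ≫
    (S.m ((a ⊗ b) ⊗ c) d).hom ≫ L.map ((α_ a b c).hom ▷ d ≫ (α_ a (b ⊗ c) d).hom ≫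
      a ◁ (α_ b c d).hom)
  · have h₁ : L.obj a ◁ (α_ (L.obj b) (L.obj c) (L.obj d)).hom ≫
        L.obj a ◁ (L.obj b ◁ (S.m c d).hom) ≫ L.obj a ◁ (S.m b (c ⊗ d)).hom =
        L.obj a ◁ ((S.m b c).hom ▷ L.obj d) ≫ L.obj a ◁ (S.m (b ⊗ c) d).hom ≫
          L.obj a ◁ L.map (α_ b c d).hom := by
      simp only [← h.whiskerLeft_comp, S.associator]
    have h₂ := S.associator a (b ⊗ c) d
    have h₃ : (α_ (L.obj a) (L.obj b) (L.obj c)).hom ▷ L.obj d ≫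
        (L.obj a ◁ (S.m b c).hom) ▷ L.obj d ≫ (S.m a (b ⊗ c)).hom ▷ L.obj d =
        ((S.m a b).hom ▷ L.obj c) ▷ L.obj d ≫ (S.m (a ⊗ b) c).hom ▷ L.obj d ≫
          L.map (α_ a b c).hom ▷ L.obj d := by
      simp only [← h.comp_whiskerRight, S.associator]
    rw [((reassoc_of% h₁) _), S.m_right,
      ((reassoc_of% (h.associator_mid (L.obj a) (S.m b c).hom (L.obj d)).symm) _),
      ((reassoc_of% h₂) _), ((reassoc_of% h₃) _), ((reassoc_of% (S.m_left (α_ a b c).hom d)) _),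
      ← L.map_comp, ← L.map_comp]
  · have h₁ := h.associator_right (L.obj a) (L.obj b) (S.m c d).hom
    have h₂ := h.associator_left (S.m a b).hom (L.obj c) (L.obj d)
    rw [((reassoc_of% h₁.symm) _), S.associator,
      ((reassoc_of% (h.whisker_exchange (S.m a b).hom (S.m c d).hom)) _),
      ((reassoc_of% h₂.symm) _), ((reassoc_of% (S.associator (a ⊗ b) c d)) _), ← L.map_comp,
      MonoidalCategory.pentagon]

theorem StrongData.triangle (S : StrongData L) (h : TensorLaws D) (a b : M) :
    (α_ (L.obj a) (𝟙_ D) (L.obj b)).hom ≫ L.obj a ◁ (λ_ (L.obj b)).hom =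
      (ρ_ (L.obj a)).hom ▷ L.obj b := by
  rw [S.leftUnitor, S.rightUnitor, ← cancel_mono (S.m a b).hom]
  simp only [h.whiskerLeft_comp, h.comp_whiskerRight, Category.assoc]
  rw [S.m_right, S.m_left, ((reassoc_of% (h.associator_mid (L.obj a) S.e.hom (L.obj b)).symm) _),
    ((reassoc_of% (S.associator a (𝟙_ M) b)) _), ← L.map_comp, MonoidalCategory.triangle]

/-- A monoidal category structure, from the laws and the coherence on a generator. -/
@[reducible]
def TensorLaws.monoidalCategory [Abelian D] {h : TensorLaws D} (hr : h.RightExact)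
    (S : StrongData L) {p : M} (hp : IsProjGen (L.obj p)) : MonoidalCategory D where
  tensorHom_def := h.tensorHom_def
  id_tensorHom_id X Y := by
    rw [h.tensorHom_def, h.id_whiskerRight, h.whiskerLeft_id, Category.comp_id]
  tensorHom_comp_tensorHom f₁ f₂ g₁ g₂ := by
    simp only [h.tensorHom_def, h.comp_whiskerRight, h.whiskerLeft_comp, Category.assoc]
    rw [((reassoc_of% (h.whisker_exchange g₁ f₂)) _)]
  whiskerLeft_id := h.whiskerLeft_id
  id_whiskerRight := h.id_whiskerRight
  associator_naturality f g k := by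
    simp only [h.tensorHom_def, h.comp_whiskerRight, h.whiskerLeft_comp, Category.assoc]
    rw [h.associator_right, ((reassoc_of% (h.associator_mid _ g _)) _),
      ((reassoc_of% (h.associator_left f _ _)) _)]
  leftUnitor_naturality := h.leftUnitor
  rightUnitor_naturality := h.rightUnitor
  pentagon := TensorLaws.pentagon_of_gen hr hp (S.pentagon h p p p p)
  triangle := TensorLaws.triangle_of_gen hr hp (S.triangle h p p)

end Strong

/-! ### Extending trifunctor isomorphisms from product objects -/

section ThreeVariables

variable {k : Type w} [Field k]
variable {A : Type u₁} [Category.{v₁} A] [Abelian A] [Linear k A]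
variable {B : Type u₂} [Category.{v₂} B] [Abelian B] [Linear k B]
variable {D : Type u₃} [Category.{v₃} D] [Abelian D] [Linear k D]
variable {P : A} {P' : B} {box : A × B ⥤ D}
variable {E : Type u} [Category.{v} E] [Abelian E]

/-- The isomorphism is extended from product objects one variable at a time, starting with the last.
Naturality in the variables still to be extended holds because it can be checked on product objects.
-/
theorem IsBox.exists_iso₃ (h : IsBox k P P' box) {F F' : D ⥤ D ⥤ D ⥤ E}
    [PreservesFiniteColimits F] [PreservesFiniteColimits F']
    (h₁ : ∀ X, PreservesFiniteColimits (F.obj X)) (h₁' : ∀ X, PreservesFiniteColimits (F'.obj X))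
    (h₂ : ∀ X Y, PreservesFiniteColimits ((F.obj X).obj Y))
    (h₂' : ∀ X Y, PreservesFiniteColimits ((F'.obj X).obj Y))
    (t : ∀ a b c, ((F.obj (box.obj a)).obj (box.obj b)).obj (box.obj c) ≅
      ((F'.obj (box.obj a)).obj (box.obj b)).obj (box.obj c))
    (n₁ : ∀ {a a'} (f : a ⟶ a') (b c),
      ((F.map (box.map f)).app (box.obj b)).app (box.obj c) ≫ (t a' b c).hom =
        (t a b c).hom ≫ ((F'.map (box.map f)).app (box.obj b)).app (box.obj c))
    (n₂ : ∀ (a) {b b'} (f : b ⟶ b') (c),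
      ((F.obj (box.obj a)).map (box.map f)).app (box.obj c) ≫ (t a b' c).hom =
        (t a b c).hom ≫ ((F'.obj (box.obj a)).map (box.map f)).app (box.obj c))
    (n₃ : ∀ (a b) {c c'} (f : c ⟶ c'),
      ((F.obj (box.obj a)).obj (box.obj b)).map (box.map f) ≫ (t a b c').hom =
        (t a b c).hom ≫ ((F'.obj (box.obj a)).obj (box.obj b)).map (box.map f)) :
    ∃ α : F ≅ F', ∀ a b c,
      ((α.hom.app (box.obj a)).app (box.obj b)).app (box.obj c) = (t a b c).hom := by
  have ht₁ : ∀ a b, ∃ β : (F.obj (box.obj a)).obj (box.obj b) ≅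
      (F'.obj (box.obj a)).obj (box.obj b), ∀ c, β.hom.app (box.obj c) = (t a b c).hom := by
    intro a b
    obtain ⟨β, hβ⟩ := h.nonempty_iso (F := (F.obj (box.obj a)).obj (box.obj b))
      (F' := (F'.obj (box.obj a)).obj (box.obj b)) (NatIso.ofComponents (t a b) (n₃ a b))
    exact ⟨β, congr_app hβ⟩
  choose t₁ ht₁ using ht₁
  have hn₁ : ∀ a {b b'} (f : b ⟶ b'), (F.obj (box.obj a)).map (box.map f) ≫ (t₁ a b').hom =
      (t₁ a b).hom ≫ (F'.obj (box.obj a)).map (box.map f) := fun a b b' f =>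
    h.natTrans_ext (NatTrans.ext (funext fun c => by
      change ((F.obj (box.obj a)).map (box.map f)).app (box.obj c) ≫ (t₁ a _).hom.app _ =
        (t₁ a _).hom.app _ ≫ ((F'.obj (box.obj a)).map (box.map f)).app (box.obj c)
      rw [ht₁, ht₁, n₂]))
  have ht₂ : ∀ a, ∃ β : F.obj (box.obj a) ≅ F'.obj (box.obj a),
      ∀ b, β.hom.app (box.obj b) = (t₁ a b).hom := by
    intro a
    obtain ⟨β, hβ⟩ := h.nonempty_iso (F := F.obj (box.obj a)) (F' := F'.obj (box.obj a))
      (NatIso.ofComponents (t₁ a) (hn₁ a))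
    exact ⟨β, congr_app hβ⟩
  choose t₂ ht₂ using ht₂
  have hn₂ : ∀ {a a'} (f : a ⟶ a'), F.map (box.map f) ≫ (t₂ a').hom =
      (t₂ a).hom ≫ F'.map (box.map f) := fun {a a'} f =>
    h.natTrans_ext (NatTrans.ext (funext fun b => by
      change (F.map (box.map f)).app (box.obj b) ≫ (t₂ _).hom.app (box.obj b) =
        (t₂ _).hom.app (box.obj b) ≫ (F'.map (box.map f)).app (box.obj b)
      refine h.natTrans_ext (NatTrans.ext (funext fun c => ?_))
      change ((F.map (box.map f)).app (box.obj b)).app (box.obj c) ≫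
            ((t₂ _).hom.app (box.obj b)).app (box.obj c) =
          ((t₂ _).hom.app (box.obj b)).app (box.obj c) ≫
            ((F'.map (box.map f)).app (box.obj b)).app (box.obj c)
      rw [ht₂, ht₂, ht₁, ht₁, n₁]))
  obtain ⟨β, hβ⟩ := h.nonempty_iso (F := F) (F' := F') (NatIso.ofComponents t₂ hn₂)
  refine ⟨β, fun a b c => ?_⟩
  have : β.hom.app (box.obj a) = (t₂ a).hom := congr_app hβ a
  rw [this, ht₂, ht₁]

end ThreeVariables

/-! ### The monoidal structure on the Deligne product -/

section Tensor

variable {k : Type w} [Field k]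
variable {C : Type u} [Category.{v} C] [Abelian C] [Linear k C] [MonoidalCategory C]
variable [MonoidalPreadditive C] [MonoidalLinear k C]
variable {D : Type u} [Category.{v} D] [Abelian D] [Linear k D]

variable {P : C} {box : C × C ⥤ D}

theorem TensorExtension.exists_associator (h : IsBox k P P box) (T : TensorExtension box)
    (hl : ∀ X, PreservesFiniteColimits (T.H.obj X))
    (hr : ∀ Y, PreservesFiniteColimits (T.H.flip.obj Y)) :
    ∃ α : bifunctorComp₁₂ T.H T.H ≅ bifunctorComp₂₃ T.H T.H, ∀ a b c : C × C,
      ((α.hom.app (box.obj a)).app (box.obj b)).app (box.obj c) ≫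
          (T.H.obj (box.obj a)).map (T.m b c).hom ≫ (T.m a (b ⊗ c)).hom =
        (T.H.map (T.m a b).hom).app (box.obj c) ≫ (T.m (a ⊗ b) c).hom ≫
          box.map (α_ a b c).hom := by
  have hcomp : ∀ {U V W : Type u} [Category.{v} U] [Category.{v} V] [Category.{v} W]
      (F : U ⥤ V) (G : V ⥤ W), PreservesFiniteColimits F → PreservesFiniteColimits G →
      PreservesFiniteColimits (F ⋙ G) := fun F G _ _ => comp_preservesFiniteColimits F G
  -- Compatibility with `T.m` leaves no choice: on product objects the associator is that of `C × C`
  -- conjugated by `T.m`.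
  let t : ∀ a b c : C × C, (T.H.obj ((T.H.obj (box.obj a)).obj (box.obj b))).obj (box.obj c) ≅
      (T.H.obj (box.obj a)).obj ((T.H.obj (box.obj b)).obj (box.obj c)) := fun a b c =>
    (T.H.mapIso (T.m a b)).app (box.obj c) ≪≫ T.m (a ⊗ b) c ≪≫ box.mapIso (α_ a b c) ≪≫
      (T.m a (b ⊗ c)).symm ≪≫ (T.H.obj (box.obj a)).mapIso (T.m b c).symm
  have ht : ∀ a b c, (t a b c).hom ≫ (T.H.obj (box.obj a)).map (T.m b c).hom ≫
      (T.m a (b ⊗ c)).hom = (T.H.map (T.m a b).hom).app (box.obj c) ≫ (T.m (a ⊗ b) c).hom ≫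
          box.map (α_ a b c).hom := fun a b c => by
    simp [t, ← Functor.map_comp_assoc]
  have hepi : ∀ a b c, Mono ((T.H.obj (box.obj a)).map (T.m b c).hom ≫
      (T.m a (b ⊗ c)).hom) := fun a b c => inferInstance
  have : PreservesFiniteColimits (bifunctorComp₁₂ T.H T.H) :=
    preservesFiniteColimits_of_evaluation _ fun Y => preservesFiniteColimits_of_evaluation _
      fun Z => hcomp (T.H.flip.obj Y) (T.H.flip.obj Z) (hr Y) (hr Z)
  have : PreservesFiniteColimits (bifunctorComp₂₃ T.H T.H) :=
    preservesFiniteColimits_of_evaluation _ fun Y => preservesFiniteColimits_of_evaluation _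
      fun Z => hr ((T.H.obj Y).obj Z)
  have hL : ∀ (X) {Y Z W : D} (f : Y ⟶ Z) (g : Z ⟶ W), (T.H.obj X).map f ≫ (T.H.obj X).map g =
      (T.H.obj X).map (f ≫ g) := fun X _ _ _ f g => ((T.H.obj X).map_comp f g).symm
  have hR : ∀ (X) {Y Z W : D} (f : Y ⟶ Z) (g : Z ⟶ W), (T.H.map f).app X ≫ (T.H.map g).app X =
      (T.H.map (f ≫ g)).app X := fun X _ _ _ f g => ((T.H.flip.obj X).map_comp f g).symm
  have hX : ∀ {X X' Y Y' : D} (f : X ⟶ X') (g : Y ⟶ Y'), (T.H.obj X).map g ≫ (T.H.map f).app Y' =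
      (T.H.map f).app Y ≫ (T.H.obj X').map g := fun f g => (T.H.map f).naturality g
  have key := h.exists_iso₃ (F := bifunctorComp₁₂ T.H T.H) (F' := bifunctorComp₂₃ T.H T.H)
    (h₁ := fun X => preservesFiniteColimits_of_evaluation _ fun Z =>
      hcomp (T.H.obj X) (T.H.flip.obj Z) (hl X) (hr Z))
    (h₁' := fun X => preservesFiniteColimits_of_evaluation _ fun Z =>
      hcomp (T.H.flip.obj Z) (T.H.obj X) (hr Z) (hl X))
    (h₂ := fun X Y => hl _)
    (h₂' := fun X Y => hcomp (T.H.obj Y) (T.H.obj X) (hl Y) (hl X)) t ?_ ?_ ?_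
  · obtain ⟨α, hα⟩ := key
    exact ⟨α, fun a b c => (congr_arg (· ≫ _) (hα a b c)).trans (ht a b c)⟩
  · intro a a' f b c
    change (T.H.map ((T.H.map (box.map f)).app (box.obj b))).app (box.obj c) ≫ _ =
      _ ≫ (T.H.map (box.map f)).app ((T.H.obj (box.obj b)).obj (box.obj c))
    rw [← cancel_mono ((T.H.obj (box.obj a')).map (T.m b c).hom ≫ (T.m a' (b ⊗ c)).hom),
      Category.assoc, ht, Category.assoc, ← Category.assoc ((T.H.map (box.map f)).app _), ← hX,
      Category.assoc, T.m_left, reassoc_of% (hR (box.obj c)), T.m_left, reassoc_of% ht, ← hR,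
      Category.assoc, reassoc_of% (T.m_left (f ▷ b) c), ← box.map_comp, ← box.map_comp,
      associator_naturality_left]
  · intro a b b' f c
    change (T.H.map ((T.H.obj (box.obj a)).map (box.map f))).app (box.obj c) ≫ _ =
      _ ≫ (T.H.obj (box.obj a)).map ((T.H.map (box.map f)).app (box.obj c))
    rw [← cancel_mono ((T.H.obj (box.obj a)).map (T.m b' c).hom ≫ (T.m a (b' ⊗ c)).hom),
      Category.assoc, ht, Category.assoc, reassoc_of% (hL (box.obj a)), T.m_left, ← hL,
      Category.assoc, T.m_right, reassoc_of% ht, reassoc_of% (hR (box.obj c)), T.m_right, ← hR,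
      Category.assoc, reassoc_of% (T.m_left (a ◁ f) c), ← box.map_comp, ← box.map_comp,
      associator_naturality_middle]
  · intro a b c c' f
    change (T.H.obj ((T.H.obj (box.obj a)).obj (box.obj b))).map (box.map f) ≫ _ =
      _ ≫ (T.H.obj (box.obj a)).map ((T.H.obj (box.obj b)).map (box.map f))
    rw [← cancel_mono ((T.H.obj (box.obj a)).map (T.m b c').hom ≫ (T.m a (b ⊗ c')).hom),
      Category.assoc, ht, Category.assoc, reassoc_of% (hL (box.obj a)), T.m_right, ← hL,
      Category.assoc, T.m_right, reassoc_of% ht, reassoc_of% hX, 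
      reassoc_of% (T.m_right (a ⊗ b) f), ← box.map_comp, ← box.map_comp,
      associator_naturality_right]

/-- Associator and unitors are extended from product objects. With unit `1 ⊠ 1`, pentagon and
triangle hold on product objects because they hold in `C × C`, in particular at the generator `P ⊠
P`, which suffices. -/
theorem IsBox.exists_productTensor (h : IsBox k P P box) (hrex : RightExactTensor C) :
    ∃ _ : MonoidalCategory D, Nonempty (ProductTensor k box) := by
  obtain ⟨T, hl, hr⟩ := h.nonempty_tensorExtension hrex
  have hl' := fun X => (hl X).rightExact
  have hr' := fun Y => (hr Y).rightExact
  obtain ⟨α, hα⟩ := T.exists_associator h hl' hr'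
  obtain ⟨l, hlu⟩ := h.nonempty_iso (F := T.H.obj (box.obj (𝟙_ (C × C)))) (F' := 𝟭 D)
    (NatIso.ofComponents (fun a => T.m (𝟙_ _) a ≪≫ box.mapIso (λ_ a)) fun {a b} f => by
      change (T.H.obj _).map (box.map f) ≫ (T.m _ b).hom ≫ box.map _ =
        ((T.m _ a).hom ≫ box.map _) ≫ box.map f
      rw [reassoc_of% (T.m_right (𝟙_ _) f), Category.assoc, ← box.map_comp, ← box.map_comp,
        leftUnitor_naturality])
  obtain ⟨r, hru⟩ := h.nonempty_iso (F := T.H.flip.obj (box.obj (𝟙_ (C × C)))) (F' := 𝟭 D)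
    (NatIso.ofComponents (fun a => T.m a (𝟙_ _) ≪≫ box.mapIso (ρ_ a)) fun {a b} f => by
      change (T.H.map (box.map f)).app _ ≫ (T.m b _).hom ≫ box.map _ =
        ((T.m a _).hom ≫ box.map _) ≫ box.map f
      rw [reassoc_of% (T.m_left f (𝟙_ _)), Category.assoc, ← box.map_comp, ← box.map_comp,
        rightUnitor_naturality])
  let str : MonoidalCategoryStruct D :=
    { tensorObj := fun X Y => (T.H.obj X).obj Y
      whiskerLeft := fun X _ _ f => (T.H.obj X).map f
      whiskerRight := fun f Y => (T.H.map f).app Y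
      tensorUnit := box.obj (𝟙_ (C × C))
      associator := fun X Y Z => ((α.app X).app Y).app Z
      leftUnitor := fun X => l.app X
      rightUnitor := fun X => r.app X }
  have laws : TensorLaws D :=
    { tensorHom_def := fun f g => rfl
      whiskerLeft_id := fun X Y => (T.H.obj X).map_id Y
      whiskerLeft_comp := fun X => (T.H.obj X).map_comp
      id_whiskerRight := fun X Y => (T.H.flip.obj Y).map_id X
      comp_whiskerRight := fun f g X => (T.H.flip.obj X).map_comp f g
      whisker_exchange := fun f g => (T.H.map f).naturality g
      associator_left := fun f Y Z => congr_app (congr_app (α.hom.naturality f) Y) Z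
      associator_mid := fun X _ _ f Z => congr_app ((α.hom.app X).naturality f) Z
      associator_right := fun X Y _ _ f => ((α.hom.app X).app Y).naturality f
      leftUnitor := fun f => l.hom.naturality f
      rightUnitor := fun f => r.hom.naturality f }
  have hrx : laws.RightExact := ⟨hl', hr'⟩
  let S : StrongData box :=
    { e := Iso.refl _
      m := T.m
      m_left := T.m_left
      m_right := T.m_right
      associator := hα
      leftUnitor := fun a => (congr_app hlu a).trans (by
        rw [Iso.refl_hom, laws.id_whiskerRight, Category.id_comp]; rfl)
      rightUnitor := fun a => (congr_app hru a).trans (by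
        rw [Iso.refl_hom, laws.whiskerLeft_id, Category.id_comp]; rfl) }
  let mon := TensorLaws.monoidalCategory hrx S h.gen
  have hpre : MonoidalPreadditive D :=
      { whiskerLeft_zero := fun {X _ _} => have := (hl X).additive; (T.H.obj X).map_zero _ _
        zero_whiskerRight := fun {X _ _} => have := (hr X).additive; (T.H.flip.obj X).map_zero _ _
        whiskerLeft_add := fun {X _ _} f g => have := (hl X).additive; (T.H.obj X).map_add
        add_whiskerRight := fun {X _ _} f g => have := (hr X).additive; (T.H.flip.obj X).map_add }
  have hlin : MonoidalLinear k D :=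
    { whiskerLeft_smul := fun X _ _ c f => (hl X).linear.map_smul f c
      smul_whiskerRight := fun c _ _ f X => (hr X).linear.map_smul f c }
  refine ⟨mon, ⟨{
    preadditive := hpre
    linear := hlin
    rightExact := fun X => ⟨hl' X, hr' X⟩
    boxMonoidal := ?_ }⟩⟩
  exact Functor.CoreMonoidal.toMonoidal
      { εIso := Iso.refl _
        μIso := T.m
        μIso_hom_natural_left := fun f a => T.m_left f a
        μIso_hom_natural_right := fun a f => T.m_right a f
        associativity := fun a b c => (S.associator a b c).symm
        left_unitality := fun a => S.leftUnitor a
        right_unitality := fun a => S.rightUnitor a }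

end Tensor

/-! ### Extending bifunctor isomorphisms from product objects -/

section TwoVariables

variable {k : Type w} [Field k]
variable {A : Type u₁} [Category.{v₁} A] [Abelian A] [Linear k A]
variable {B : Type u₂} [Category.{v₂} B] [Abelian B] [Linear k B]
variable {D : Type u₃} [Category.{v₃} D] [Abelian D] [Linear k D]
variable {P : A} {P' : B} {box : A × B ⥤ D}
variable {E : Type u} [Category.{v} E] [Abelian E]

theorem IsBox.exists_iso₂ (h : IsBox k P P' box) {F F' : D ⥤ D ⥤ E}
    [PreservesFiniteColimits F] [PreservesFiniteColimits F']
    (h₁ : ∀ X, PreservesFiniteColimits (F.obj X)) (h₁' : ∀ X, PreservesFiniteColimits (F'.obj X))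
    (t : ∀ a b, (F.obj (box.obj a)).obj (box.obj b) ≅ (F'.obj (box.obj a)).obj (box.obj b))
    (n₁ : ∀ {a a'} (f : a ⟶ a') (b), (F.map (box.map f)).app (box.obj b) ≫ (t a' b).hom =
        (t a b).hom ≫ (F'.map (box.map f)).app (box.obj b))
    (n₂ : ∀ (a) {b b'} (f : b ⟶ b'), (F.obj (box.obj a)).map (box.map f) ≫ (t a b').hom =
        (t a b).hom ≫ (F'.obj (box.obj a)).map (box.map f)) :
    ∃ α : F ≅ F', ∀ a b, (α.hom.app (box.obj a)).app (box.obj b) = (t a b).hom := by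
  have ht₁ : ∀ a, ∃ β : F.obj (box.obj a) ≅ F'.obj (box.obj a),
      ∀ b, β.hom.app (box.obj b) = (t a b).hom := by
    intro a
    obtain ⟨β, hβ⟩ := h.nonempty_iso (F := F.obj (box.obj a)) (F' := F'.obj (box.obj a))
      (NatIso.ofComponents (t a) (n₂ a))
    exact ⟨β, congr_app hβ⟩
  choose t₁ ht₁ using ht₁
  have hn : ∀ {a a'} (f : a ⟶ a'), F.map (box.map f) ≫ (t₁ a').hom =
      (t₁ a).hom ≫ F'.map (box.map f) := fun {a a'} f =>
    h.natTrans_ext (NatTrans.ext (funext fun b => by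
      change (F.map (box.map f)).app (box.obj b) ≫ (t₁ _).hom.app (box.obj b) =
        (t₁ _).hom.app (box.obj b) ≫ (F'.map (box.map f)).app (box.obj b)
      rw [ht₁, ht₁, n₁]))
  obtain ⟨β, hβ⟩ := h.nonempty_iso (F := F) (F' := F') (NatIso.ofComponents t₁ hn)
  refine ⟨β, fun a b => ?_⟩
  have : β.hom.app (box.obj a) = (t₁ a).hom := congr_app hβ a
  rw [this, ht₁]

end TwoVariables

/-! ### Strong monoidal structures and the functor `T` -/

section Monoidal

open Functor.LaxMonoidal Functor.OplaxMonoidal Functor.Monoidal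

variable {k : Type w} [Field k]
variable {C : Type u} [Category.{v} C] [Abelian C] [Linear k C] [MonoidalCategory C]
variable {D : Type u₁} [Category.{v₁} D] [Abelian D] [Linear k D] [MonoidalCategory D]
variable {E : Type u₂} [Category.{v₂} E] [Abelian E] [MonoidalCategory E]
variable {P : C} {box : C × C ⥤ D}

/-- A right exact functor `F` on a Deligne product such that `box ⋙ F` is strong monoidal is
strong monoidal. -/
theorem IsBox.exists_monoidal (h : IsBox k P P box) [box.Monoidal]
    (hD : RightExactTensor D) (hE : RightExactTensor E) (F : D ⥤ E) [PreservesFiniteColimits F]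
    (G : C × C ⥤ E) [G.Monoidal] (i : box ⋙ F ≅ G) :
    ∃ _ : F.Monoidal, (∀ a b : C × C, μ F (box.obj a) (box.obj b) ≫ F.map (μ box a b) ≫
        i.hom.app (a ⊗ b) = (i.hom.app a ⊗ₘ i.hom.app b) ≫ μ G a b) ∧
      ε F ≫ F.map (ε box) ≫ i.hom.app (𝟙_ _) = ε G := by
  have hDl := fun X => (hD X).1
  have hDr := fun X => (hD X).2
  have hEl := fun X => (hE X).1
  have hEr := fun X => (hE X).2
  have hcomp : ∀ {U : Type u₁} {V : Type u₂} {W : Type u₂} [Category.{v₁} U] [Category.{v₂} V]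
      [Category.{v₂} W]
      (F : U ⥤ V) (G : V ⥤ W), PreservesFiniteColimits F → PreservesFiniteColimits G →
      PreservesFiniteColimits (F ⋙ G) := fun F G _ _ => comp_preservesFiniteColimits F G
  have : PreservesFiniteColimits (curriedTensorPre F) :=
    preservesFiniteColimits_of_evaluation _ fun Y => hcomp F (tensorRight (F.obj Y)) ‹_› (hEr _)
  have : PreservesFiniteColimits (curriedTensorPost F) :=
    preservesFiniteColimits_of_evaluation _ fun Y =>
      have := hDr Y; comp_preservesFiniteColimits (tensorRight Y) F
  -- The compatibility with `μ G` demanded in the conclusion forces this formula on product objects.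
  let t : ∀ a b : C × C, F.obj (box.obj a) ⊗ F.obj (box.obj b) ≅
      F.obj (box.obj a ⊗ box.obj b) := fun a b =>
    (i.app a ⊗ᵢ i.app b) ≪≫ μIso G a b ≪≫ (i.app (a ⊗ b)).symm ≪≫ F.mapIso (μIso box a b).symm
  have ht : ∀ a b : C × C, (t a b).hom ≫ F.map (μ box a b) ≫
      i.hom.app (a ⊗ b) = (i.hom.app a ⊗ₘ i.hom.app b) ≫ μ G a b := fun a b => by
    simp [t, ← F.map_comp_assoc]
  have hmono : ∀ a b : C × C, Mono (F.map (μ box a b) ≫ i.hom.app (a ⊗ b)) := fun a b =>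
    inferInstance
  have key := h.exists_iso₂ (F := curriedTensorPre F) (F' := curriedTensorPost F)
    (fun X => hcomp F (tensorLeft (F.obj X)) ‹_› (hEl _))
    (fun X => have := hDl X; comp_preservesFiniteColimits (tensorLeft X) F) t ?_ ?_
  · obtain ⟨m, hm⟩ := key
    have hs : ∀ a b : C × C, (m.hom.app (box.obj a)).app (box.obj b) ≫ F.map (μ box a b) ≫
      i.hom.app (a ⊗ b) = (i.hom.app a ⊗ₘ i.hom.app b) ≫ μ G a b := fun a b =>
        (congr_arg (· ≫ _) (hm a b)).trans (ht a b)
    have hm₁ : ∀ {X X' : D} (f : X ⟶ X') (Y : D), F.map f ▷ F.obj Y ≫ (m.hom.app X').app Y =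
        (m.hom.app X).app Y ≫ F.map (f ▷ Y) := fun f Y => congr_app (m.hom.naturality f) Y
    have hm₂ : ∀ (X : D) {Y Y' : D} (f : Y ⟶ Y'), F.obj X ◁ F.map f ≫ (m.hom.app X).app Y' =
        (m.hom.app X).app Y ≫ F.map (X ◁ f) := fun X _ _ f => (m.hom.app X).naturality f
    let e : 𝟙_ E ≅ F.obj (𝟙_ D) := εIso G ≪≫ (i.app (𝟙_ (C × C))).symm ≪≫ F.mapIso (εIso box).symm
    have he : e.hom ≫ F.map (ε box) = ε G ≫ i.inv.app (𝟙_ (C × C)) := by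
      simp [e, ← F.map_comp]
    have he' : e.hom ≫ F.map (ε box) ≫ i.hom.app (𝟙_ (C × C)) = ε G := by
      rw [reassoc_of% he]; simp
    have hassoc : ∀ a b c : C × C, (m.hom.app (box.obj a)).app (box.obj b) ▷ F.obj (box.obj c) ≫
        (m.hom.app (box.obj a ⊗ box.obj b)).app (box.obj c) ≫
          F.map (α_ (box.obj a) (box.obj b) (box.obj c)).hom =
        (α_ _ _ _).hom ≫ F.obj (box.obj a) ◁ (m.hom.app (box.obj b)).app (box.obj c) ≫
          (m.hom.app (box.obj a)).app (box.obj b ⊗ box.obj c) := by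
      intro a b c
      rw [← cancel_mono (F.map (box.obj a ◁ μ box b c)),
        ← cancel_mono (F.map (μ box a (b ⊗ c)) ≫ i.hom.app (a ⊗ b ⊗ c))]
      have h₁ : F.map (α_ (box.obj a) (box.obj b) (box.obj c)).hom ≫ F.map (box.obj a ◁ μ box b c) ≫
          F.map (μ box a (b ⊗ c)) = F.map (μ box a b ▷ box.obj c) ≫ F.map (μ box (a ⊗ b) c) ≫
            F.map (box.map (α_ a b c).hom) := by
        simp only [← F.map_comp, Functor.LaxMonoidal.associativity]
      have h₂ : F.map (box.map (α_ a b c).hom) ≫ i.hom.app (a ⊗ b ⊗ c) =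
          i.hom.app ((a ⊗ b) ⊗ c) ≫ G.map (α_ a b c).hom := i.hom.naturality (α_ a b c).hom
      have h₃ : (m.hom.app (box.obj a)).app (box.obj b) ▷ F.obj (box.obj c) ≫
          F.map (μ box a b) ▷ F.obj (box.obj c) ≫ (i.hom.app (a ⊗ b) ⊗ₘ i.hom.app c) =
          ((i.hom.app a ⊗ₘ i.hom.app b) ⊗ₘ i.hom.app c) ≫ μ G a b ▷ G.obj c := by
        rw [tensorHom_comp_whiskerRight, ← hs, whiskerRight_comp_tensorHom,
          whiskerRight_comp_tensorHom]
      have h₄ : F.obj (box.obj a) ◁ (m.hom.app (box.obj b)).app (box.obj c) ≫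
          F.obj (box.obj a) ◁ F.map (μ box b c) ≫ (i.hom.app a ⊗ₘ i.hom.app (b ⊗ c)) =
          (i.hom.app a ⊗ₘ (i.hom.app b ⊗ₘ i.hom.app c)) ≫ G.obj a ◁ μ G b c := by
        rw [tensorHom_comp_whiskerLeft, ← hs, whiskerLeft_comp_tensorHom,
          whiskerLeft_comp_tensorHom]
      simp only [Category.assoc]
      rw [reassoc_of% h₁, h₂, ← reassoc_of% hm₁, reassoc_of% hs, reassoc_of% h₃, ← reassoc_of% hm₂,
        hs, reassoc_of% h₄, Functor.LaxMonoidal.associativity]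
      exact (reassoc_of% (associator_naturality (i.hom.app a) (i.hom.app b) (i.hom.app c))) _
    have hleft : ∀ a : C × C, (λ_ (F.obj (box.obj a))).hom = e.hom ▷ F.obj (box.obj a) ≫
        (m.hom.app (𝟙_ D)).app (box.obj a) ≫ F.map (λ_ (box.obj a)).hom := by
      intro a
      rw [← cancel_mono (i.hom.app a)]
      have h₁ : F.map (box.map (λ_ a).hom) ≫ i.hom.app a = i.hom.app _ ≫ G.map (λ_ a).hom :=
        i.hom.naturality (λ_ a).hom
      rw [Functor.LaxMonoidal.left_unitality box a]
      simp only [F.map_comp, Category.assoc, h₁]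
      rw [← reassoc_of% hm₁, reassoc_of% hs]
      have h₂ : e.hom ▷ F.obj (box.obj a) ≫ F.map (ε box) ▷ F.obj (box.obj a) ≫
          (i.hom.app (𝟙_ _) ⊗ₘ i.hom.app a) = 𝟙_ E ◁ i.hom.app a ≫ ε G ▷ G.obj a := by
        rw [whiskerRight_comp_tensorHom, whiskerRight_comp_tensorHom, he', tensorHom_def']
      rw [reassoc_of% h₂, ← Functor.LaxMonoidal.left_unitality, leftUnitor_naturality]
    have hright : ∀ a : C × C, (ρ_ (F.obj (box.obj a))).hom = F.obj (box.obj a) ◁ e.hom ≫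
        (m.hom.app (box.obj a)).app (𝟙_ D) ≫ F.map (ρ_ (box.obj a)).hom := by
      intro a
      rw [← cancel_mono (i.hom.app a)]
      have h₁ : F.map (box.map (ρ_ a).hom) ≫ i.hom.app a = i.hom.app _ ≫ G.map (ρ_ a).hom :=
        i.hom.naturality (ρ_ a).hom
      rw [Functor.LaxMonoidal.right_unitality box a]
      simp only [F.map_comp, Category.assoc, h₁]
      rw [← reassoc_of% hm₂, reassoc_of% hs]
      have h₂ : F.obj (box.obj a) ◁ e.hom ≫ F.obj (box.obj a) ◁ F.map (ε box) ≫
          (i.hom.app a ⊗ₘ i.hom.app (𝟙_ _)) = i.hom.app a ▷ 𝟙_ E ≫ G.obj a ◁ ε G := by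
        rw [whiskerLeft_comp_tensorHom, whiskerLeft_comp_tensorHom, he', MonoidalCategory.tensorHom_def]
      rw [reassoc_of% h₂, ← Functor.LaxMonoidal.right_unitality, rightUnitor_naturality]
    have h₁ : PreservesFiniteColimits (curriedTensorPrePre F) :=
      preservesFiniteColimits_of_evaluation _ fun Y => preservesFiniteColimits_of_evaluation _
        fun Z => hcomp F (tensorRight (F.obj Y) ⋙ tensorRight (F.obj Z)) ‹_›
          (comp_preservesFiniteColimits _ _)
    have h₂ : ∀ X, PreservesFiniteColimits ((curriedTensorPrePre F).obj X) := fun X =>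
      preservesFiniteColimits_of_evaluation _ fun Z =>
        hcomp F (tensorLeft (F.obj X) ⋙ tensorRight (F.obj Z)) ‹_›
          (comp_preservesFiniteColimits _ _)
    have h₃ : ∀ X Y, PreservesFiniteColimits (((curriedTensorPrePre F).obj X).obj Y) := fun X Y =>
      hcomp F (tensorLeft (F.obj X ⊗ F.obj Y)) ‹_› (hEl _)
    -- Both sides are transformations of right exact functors of three variables, so `hassoc` at the
    -- generator decides.
    have hassoc' : Functor.LaxMonoidal.ofBifunctor.firstMap m.hom =
        Functor.LaxMonoidal.ofBifunctor.secondMap m.hom :=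
      h.gen.natTrans_ext (h.gen.natTrans_ext (h.gen.natTrans_ext
        (hassoc (P, P) (P, P) (P, P))))
    have hleft' : ∀ X, (λ_ (F.obj X)).hom = e.hom ▷ F.obj X ≫
        (m.hom.app (𝟙_ D)).app X ≫ F.map (λ_ X).hom := fun X => by
      have := hcomp F (tensorLeft (𝟙_ E)) ‹_› (hEl _)
      refine h.gen.hom_ext (F ⋙ tensorLeft (𝟙_ E)) fun f => ?_
      change 𝟙_ E ◁ F.map f ≫ _ = 𝟙_ E ◁ F.map f ≫ _
      rw [leftUnitor_naturality, hleft, whisker_exchange_assoc, reassoc_of% hm₂, ← F.map_comp,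
        leftUnitor_naturality, F.map_comp]
      simp only [Category.assoc]
    have hright' : ∀ X, (ρ_ (F.obj X)).hom = F.obj X ◁ e.hom ≫
        (m.hom.app X).app (𝟙_ D) ≫ F.map (ρ_ X).hom := fun X => by
      have := hcomp F (tensorRight (𝟙_ E)) ‹_› (hEr _)
      refine h.gen.hom_ext (F ⋙ tensorRight (𝟙_ E)) fun f => ?_
      change F.map f ▷ 𝟙_ E ≫ _ = F.map f ▷ 𝟙_ E ≫ _
      rw [rightUnitor_naturality, hright, ← whisker_exchange_assoc, reassoc_of% hm₁, ← F.map_comp,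
        rightUnitor_naturality, F.map_comp]
      simp only [Category.assoc]
    let core : F.CoreMonoidal :=
      { εIso := e
        μIso := fun X Y => (m.app X).app Y
        μIso_hom_natural_left := hm₁
        μIso_hom_natural_right := fun X f => hm₂ X f
        associativity := fun X Y Z => congr_app (congr_app (congr_app hassoc' X) Y) Z
        left_unitality := hleft'
        right_unitality := hright' }
    exact ⟨core.toMonoidal, fun a b => hs a b, he'⟩
  · intro a a' f b
    change F.map (box.map f) ▷ _ ≫ _ = _ ≫ F.map (box.map f ▷ _)
    rw [← cancel_mono (F.map (μ box a' b) ≫ i.hom.app (a' ⊗ b)), Category.assoc, ht,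
      Category.assoc, ← F.map_comp_assoc, μ_natural_left, F.map_comp_assoc]
    have := i.hom.naturality (f ▷ b)
    rw [Functor.comp_map] at this
    rw [this, reassoc_of% ht]
    have := i.hom.naturality f
    rw [Functor.comp_map] at this
    rw [← μ_natural_left, ← Category.assoc, ← Category.assoc]
    refine congr_arg (· ≫ _) ?_
    rw [← tensorHom_id, ← tensorHom_id, tensorHom_comp_tensorHom]
    refine Eq.trans ?_ (tensorHom_comp_tensorHom _ _ _ _).symm
    rw [this, Category.id_comp, Category.comp_id]
  · intro a b b' f
    change _ ◁ F.map (box.map f) ≫ _ = _ ≫ F.map (_ ◁ box.map f)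
    rw [← cancel_mono (F.map (μ box a b') ≫ i.hom.app (a ⊗ b')), Category.assoc, ht,
      Category.assoc, ← F.map_comp_assoc, μ_natural_right, F.map_comp_assoc]
    have := i.hom.naturality (a ◁ f)
    rw [Functor.comp_map] at this
    rw [this, reassoc_of% ht]
    have := i.hom.naturality f
    rw [Functor.comp_map] at this
    rw [← μ_natural_right, ← Category.assoc, ← Category.assoc]
    refine congr_arg (· ≫ _) ?_
    rw [← id_tensorHom, ← id_tensorHom, tensorHom_comp_tensorHom]
    refine Eq.trans ?_ (tensorHom_comp_tensorHom _ _ _ _).symm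
    rw [this, Category.id_comp, Category.comp_id]

/-- The tensor product `C × C ⥤ C` of a braided category is itself strong monoidal, and its
structure passes to the extension `T`. The reverse braiding is used because `interchange` contains
`c⁻¹`. -/
theorem IsBox.nonempty_tensorFunctor [MonoidalPreadditive C] [MonoidalLinear k C]
    [BraidedCategory C] {D : Type u} [Category.{v} D] [Abelian D] [Linear k D] {box : C × C ⥤ D}
    (h : IsBox k P P box) (hrex : RightExactTensor C) [MonoidalCategory D]
    (S : ProductTensor k box) : Nonempty (TensorFunctor k S) := by
  let := S.boxMonoidal
  have hG : IsMultiRightExact k (tensor C) :=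
    { fixLeft := fun a => (hrex.tensorLeft a).of_iso
        (NatIso.ofComponents (fun _ => Iso.refl _) fun f => natural_refl (id_tensorHom _ f).symm)
      fixRight := fun a => (hrex.tensorRight a).of_iso
        (NatIso.ofComponents (fun _ => Iso.refl _) fun f => natural_refl (tensorHom_id f _).symm) }
  obtain ⟨T⟩ := h.nonempty_extension hG
  have := T.isLinearRightExact.rightExact
  let mon : (tensor C).Monoidal :=
    letI := reverseBraiding C
    inferInstance
  obtain ⟨m, hm, hm'⟩ := h.exists_monoidal S.rightExact hrex T.functor (tensor C) T.iso
  refine ⟨{ T with monoidal := m, T₂_eq := fun A B U V => (hm (A, B) (U, V)).trans ?_, T₀_eq := hm' }⟩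
  refine congr_arg (_ ≫ ·) ?_
  have : interchange A B U V = @tensorμ C _ _ (reverseBraiding C) A B U V := by
    simp only [interchange, tensorμ, MonoidalCategory.whiskerLeft_comp, Category.assoc]
    rfl
  rw [this]
  rfl

end Monoidal

/-! ### Exactness of Hom and of tensor products of vector spaces -/

section HomFunctors

variable (k : Type w) [Field k]

/-- `M ↦ M ⊗ W` on vector spaces. -/
def tensorSpaceRight (W : Type v) [AddCommGroup W] [Module k W] :
    ModuleCat.{v} k ⥤ ModuleCat.{v} k where
  obj M := ModuleCat.of k (M ⊗[k] W)
  map f := ModuleCat.ofHom (f.hom.rTensor W)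
  map_id M := by ext : 1; exact LinearMap.rTensor_id W M
  map_comp f g := by ext : 1; exact LinearMap.rTensor_comp W g.hom f.hom

/-- `M ↦ W ⊗ M` on vector spaces. -/
def tensorSpaceLeft (W : Type v) [AddCommGroup W] [Module k W] :
    ModuleCat.{v} k ⥤ ModuleCat.{v} k where
  obj M := ModuleCat.of k (W ⊗[k] M)
  map f := ModuleCat.ofHom (f.hom.lTensor W)
  map_id M := by ext : 1; exact LinearMap.lTensor_id W M
  map_comp f g := by ext : 1; exact LinearMap.lTensor_comp W g.hom f.hom

theorem exact_tensorSpaceRight (W : Type v) [AddCommGroup W] [Module k W] :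
    PreservesFiniteLimits (tensorSpaceRight k W) ∧ PreservesFiniteColimits (tensorSpaceRight k W) := by
  have : (tensorSpaceRight k W).Additive :=
    ⟨fun {X Y f g} => by ext : 1; exact LinearMap.rTensor_add W f.hom g.hom⟩
  refine ((tensorSpaceRight k W).exact_tfae.out 1 3).1 fun S hS => ?_
  rw [ShortComplex.ShortExact.moduleCat_exact_iff_function_exact] at hS ⊢
  exact Module.Flat.rTensor_exact W hS

theorem exact_tensorSpaceLeft (W : Type v) [AddCommGroup W] [Module k W] :
    PreservesFiniteLimits (tensorSpaceLeft k W) ∧ PreservesFiniteColimits (tensorSpaceLeft k W) := by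
  have : (tensorSpaceLeft k W).Additive :=
    ⟨fun {X Y f g} => by ext : 1; exact LinearMap.lTensor_add W f.hom g.hom⟩
  refine ((tensorSpaceLeft k W).exact_tfae.out 1 3).1 fun S hS => ?_
  rw [ShortComplex.ShortExact.moduleCat_exact_iff_function_exact] at hS ⊢
  exact Module.Flat.lTensor_exact W hS

variable {X : Type u} [Category.{v} X] [Abelian X] [Linear k X]

theorem preservesFiniteLimits_linearYoneda (Y : X) :
    PreservesFiniteLimits ((linearYoneda k X).obj Y) := by
  have : PreservesFiniteLimits ((linearYoneda k X).obj Y ⋙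
      forget₂ (ModuleCat.{v} k) AddCommGrpCat.{v}) :=
    inferInstanceAs (PreservesFiniteLimits (preadditiveYoneda.obj Y))
  exact preservesFiniteLimits_of_reflects_of_preserves _
    (forget₂ (ModuleCat.{v} k) AddCommGrpCat.{v})

theorem preservesFiniteLimits_linearCoyoneda (Y : X) :
    PreservesFiniteLimits ((linearCoyoneda k X).obj (op Y)) := by
  have : PreservesFiniteLimits ((linearCoyoneda k X).obj (op Y) ⋙
      forget₂ (ModuleCat.{v} k) AddCommGrpCat.{v}) :=
    inferInstanceAs (PreservesFiniteLimits (preadditiveCoyoneda.obj (op Y)))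
  exact preservesFiniteLimits_of_reflects_of_preserves _
    (forget₂ (ModuleCat.{v} k) AddCommGrpCat.{v})

theorem preservesFiniteColimits_linearCoyoneda (Y : X) [Projective Y] :
    PreservesFiniteColimits ((linearCoyoneda k X).obj (op Y)) := by
  have hlim := preservesFiniteLimits_linearCoyoneda k Y
  refine ((Functor.preservesFiniteColimits_tfae _).out 0 3).1 fun S hS => ?_
  have he : Epi (((linearCoyoneda k X).obj (op Y)).map S.g) := by
    rw [ModuleCat.epi_iff_surjective]
    intro f
    have := hS.epi_g
    exact ⟨Projective.factorThru f S.g, Projective.factorThru_comp f S.g⟩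
  exact ⟨(((Functor.preservesFiniteLimits_tfae ((linearCoyoneda k X).obj (op Y))).out 0 3
    rfl rfl).2 hlim S hS).1, he⟩

/-- `X ↦ Hom(X, Y)` as a covariant functor to the opposite of vector spaces. -/
def homTo (Y : X) : X ⥤ (ModuleCat.{v} k)ᵒᵖ :=
  ((linearYoneda k X).obj Y).rightOp

theorem isLinearRightExact_homTo (Y : X) : IsLinearRightExact k (homTo k Y) := by
  have := preservesFiniteLimits_linearYoneda k Y
  have : PreservesFiniteColimits (homTo k Y) := preservesFiniteColimits_rightOp _
  refine ⟨inferInstance, ⟨fun f c => ?_⟩, this⟩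
  apply Quiver.Hom.unop_inj
  ext g
  exact Linear.smul_comp _ _ _ c f g

end HomFunctors

/-! ### Morphisms between product objects, and exactness of `⊠` -/

section HomFormula

variable {k : Type w} [Field k]
variable {A : Type u} [Category.{v} A] [Abelian A] [Linear k A]
variable {B : Type u₁} [Category.{v} B] [Abelian B] [Linear k B]
variable {D : Type u₂} [Category.{v} D] [Abelian D] [Linear k D]
variable {P : A} {P' : B} {box : A × B ⥤ D}

section Naturality

variable {G : A × B ⥤ D} (hG : IsMultiRightExact k G)

theorem homMap_rTensor_rightComp {U U' U'' : A} {V V' : B} (f : U' ⟶ U'')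
    (x : (U ⟶ U') ⊗[k] (V ⟶ V')) :
    homMap hG U U'' V V' ((Linear.rightComp k U f).rTensor (V ⟶ V') x) =
      homMap hG U U' V V' x ≫ G.map (Prod.mkHom f (𝟙 V')) := by
  induction x with
  | zero => simp
  | add x y hx hy => simp only [map_add, hx, hy, Preadditive.add_comp]
  | tmul a b => rw [LinearMap.rTensor_tmul, homMap_tmul, homMap_tmul, map_mkHom_comp,
      Category.comp_id, Linear.rightComp_apply]

theorem homMap_lTensor_rightComp {U U' : A} {V V' V'' : B} (g : V' ⟶ V'')
    (x : (U ⟶ U') ⊗[k] (V ⟶ V')) :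
    homMap hG U U' V V'' ((Linear.rightComp k V g).lTensor (U ⟶ U') x) =
      homMap hG U U' V V' x ≫ G.map (Prod.mkHom (𝟙 U') g) := by
  induction x with
  | zero => simp
  | add x y hx hy => simp only [map_add, hx, hy, Preadditive.add_comp]
  | tmul a b => rw [LinearMap.lTensor_tmul, homMap_tmul, homMap_tmul, map_mkHom_comp,
      Category.comp_id, Linear.rightComp_apply]

theorem homMap_rTensor_leftComp {U₀ U U' : A} {V V' : B} (f : U₀ ⟶ U)
    (x : (U ⟶ U') ⊗[k] (V ⟶ V')) :
    homMap hG U₀ U' V V' ((Linear.leftComp k U' f).rTensor (V ⟶ V') x) =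
      G.map (Prod.mkHom f (𝟙 V)) ≫ homMap hG U U' V V' x := by
  induction x with
  | zero => simp
  | add x y hx hy => simp only [map_add, hx, hy, Preadditive.comp_add]
  | tmul a b => rw [LinearMap.rTensor_tmul, homMap_tmul, homMap_tmul, map_mkHom_comp,
      Category.id_comp, Linear.leftComp_apply]

theorem homMap_lTensor_leftComp {U U' : A} {V₀ V V' : B} (g : V₀ ⟶ V)
    (x : (U ⟶ U') ⊗[k] (V ⟶ V')) :
    homMap hG U U' V₀ V' ((Linear.leftComp k V' g).lTensor (U ⟶ U') x) =
      G.map (Prod.mkHom (𝟙 U) g) ≫ homMap hG U U' V V' x := by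
  induction x with
  | zero => simp
  | add x y hx hy => simp only [map_add, hx, hy, Preadditive.comp_add]
  | tmul a b => rw [LinearMap.lTensor_tmul, homMap_tmul, homMap_tmul, map_mkHom_comp,
      Category.id_comp, Linear.leftComp_apply]

end Naturality

theorem isIso_ofHom_iff {M N : Type v} [AddCommGroup M] [Module k M] [AddCommGroup N]
    [Module k N] (f : M →ₗ[k] N) : IsIso (ModuleCat.ofHom f) ↔ Function.Bijective f :=
  ConcreteCategory.isIso_iff_bijective (ModuleCat.ofHom f)

/-- Both sides are right exact in `U`, since `P` and `P ⊠ P'` are projective and tensoring over `k`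
is exact. So the comparison is an isomorphism once it is one at `U = P`, which is the criterion. -/
theorem IsBox.homMap_bijective_gen_left (h : IsBox k P P' box) (U : A) :
    Function.Bijective (homMap h.multi P U P' P') := by
  have := h.left.projective
  have := h.gen.projective
  have := preservesFiniteColimits_linearCoyoneda k P
  have := preservesFiniteColimits_linearCoyoneda k (box.obj (P, P'))
  have := (exact_tensorSpaceRight k (P' ⟶ P')).2
  have := (h.multi.fixRight P').rightExact
  have := comp_preservesFiniteColimits ((linearCoyoneda k A).obj (op P))
    (tensorSpaceRight k (P' ⟶ P'))
  have := comp_preservesFiniteColimits (Prod.sectL A P' ⋙ box)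
    ((linearCoyoneda k D).obj (op (box.obj (P, P'))))
  let α : (linearCoyoneda k A).obj (op P) ⋙ tensorSpaceRight k (P' ⟶ P') ⟶
      (Prod.sectL A P' ⋙ box) ⋙ (linearCoyoneda k D).obj (op (box.obj (P, P'))) :=
    { app := fun U => ModuleCat.ofHom (homMap h.multi P U P' P')
      naturality := fun U V f => ModuleCat.hom_ext (LinearMap.ext fun x =>
        homMap_rTensor_rightComp h.multi f x) }
  have := h.left.isIso_of_isIso_app α ((isIso_ofHom_iff (homMap h.multi P P P' P')).2 h.bij)
  exact (isIso_ofHom_iff (homMap h.multi P U P' P')).1 (NatIso.isIso_app_of_isIso α U)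

theorem IsBox.homMap_bijective_gen (h : IsBox k P P' box) (U : A) (V : B) :
    Function.Bijective (homMap h.multi P U P' V) := by
  have := h.right.projective
  have := h.gen.projective
  have := preservesFiniteColimits_linearCoyoneda k P'
  have := preservesFiniteColimits_linearCoyoneda k (box.obj (P, P'))
  have := (exact_tensorSpaceLeft k (P ⟶ U)).2
  have := (h.multi.fixLeft U).rightExact
  have := comp_preservesFiniteColimits ((linearCoyoneda k B).obj (op P'))
    (tensorSpaceLeft k (P ⟶ U))
  have := comp_preservesFiniteColimits (Prod.sectR U B ⋙ box)
    ((linearCoyoneda k D).obj (op (box.obj (P, P'))))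
  let α : (linearCoyoneda k B).obj (op P') ⋙ tensorSpaceLeft k (P ⟶ U) ⟶
      (Prod.sectR U B ⋙ box) ⋙ (linearCoyoneda k D).obj (op (box.obj (P, P'))) :=
    { app := fun V => ModuleCat.ofHom (homMap h.multi P U P' V)
      naturality := fun V V' f => ModuleCat.hom_ext (LinearMap.ext fun x =>
        homMap_lTensor_rightComp h.multi f x) }
  have := h.right.isIso_of_isIso_app α
    ((isIso_ofHom_iff (homMap h.multi P U P' P')).2 (h.homMap_bijective_gen_left U))
  exact (isIso_ofHom_iff (homMap h.multi P U P' V)).1 (NatIso.isIso_app_of_isIso α V)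

/-- Now the source varies. Both sides turn cokernels into kernels, i.e. are right exact into the
opposite of vector spaces; for this `- ⊗ W` must preserve kernels. The case `U = P` is already
known. -/
theorem IsBox.homMap_bijective_left (h : IsBox k P P' box) (U U' : A) (V : B) :
    Function.Bijective (homMap h.multi U U' P' V) := by
  have := (exact_tensorSpaceRight k (P' ⟶ V)).1
  have := preservesFiniteColimits_op (tensorSpaceRight k (P' ⟶ V))
  have := (h.multi.fixRight P').rightExact
  have := (isLinearRightExact_homTo k U').rightExact
  have := (isLinearRightExact_homTo k (box.obj (U', V))).rightExact
  have := comp_preservesFiniteColimits (homTo k U') (tensorSpaceRight k (P' ⟶ V)).op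
  have := comp_preservesFiniteColimits (Prod.sectL A P' ⋙ box) (homTo k (box.obj (U', V)))
  let α : (Prod.sectL A P' ⋙ box) ⋙ homTo k (box.obj (U', V)) ⟶
      homTo k U' ⋙ (tensorSpaceRight k (P' ⟶ V)).op :=
    { app := fun U => (ModuleCat.ofHom (homMap h.multi U U' P' V)).op
      naturality := fun U₀ U f => Quiver.Hom.unop_inj (ModuleCat.hom_ext (LinearMap.ext fun x =>
        (homMap_rTensor_leftComp h.multi f x).symm)) }
  have hα : ∀ U, IsIso (α.app U) ↔ Function.Bijective (homMap h.multi U U' P' V) := fun U =>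
    (isIso_op_iff (ModuleCat.ofHom (homMap h.multi U U' P' V))).trans (isIso_ofHom_iff _)
  have := h.left.isIso_of_isIso_app α ((hα P).2 (h.homMap_bijective_gen U' V))
  exact (hα U).1 (NatIso.isIso_app_of_isIso α U)

/-- Morphisms between product objects. -/
theorem IsBox.homMap_bijective (h : IsBox k P P' box) (U U' : A) (V V' : B) :
    Function.Bijective (homMap h.multi U U' V V') := by
  have := (exact_tensorSpaceLeft k (U ⟶ U')).1
  have := preservesFiniteColimits_op (tensorSpaceLeft k (U ⟶ U'))
  have := (h.multi.fixLeft U).rightExact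
  have := (isLinearRightExact_homTo k V').rightExact
  have := (isLinearRightExact_homTo k (box.obj (U', V'))).rightExact
  have := comp_preservesFiniteColimits (homTo k V') (tensorSpaceLeft k (U ⟶ U')).op
  have := comp_preservesFiniteColimits (Prod.sectR U B ⋙ box) (homTo k (box.obj (U', V')))
  let α : (Prod.sectR U B ⋙ box) ⋙ homTo k (box.obj (U', V')) ⟶
      homTo k V' ⋙ (tensorSpaceLeft k (U ⟶ U')).op :=
    { app := fun V => (ModuleCat.ofHom (homMap h.multi U U' V V')).op
      naturality := fun V₀ V f => Quiver.Hom.unop_inj (ModuleCat.hom_ext (LinearMap.ext fun x =>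
        (homMap_lTensor_leftComp h.multi f x).symm)) }
  have hα : ∀ V, IsIso (α.app V) ↔ Function.Bijective (homMap h.multi U U' V V') := fun V =>
    (isIso_op_iff (ModuleCat.ofHom (homMap h.multi U U' V V'))).trans (isIso_ofHom_iff _)
  have := h.right.isIso_of_isIso_app α ((hα P').2 (h.homMap_bijective_left U U' V'))
  exact (hα V).1 (NatIso.isIso_app_of_isIso α V)

theorem IsProjGen.mono_of_injective {X : Type u} [Category.{v} X] [Abelian X] {Q : X}
    (hQ : IsProjGen Q) {U V : X} (f : U ⟶ V) (hf : ∀ g : Q ⟶ U, g ≫ f = 0 → g = 0) : Mono f := by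
  refine Preadditive.mono_of_cancel_zero f fun {W} g hg => ?_
  refine hQ.hom_ext (𝟭 X) fun a => ?_
  exact (hf (a ≫ g) (by rw [Category.assoc, hg, comp_zero])).trans comp_zero.symm

/-- On maps from `P ⊠ P'` the morphism acts as `Hom(P, f) ⊗ Hom(P', V)`, and tensoring over a field
preserves injectivity. This upgrades right exactness of `⊠` to exactness. -/
theorem IsBox.mono_map_left (h : IsBox k P P' box) {U U' : A} (f : U ⟶ U') [Mono f] (V : B) :
    Mono (box.map (Prod.mkHom f (𝟙 V))) := by
  refine h.gen.mono_of_injective _ fun g hg => ?_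
  obtain ⟨x, rfl⟩ := (h.homMap_bijective_gen U V).2 g
  rw [← homMap_rTensor_rightComp] at hg
  have h₁ := (h.homMap_bijective_gen U' V).1 (hg.trans (map_zero _).symm)
  have hinj : Function.Injective (Linear.rightComp k P f) := fun a b hab =>
    (cancel_mono f).1 hab
  have h₂ := Module.Flat.rTensor_preserves_injective_linearMap (M := (P' ⟶ V)) _ hinj
  rw [h₂ (h₁.trans (map_zero _).symm), map_zero]

theorem IsBox.mono_map_right (h : IsBox k P P' box) (U : A) {V V' : B} (f : V ⟶ V') [Mono f] :
    Mono (box.map (Prod.mkHom (𝟙 U) f)) := by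
  refine h.gen.mono_of_injective _ fun g hg => ?_
  obtain ⟨x, rfl⟩ := (h.homMap_bijective_gen U V).2 g
  rw [← homMap_lTensor_rightComp] at hg
  have h₁ := (h.homMap_bijective_gen U V').1 (hg.trans (map_zero _).symm)
  have hinj : Function.Injective (Linear.rightComp k P' f) := fun a b hab =>
    (cancel_mono f).1 hab
  have h₂ := Module.Flat.lTensor_preserves_injective_linearMap (M := (P ⟶ U)) _ hinj
  rw [h₂ (h₁.trans (map_zero _).symm), map_zero]

theorem preservesFiniteLimits_of_mono {X : Type u} [Category.{v} X] [Abelian X] {Y : Type u₁}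
    [Category.{v₁} Y] [Abelian Y] (F : X ⥤ Y) [PreservesFiniteColimits F]
    (hF : ∀ {U V : X} (f : U ⟶ V) [Mono f], Mono (F.map f)) : PreservesFiniteLimits F := by
  refine ((F.preservesFiniteLimits_tfae).out 0 3).1 fun S hS => ?_
  have := hS.mono_f
  exact ⟨((F.preservesFiniteColimits_tfae.out 0 3 rfl rfl).2 inferInstance S hS).1, hF S.f⟩

theorem IsBox.preservesFiniteLimits_sectR (h : IsBox k P P' box) (U : A) :
    PreservesFiniteLimits (Prod.sectR U B ⋙ box) :=
  have := (h.multi.fixLeft U).rightExact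
  preservesFiniteLimits_of_mono _ fun f _ => h.mono_map_right U f

theorem IsBox.preservesFiniteLimits_sectL (h : IsBox k P P' box) (V : B) :
    PreservesFiniteLimits (Prod.sectL A V ⋙ box) :=
  have := (h.multi.fixRight V).rightExact
  preservesFiniteLimits_of_mono _ fun f _ => h.mono_map_left f V

end HomFormula

/-! ### Right exactness of opposite functors -/

section Opposites

variable {k : Type w} [Field k]
variable {A : Type u₁} [Category.{v₁} A] [Abelian A] [Linear k A]
variable {B : Type u₂} [Category.{v₂} B] [Abelian B] [Linear k B]
variable {E : Type u₃} [Category.{v₃} E] [Abelian E] [Linear k E]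

theorem linear_op (F : A ⥤ E) [F.Additive] [F.Linear k] : F.op.Linear k :=
  ⟨fun f c => Quiver.Hom.unop_inj (F.map_smul c f.unop)⟩

theorem isLinearRightExact_op {F : A ⥤ E} (hF : IsLinearRightExact k F)
    (h : PreservesFiniteLimits F) : IsLinearRightExact k F.op := by
  have := hF.additive
  have := hF.linear
  have := preservesFiniteColimits_op F
  exact ⟨inferInstance, linear_op F, this⟩

theorem isLinearRightExact_of_isEquivalence (F : A ⥤ E) [F.IsEquivalence] [F.Additive]
    [F.Linear k] : IsLinearRightExact k F :=
  ⟨inferInstance, inferInstance, inferInstance⟩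

end Opposites

/-! ### The contragredient functor of `C` -/

section Star

variable {k : Type w} [Field k]
variable {C : Type u} [Category.{v} C] [Abelian C] [Linear k C] [MonoidalCategory C]
variable (K : Conjugates k C)

theorem Conjugates.star_isEquivalence : K.star.IsEquivalence :=
  (CategoryTheory.Equivalence.mk K.star K.star.rightOp
    (NatIso.ofComponents (fun X => (K.δ.app X.unop).symm.op) fun f =>
      Quiver.Hom.unop_inj (K.δ.inv.naturality f.unop).symm)
    K.δ.symm).isEquivalence_functor

theorem Conjugates.isLinearRightExact_star : IsLinearRightExact k K.star :=
  have := K.star_isEquivalence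
  have := K.star_additive
  have := K.star_linear
  isLinearRightExact_of_isEquivalence K.star

theorem Conjugates.isLinearRightExact_rightOp : IsLinearRightExact k K.star.rightOp := by
  have := K.star_isEquivalence
  have := K.star_additive
  have := K.star_linear
  have : K.star.rightOp.Linear k := ⟨fun f c => Quiver.Hom.unop_inj (K.star.map_smul c f.op)⟩
  have : K.star.rightOp.IsEquivalence := inferInstance
  exact isLinearRightExact_of_isEquivalence K.star.rightOp

variable {D : Type u₁} [Category.{v₁} D] [Abelian D] [Linear k D]

theorem IsMultiRightExact.prod {A : Type u₁} [Category.{v₁} A] [Abelian A] [Linear k A]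
    {B : Type u₂} [Category.{v₂} B] [Abelian B] [Linear k B]
    {A' : Type u₃} [Category.{v₃} A'] [Abelian A'] [Linear k A']
    {B' : Type u} [Category.{v} B'] [Abelian B'] [Linear k B']
    {D : Type*} [Category* D] [Abelian D] [Linear k D]
    {G : A × B ⥤ D} (hG : IsMultiRightExact k G) {F : A' ⥤ A} {F' : B' ⥤ B}
    (hF : IsLinearRightExact k F) (hF' : IsLinearRightExact k F') :
    IsMultiRightExact k (F.prod F' ⋙ G) where
  fixLeft a := (hF'.comp (hG.fixLeft (F.obj a))).of_iso
    (NatIso.ofComponents (fun _ => Iso.refl _) fun f => natural_refl (by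
      change G.map (Prod.mkHom (𝟙 _) (F'.map f)) = G.map (Prod.mkHom (F.map (𝟙 a)) (F'.map f))
      rw [F.map_id]))
  fixRight b := (hF.comp (hG.fixRight (F'.obj b))).of_iso
    (NatIso.ofComponents (fun _ => Iso.refl _) fun f => natural_refl (by
      change G.map (Prod.mkHom (F.map f) (𝟙 _)) = G.map (Prod.mkHom (F.map f) (F'.map (𝟙 b)))
      rw [F'.map_id]))

end Star

/-! ### The product functor on opposite categories -/

section BoxOp

variable {k : Type w} [Field k]
variable {A : Type u} [Category.{v} A] [Abelian A] [Linear k A]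
variable {B : Type u₁} [Category.{v} B] [Abelian B] [Linear k B]
variable {D : Type u₂} [Category.{v} D] [Abelian D] [Linear k D]
variable {P : A} {P' : B}

/-- `(A, B) ↦ A ⊠ B` on the opposite categories. -/
def boxOp (box : A × B ⥤ D) : Aᵒᵖ × Bᵒᵖ ⥤ Dᵒᵖ where
  obj a := op (box.obj (a.1.unop, a.2.unop))
  map f := (box.map (Prod.mkHom f.1.unop f.2.unop)).op
  map_id a := Quiver.Hom.unop_inj (box.map_id (a.1.unop, a.2.unop))
  map_comp _ _ := Quiver.Hom.unop_inj (map_mkHom_comp box _ _ _ _).symm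

variable {box : A × B ⥤ D}

/-- Cokernels in the opposite category are kernels, so this is where left exactness of `⊠` in each
variable enters. -/
theorem IsBox.isMultiRightExact_boxOp (h : IsBox k P P' box) : IsMultiRightExact k (boxOp box) where
  fixLeft a := (isLinearRightExact_op (h.multi.fixLeft a.unop)
    (h.preservesFiniteLimits_sectR a.unop)).of_iso (NatIso.ofComponents (fun _ => Iso.refl _)
      fun _ => natural_refl rfl)
  fixRight b := (isLinearRightExact_op (h.multi.fixRight b.unop)
    (h.preservesFiniteLimits_sectL b.unop)).of_iso (NatIso.ofComponents (fun _ => Iso.refl _)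
      fun _ => natural_refl rfl)

theorem IsBox.homMap_boxOp_bijective (h : IsBox k P P' box) (U U' : A) (V V' : B) :
    Function.Bijective (homMap h.isMultiRightExact_boxOp (op U) (op U') (op V) (op V')) := by
  let e₁ : (op U ⟶ op U') ≃ₗ[k] (U' ⟶ U) :=
    { toFun := Quiver.Hom.unop, invFun := Quiver.Hom.op, map_add' := fun _ _ => rfl
      map_smul' := fun _ _ => rfl, left_inv := fun _ => rfl, right_inv := fun _ => rfl }
  let e₂ : (op V ⟶ op V') ≃ₗ[k] (V' ⟶ V) :=
    { toFun := Quiver.Hom.unop, invFun := Quiver.Hom.op, map_add' := fun _ _ => rfl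
      map_smul' := fun _ _ => rfl, left_inv := fun _ => rfl, right_inv := fun _ => rfl }
  have key : ⇑(homMap h.isMultiRightExact_boxOp (op U) (op U') (op V) (op V')) =
      Quiver.Hom.op ∘ homMap h.multi U' U V' V ∘ TensorProduct.congr e₁ e₂ := by
    funext x
    induction x with
    | zero => simp; rfl
    | add x y hx hy =>
      simp only [map_add, hx, hy, Function.comp_apply, op_add]
      rfl
    | tmul a b => rfl
  rw [key]
  exact (opEquiv _ _).symm.bijective.comp
    ((h.homMap_bijective U' U V' V).comp (TensorProduct.congr e₁ e₂).bijective)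

end BoxOp

/-! ### The induced involution -/

section ProductStar

variable {k : Type w} [Field k]
variable {C : Type u} [Category.{v} C] [Abelian C] [Linear k C] [MonoidalCategory C]
variable (K : Conjugates k C)
variable {D : Type u} [Category.{v} D] [Abelian D] [Linear k D] {P : C} {box : C × C ⥤ D}

/-- `boxStar` factors through `boxOp`. -/
def boxStarIso (box : C × C ⥤ D) : K.star.rightOp.prod K.star.rightOp ⋙ boxOp box ≅ boxStar k K box :=
  NatIso.ofComponents (fun _ => Iso.refl _) fun _ => natural_refl rfl

theorem IsBox.isMultiRightExact_boxStar (h : IsBox k P P box) :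
    IsMultiRightExact k (boxStar k K box) :=
  (h.isMultiRightExact_boxOp.prod K.isLinearRightExact_rightOp
    K.isLinearRightExact_rightOp).of_iso (boxStarIso K box)

theorem IsBox.nonempty_productStar (h : IsBox k P P box) : Nonempty (ProductStar k K box) :=
  h.nonempty_extension (h.isMultiRightExact_boxStar K)

end ProductStar

/-! ### Representability and injective cogenerators -/

section Representable

variable {k : Type w} [Field k]
variable {X : Type u} [Category.{v} X] [Abelian X] [Linear k X] {Q : X}

theorem finiteDimensional_hom_power [FiniteDimensional k (Q ⟶ Q)] (n : ℕ) :
    FiniteDimensional k (Q ⟶ ⨁ fun _ : Fin n => Q) := by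
  let f : (Q ⟶ ⨁ fun _ : Fin n => Q) →ₗ[k] (Fin n → (Q ⟶ Q)) :=
    LinearMap.pi fun i => Linear.rightComp k Q (biproduct.π (fun _ : Fin n => Q) i)
  refine FiniteDimensional.of_injective f fun a b hab => ?_
  exact biproduct.hom_ext _ _ fun i => congr_fun hab i

theorem IsProjGen.finiteDimensional_hom (hQ : IsProjGen Q) [FiniteDimensional k (Q ⟶ Q)] (U : X) :
    FiniteDimensional k (Q ⟶ U) := by
  have := hQ.projective
  obtain ⟨n, p, _⟩ := hQ.exists_epi U
  have := finiteDimensional_hom_power (k := k) (Q := Q) n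
  exact Module.Finite.of_surjective (Linear.rightComp k Q p) fun f =>
    ⟨Projective.factorThru f p, Projective.factorThru_comp f p⟩

/-- The action of a morphism on a contravariant functor with values in vector spaces. -/
def pull (G : X ⥤ (ModuleCat.{v} k)ᵒᵖ) {U V : X} (f : U ⟶ V) :
    (G.obj V).unop →ₗ[k] (G.obj U).unop :=
  (G.map f).unop.hom

theorem pull_comp (G : X ⥤ (ModuleCat.{v} k)ᵒᵖ) {U V W : X} (f : U ⟶ V) (g : V ⟶ W)
    (x : (G.obj W).unop) : pull G (f ≫ g) x = pull G f (pull G g x) := by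
  simp [pull]

theorem pull_id (G : X ⥤ (ModuleCat.{v} k)ᵒᵖ) {U : X} (x : (G.obj U).unop) :
    pull G (𝟙 U) x = x := by
  simp [pull]

/-- The pullback of an element along morphisms. -/
def pullElement {G : X ⥤ (ModuleCat.{v} k)ᵒᵖ} (hG : IsLinearRightExact k G) {V : X}
    (x : (G.obj V).unop) (U : X) : (U ⟶ V) →ₗ[k] (G.obj U).unop where
  toFun f := pull G f x
  map_add' f g := by
    have := hG.additive
    simp [pull]
  map_smul' c f := by
    have := hG.linear
    have : G.map (c • f) = c • G.map f := G.map_smul c f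
    simp only [pull, this]
    rfl

/-- The Yoneda map of an element. -/
def elementHom {G : X ⥤ (ModuleCat.{v} k)ᵒᵖ} (hG : IsLinearRightExact k G) {V : X}
    (x : (G.obj V).unop) : G ⟶ homTo k V where
  app U := (ModuleCat.ofHom (pullElement hG x U)).op
  naturality _ _ f := Quiver.Hom.unop_inj (ModuleCat.hom_ext (LinearMap.ext fun a =>
    (pull_comp G f a x).symm))

theorem IsProjGen.isIso_elementHom (hQ : IsProjGen Q) {G : X ⥤ (ModuleCat.{v} k)ᵒᵖ}
    (hG : IsLinearRightExact k G) {V : X} (x : (G.obj V).unop)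
    (h : Function.Bijective (pullElement hG x Q)) : IsIso (elementHom hG x) := by
  have := hG.rightExact
  have := (isLinearRightExact_homTo k V).rightExact
  exact hQ.isIso_of_isIso_app _ ((isIso_op_iff (ModuleCat.ofHom (pullElement hG x Q))).2
    ((isIso_ofHom_iff _).2 h))

/-- Left exact contravariant functors to vector spaces are representable. -/
theorem IsProjGen.exists_representing (hQ : IsProjGen Q) [FiniteDimensional k (Q ⟶ Q)]
    {G : X ⥤ (ModuleCat.{v} k)ᵒᵖ} (hG : IsLinearRightExact k G)
    (hf : FiniteDimensional k (G.obj Q).unop) :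
    ∃ (R : X) (ξ : (G.obj R).unop), IsIso (elementHom hG ξ) := by
  have := hQ.projective
  have := hG.additive
  have := hG.rightExact
  obtain ⟨n, g, hg⟩ := Module.Finite.exists_fin (R := k) (M := (G.obj Q).unop)
  have pull_ext : ∀ {n : ℕ} (x : (G.obj (⨁ fun _ : Fin n => Q)).unop),
      (∀ i, pull G (biproduct.ι (fun _ : Fin n => Q) i) x = 0) → x = 0 := by
    intro n x hx
    have h₁ : pullElement hG x _ (∑ i, biproduct.π (fun _ : Fin n => Q) i ≫
        biproduct.ι (fun _ : Fin n => Q) i) = x := by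
      rw [biproduct.total]; exact pull_id G x
    rw [← h₁, map_sum]
    exact Finset.sum_eq_zero fun i _ => by
      change pull G _ x = 0
      rw [pull_comp, hx, map_zero]
  -- Generators of `G(Q)` assemble into one element of `G(Q^n)`, making `Hom(Q, Q^n) → G(Q)`
  -- surjective. Generators of its kernel form `ρ : Q^m ⟶ Q^n`, and the cokernel of `ρ` is the
  -- representing object.
  let γ : (G.obj (⨁ fun _ : Fin n => Q)).unop :=
    ∑ i, pull G (biproduct.π (fun _ : Fin n => Q) i) (g i)
  have hγ : ∀ i, pull G (biproduct.ι (fun _ : Fin n => Q) i) γ = g i := by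
    intro i
    simp only [γ, map_sum, ← pull_comp]
    rw [Finset.sum_eq_single i]
    · rw [biproduct.ι_π_self, pull_id]
    · intro j _ hj
      rw [biproduct.ι_π_ne _ hj.symm]
      simp [pull]
    · simp
  have := finiteDimensional_hom_power (k := k) (Q := Q) n
  obtain ⟨m, r, hr⟩ := Module.Finite.exists_fin (R := k) (M := LinearMap.ker (pullElement hG γ Q))
  let ρ : (⨁ fun _ : Fin m => Q) ⟶ ⨁ fun _ : Fin n => Q := biproduct.desc fun j => (r j).1
  have hρ : pull G ρ γ = 0 := pull_ext _ fun j => by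
    rw [← pull_comp, biproduct.ι_desc]
    exact (r j).2
  -- `G` sends the cokernel of `ρ` to the kernel of `G(ρ)`, and `γ` lies in that kernel.
  have hex : ∃ ξ, pull G (cokernel.π ρ) ξ = γ := by
    have := (map_exact_epi G (ShortComplex.exact_cokernel ρ) inferInstance).1.unop
    rw [ShortComplex.moduleCat_exact_iff] at this
    exact this γ hρ
  obtain ⟨ξ, hξ⟩ := hex
  refine ⟨cokernel ρ, ξ, hQ.isIso_elementHom hG ξ ⟨?_, ?_⟩⟩
  · rw [injective_iff_map_eq_zero]
    intro f hf
    have h₁ : Projective.factorThru f (cokernel.π ρ) ∈ LinearMap.ker (pullElement hG γ Q) := by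
      rw [LinearMap.mem_ker]
      change pull G _ γ = 0
      rw [← hξ, ← pull_comp, Projective.factorThru_comp]
      exact hf
    have h₂ : ∀ y ∈ LinearMap.ker (pullElement hG γ Q), y ≫ cokernel.π ρ = 0 := by
      intro y hy
      have h₃ : (⟨y, hy⟩ : LinearMap.ker (pullElement hG γ Q)) ∈
          Submodule.span k (Set.range r) := hr ▸ Submodule.mem_top
      have h₄ : Submodule.span k (Set.range r) ≤ LinearMap.ker
          ((Linear.rightComp k Q (cokernel.π ρ)).comp (Submodule.subtype _)) := by
        rw [Submodule.span_le]
        rintro _ ⟨j, rfl⟩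
        change (r j).1 ≫ cokernel.π ρ = 0
        have : (r j).1 = biproduct.ι (fun _ : Fin m => Q) j ≫ ρ := by simp [ρ]
        rw [this, Category.assoc, cokernel.condition, comp_zero]
      exact h₄ h₃
    rw [← Projective.factorThru_comp f (cokernel.π ρ), h₂ _ h₁]
  · rw [← LinearMap.range_eq_top, ← top_le_iff, ← hg, Submodule.span_le]
    rintro _ ⟨i, rfl⟩
    refine ⟨biproduct.ι (fun _ : Fin n => Q) i ≫ cokernel.π ρ, ?_⟩
    change pull G _ ξ = _
    rw [pull_comp, hξ, hγ]

section Dual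

variable (k) in
/-- `U ↦ Hom_k(Hom(Q, U), W)`. -/
def dualHom (Q : X) (W : Type v) [AddCommGroup W] [Module k W] : X ⥤ (ModuleCat.{v} k)ᵒᵖ :=
  (linearCoyoneda k X).obj (op Q) ⋙ homTo k (ModuleCat.of k W)

variable {W : Type v} [AddCommGroup W] [Module k W]

theorem IsProjGen.isLinearRightExact_dualHom (hQ : IsProjGen Q) :
    IsLinearRightExact k (dualHom k Q W) := by
  have := hQ.projective
  have := preservesFiniteColimits_linearCoyoneda k Q
  refine IsLinearRightExact.comp ⟨inferInstance, ⟨fun f c => ?_⟩, this⟩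
    (isLinearRightExact_homTo k _)
  ext g
  exact Linear.comp_smul _ _ _ g c f

/-- The pairing `Hom(U, I) × Hom(Q, U) → W` induced by a linear map `Hom(Q, I) → W`. -/
def dualPairing {I : X} (ev : (Q ⟶ I) →ₗ[k] W) (U : X) :
    (U ⟶ I) →ₗ[k] ((Q ⟶ U) →ₗ[k] W) where
  toFun f := ev ∘ₗ Linear.rightComp k Q f
  map_add' f g := by ext; simp
  map_smul' c f := by ext; simp

theorem bijective_dualPairing_iff (hQ : IsProjGen Q) {I : X} (ev : (Q ⟶ I) →ₗ[k] W) (U : X) :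
    Function.Bijective (dualPairing ev U) ↔
      Function.Bijective (pullElement (hQ.isLinearRightExact_dualHom (W := W)) (V := I)
        (ModuleCat.ofHom ev : ModuleCat.of k (Q ⟶ I) ⟶ ModuleCat.of k W) U) := by
  have : ⇑(pullElement (hQ.isLinearRightExact_dualHom (W := W)) (V := I)
        (ModuleCat.ofHom ev : ModuleCat.of k (Q ⟶ I) ⟶ ModuleCat.of k W) U) =
      (ModuleCat.homEquiv (M := ModuleCat.of k (Q ⟶ U)) (N := ModuleCat.of k W)).symm ∘
        dualPairing ev U := rfl
  have h := (ModuleCat.homEquiv (M := ModuleCat.of k (Q ⟶ U))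
    (N := ModuleCat.of k W)).symm.comp_bijective (dualPairing ev U)
  exact ⟨fun h' => this ▸ h.2 h', fun h' => h.1 (this ▸ h')⟩

theorem IsProjGen.dualPairing_bijective (hQ : IsProjGen Q) {I : X} (ev : (Q ⟶ I) →ₗ[k] W)
    (h : Function.Bijective (dualPairing ev Q)) (U : X) :
    Function.Bijective (dualPairing ev U) := by
  rw [bijective_dualPairing_iff hQ] at h ⊢
  have := hQ.isIso_elementHom hQ.isLinearRightExact_dualHom _ h
  exact (isIso_ofHom_iff _).1 ((isIso_op_iff (ModuleCat.ofHom
    (pullElement (hQ.isLinearRightExact_dualHom (W := W)) (V := I) _ U))).1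
      (NatIso.isIso_app_of_isIso (elementHom hQ.isLinearRightExact_dualHom _) U))

/-- The functor `U ↦ Hom_k(Hom(Q, U), W)` is left exact and finite-dimensional at `Q`, hence
representable. The space `W` takes the place of `k` because it has to live in the universe of the
Hom spaces. -/
theorem IsProjGen.exists_dualPairing (hQ : IsProjGen Q) [FiniteDimensional k (Q ⟶ Q)]
    [FiniteDimensional k W] : ∃ (I : X) (ev : (Q ⟶ I) →ₗ[k] W), ∀ U,
      Function.Bijective (dualPairing ev U) := by
  have hf : FiniteDimensional k ((dualHom k Q W).obj Q).unop :=
    Module.Finite.equiv (ModuleCat.homLinearEquiv (S := k) (M := ModuleCat.of k (Q ⟶ Q))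
      (N := ModuleCat.of k W)).symm
  obtain ⟨I, ξ, hξ⟩ := hQ.exists_representing (hQ.isLinearRightExact_dualHom (W := W)) hf
  refine ⟨I, (show ModuleCat.of k (Q ⟶ I) ⟶ ModuleCat.of k W from ξ).hom,
    fun U => (bijective_dualPairing_iff hQ _ U).2 ?_⟩
  exact (isIso_ofHom_iff _).1 ((isIso_op_iff (ModuleCat.ofHom
    (pullElement (hQ.isLinearRightExact_dualHom (W := W)) (V := I) ξ U))).1
      (NatIso.isIso_app_of_isIso (elementHom hQ.isLinearRightExact_dualHom _) U))

/-- An object which represents the dual of `Hom(Q, -)` is an injective cogenerator. -/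
theorem IsProjGen.op_of_dualPairing (hQ : IsProjGen Q) [FiniteDimensional k (Q ⟶ Q)] {I : X}
    (ev : (Q ⟶ I) →ₗ[k] W) (h : ∀ U, Function.Bijective (dualPairing ev U)) (x : W)
    (hx : ∀ (U : X) (y : Q ⟶ U), y ≠ 0 → x ≠ 0) : IsProjGen (op I) where
  projective := by
    have : Injective I := by
      refine ⟨fun {U V} g f _ => ?_⟩
      have hinj : LinearMap.ker (Linear.rightComp k Q f) = ⊥ :=
        LinearMap.ker_eq_bot.2 fun a b hab => (cancel_mono f).1 hab
      -- Maps into `I` are linear maps `Hom(Q, -) → W`; extending one along a mono needs only a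
      -- linear retraction of an injection of vector spaces.
      obtain ⟨l, hl⟩ := LinearMap.exists_leftInverse_of_injective _ hinj
      obtain ⟨t, ht⟩ := (h V).2 (dualPairing ev U g ∘ₗ l)
      refine ⟨t, (h U).1 (LinearMap.ext fun a => ?_)⟩
      have h₁ := LinearMap.congr_fun ht (a ≫ f)
      have h₂ : l (a ≫ f) = a := LinearMap.congr_fun hl a
      change _ = dualPairing ev U g (l (a ≫ f)) at h₁
      rw [h₂] at h₁
      rw [← h₁]
      simp [dualPairing]
    infer_instance
  exists_epi U := by
    have := hQ.finiteDimensional_hom (k := k) U.unop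
    let b := Module.finBasis k (Q ⟶ U.unop)
    -- The maps `φ i` correspond to the coordinate functionals of a basis of `Hom(Q, U)` times `x`;
    -- together they detect every nonzero map from `Q`.
    choose φ hφ using fun i => (h U.unop).2 ((b.coord i).smulRight x)
    refine ⟨_, biproduct.desc fun i => (φ i).op, Preadditive.epi_of_cancel_zero _ fun {Z} g hg => ?_⟩
    have hg' : ∀ i, g.unop ≫ φ i = 0 := fun i => by
      have := congr_arg (fun t => biproduct.ι (fun _ => op I) i ≫ t) hg
      simp only [biproduct.ι_desc_assoc, comp_zero] at this
      exact Quiver.Hom.op_inj this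
    refine Quiver.Hom.unop_inj (hQ.hom_ext (𝟭 X) fun a => ?_)
    change a ≫ g.unop = a ≫ 0
    rw [comp_zero]
    by_contra hne
    -- The vector `x` must be nonzero only if some `Q ⟶ U` is nonzero, so the zero category is not
    -- excluded.
    have hx' := hx _ _ hne
    refine hne (b.ext_elem fun i => ?_)
    have h₁ := LinearMap.congr_fun (hφ i) (a ≫ g.unop)
    have h₂ : dualPairing ev U.unop (φ i) (a ≫ g.unop) = 0 := by
      simp [dualPairing, hg']
    rw [h₂] at h₁
    have h₃ : b.coord i (a ≫ g.unop) • x = 0 := h₁.symm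
    rw [smul_eq_zero] at h₃
    simpa using h₃.resolve_right hx'

end Dual

end Representable

/-! ### The opposite of a Deligne product -/

section DualBox

variable {k : Type w} [Field k]
variable {A : Type u} [Category.{v} A] [Abelian A] [Linear k A]
variable {B : Type u₁} [Category.{v} B] [Abelian B] [Linear k B]
variable {D : Type u₂} [Category.{v} D] [Abelian D] [Linear k D]
variable {P : A} {P' : B} {box : A × B ⥤ D}

theorem IsBox.finiteDimensional_hom (h : IsBox k P P' box) [FiniteDimensional k (P ⟶ P)]
    [FiniteDimensional k (P' ⟶ P')] :
    FiniteDimensional k (box.obj (P, P') ⟶ box.obj (P, P')) :=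
  Module.Finite.equiv (LinearEquiv.ofBijective _ h.bij)

/-- The opposite of a Deligne product is a Deligne product of the opposite categories. -/
theorem IsBox.exists_isBox_boxOp (h : IsBox k P P' box) [FiniteDimensional k (P ⟶ P)]
    [FiniteDimensional k (P' ⟶ P')] : ∃ I I', IsBox k (op I) (op I') (boxOp box) := by
  have := h.finiteDimensional_hom
  obtain ⟨I, ev, hev⟩ := h.left.exists_dualPairing (k := k) (W := P ⟶ P)
  obtain ⟨I', ev', hev'⟩ := h.right.exists_dualPairing (k := k) (W := P' ⟶ P')
  let e := LinearEquiv.ofBijective _ (h.homMap_bijective_gen I I')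
  let EV : (box.obj (P, P') ⟶ box.obj (I, I')) →ₗ[k] (P ⟶ P) ⊗[k] (P' ⟶ P') :=
    TensorProduct.map ev ev' ∘ₗ e.symm.toLinearMap
  let d := LinearEquiv.ofBijective _ (hev P)
  let d' := LinearEquiv.ofBijective _ (hev' P')
  let e₀ := LinearEquiv.ofBijective _ h.bij
  -- By the Hom formula and finite-dimensionality, `Hom(P ⊠ P', I ⊠ I')` is the tensor product of
  -- the two dual spaces, hence the dual of `End (P ⊠ P')` with values in `End P ⊗ End P'`. So `I ⊠
  -- I'` represents the dual of `Hom(P ⊠ P', -)`.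
  let s : (box.obj (P, P') ⟶ box.obj (I, I')) ≃ₗ[k]
      ((box.obj (P, P') ⟶ box.obj (P, P')) →ₗ[k] (P ⟶ P) ⊗[k] (P' ⟶ P')) :=
    e.symm ≪≫ₗ TensorProduct.congr d d' ≪≫ₗ homTensorHomEquiv k _ _ _ _ ≪≫ₗ
      e₀.arrowCongr (LinearEquiv.refl k _)
  have hs : ∀ f, dualPairing EV (box.obj (P, P')) f = s f := by
    intro f
    obtain ⟨x, rfl⟩ := e.surjective f
    ext g
    obtain ⟨y, rfl⟩ := e₀.surjective g
    have h₁ : s (e x) (e₀ y) = homTensorHomEquiv k _ _ _ _ (TensorProduct.congr d d' x) y := by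
      simp [s]
    rw [h₁]
    clear h₁
    change TensorProduct.map ev ev' (e.symm (e₀ y ≫ e x)) = _
    induction x using TensorProduct.induction_on with
    | zero => simp
    | add x₁ x₂ h₁ h₂ => simp_all [Preadditive.comp_add]
    | tmul f f' =>
      induction y using TensorProduct.induction_on with
      | zero => simp
      | add y₁ y₂ h₁ h₂ => simp_all [Preadditive.add_comp]
      | tmul g g' =>
        have h₂ : e₀ (g ⊗ₜ g') ≫ e (f ⊗ₜ f') = e ((g ≫ f) ⊗ₜ (g' ≫ f')) := by
          change homMap h.multi P P P' P' _ ≫ homMap h.multi P I P' I' _ =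
            homMap h.multi P I P' I' _
          simp only [homMap_tmul, map_mkHom_comp]
        rw [h₂, e.symm_apply_apply]
        simp only [TensorProduct.map_tmul, TensorProduct.congr_tmul, homTensorHomEquiv_apply,
          TensorProduct.homTensorHomMap_apply]
        rfl
  have hbij : Function.Bijective (dualPairing EV (box.obj (P, P'))) := by
    have : ⇑(dualPairing EV (box.obj (P, P'))) = s := funext hs
    rw [this]
    exact s.bijective
  refine ⟨I, I', h.left.op_of_dualPairing ev hev (𝟙 P) fun U y hy h₁ => hy ?_,
    h.right.op_of_dualPairing ev' hev' (𝟙 P') fun U y hy h₁ => hy ?_, h.isMultiRightExact_boxOp,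
    h.gen.op_of_dualPairing EV (h.gen.dualPairing_bijective EV hbij) (𝟙 P ⊗ₜ 𝟙 P')
      fun U y hy h₁ => hy ?_,
    h.homMap_boxOp_bijective I I I' I'⟩
  · rw [← Category.id_comp y, h₁, zero_comp]
  · rw [← Category.id_comp y, h₁, zero_comp]
  · have : 𝟙 (box.obj (P, P')) = 0 := by
      have h₂ := homMap_tmul h.multi (𝟙 P) (𝟙 P')
      rw [h₁, map_zero] at h₂
      exact (box.map_id (P, P')).symm.trans h₂.symm
    rw [← Category.id_comp y, this, zero_comp]

end DualBox

/-! ### The induced involution is an equivalence -/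

section StarEquivalence

variable {k : Type w} [Field k]
variable {C : Type u} [Category.{v} C] [Abelian C] [Linear k C] [MonoidalCategory C]
variable {K : Conjugates k C}
variable {D : Type u} [Category.{v} D] [Abelian D] [Linear k D] {P : C} {box : C × C ⥤ D}

variable (K) in
/-- `U ↦ U^*` is an involutive equivalence between `C` and its opposite. -/
def Conjugates.starδ : K.star ⋙ K.star.rightOp ≅ 𝟭 Cᵒᵖ :=
  NatIso.ofComponents (fun X => (K.δ.app X.unop).op) fun f =>
    Quiver.Hom.unop_inj (K.δ.hom.naturality f.unop).symm

/-- The opposite of `D` being a Deligne product, `A^* ⊠ B^*` also extends to `τ` from the opposite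
of `D` to `D`. Both composites of `σ` and `τ` agree with the identity on product objects through
`δ`, hence everywhere. -/
theorem IsBox.isEquivalence_star (h : IsBox k P P box) [FiniteDimensional k (P ⟶ P)]
    (σ : ProductStar k K box) : σ.star.IsEquivalence := by
  obtain ⟨I, I', hop⟩ := h.exists_isBox_boxOp
  obtain ⟨τ⟩ := hop.nonempty_extension
    (h.multi.prod K.isLinearRightExact_star K.isLinearRightExact_star)
  have := σ.isLinearRightExact.rightExact
  have := τ.isLinearRightExact.rightExact
  have : PreservesFiniteColimits (σ.functor ⋙ τ.functor) := comp_preservesFiniteColimits _ _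
  have : PreservesFiniteColimits (τ.functor ⋙ σ.functor) := comp_preservesFiniteColimits _ _
  have e₁ : box ⋙ 𝟭 D ≅ box ⋙ σ.functor ⋙ τ.functor :=
    (Functor.isoWhiskerRight (NatIso.prod K.δ K.δ) box :) ≪≫
      Functor.isoWhiskerLeft (K.star.rightOp.prod K.star.rightOp) τ.iso.symm ≪≫
      Functor.isoWhiskerRight (boxStarIso K box ≪≫ σ.iso.symm) τ.functor
  have e₂ : boxOp box ⋙ τ.functor ⋙ σ.functor ≅ boxOp box ⋙ 𝟭 Dᵒᵖ :=
    (Functor.isoWhiskerRight τ.iso σ.functor :) ≪≫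
      Functor.isoWhiskerLeft (K.star.prod K.star) (σ.iso ≪≫ (boxStarIso K box).symm) ≪≫
      (Functor.isoWhiskerRight (NatIso.prod K.starδ K.starδ) (boxOp box) :)
  obtain ⟨i₁, _⟩ := h.nonempty_iso e₁
  obtain ⟨i₂, _⟩ := hop.nonempty_iso e₂
  have : σ.functor.IsEquivalence :=
    (CategoryTheory.Equivalence.mk σ.functor τ.functor i₁ i₂).isEquivalence_functor
  exact inferInstanceAs σ.functor.leftOp.IsEquivalence

theorem ProductStar.isLinearRightExact_star (σ : ProductStar k K box) (h : σ.star.IsEquivalence) :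
    IsLinearRightExact k σ.star := by
  have := σ.isLinearRightExact.additive
  have := σ.isLinearRightExact.linear
  have : σ.star.Linear k := ⟨fun f c => Quiver.Hom.op_inj (σ.functor.map_smul c f.unop)⟩
  exact isLinearRightExact_of_isEquivalence σ.star

/-- `(A ⊠ B)^* ≅ A^* ⊠ B^*` -/
def ProductStar.starBox (σ : ProductStar k K box) (b : C × C) :
    σ.star.obj (op (box.obj b)) ≅ box.obj (K.star.obj (op b.1), K.star.obj (op b.2)) :=
  (σ.iso.app b).unop.symm

theorem ProductStar.starBox_naturality (σ : ProductStar k K box) {b b' : C × C} (g : b ⟶ b') :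
    σ.star.map (box.map g).op ≫ (σ.starBox b).hom =
      (σ.starBox b').hom ≫ box.map (Prod.mkHom (K.star.map g.1.op) (K.star.map g.2.op)) :=
  Quiver.Hom.op_inj (σ.iso.inv.naturality g).symm

/-- As an equivalence, `σ.star` is right exact out of the opposite category, so the double dual is
right exact; on product objects it is identified with the identity by `δ ⊠ δ`. -/
theorem IsBox.nonempty_starStar (h : IsBox k P P box) [FiniteDimensional k (P ⟶ P)]
    (σ : ProductStar k K box) (X : D) :
    Nonempty (X ≅ σ.star.obj (op (σ.star.obj (op X)))) := by
  have := σ.isLinearRightExact.rightExact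
  have := (σ.isLinearRightExact_star (h.isEquivalence_star σ)).rightExact
  have : PreservesFiniteColimits (σ.functor ⋙ σ.star) := comp_preservesFiniteColimits _ _
  have e : box ⋙ 𝟭 D ≅ box ⋙ σ.functor ⋙ σ.star :=
    (Functor.isoWhiskerRight (NatIso.prod K.δ K.δ) box :) ≪≫
      NatIso.ofComponents (fun b => (σ.starBox (K.star.obj (op b.1), K.star.obj (op b.2))).symm ≪≫
        σ.star.mapIso (σ.starBox b).op) fun {b b'} g => by
        have h₁ := σ.starBox_naturality
          (Prod.mkHom (K.star.map g.1.op) (K.star.map g.2.op) :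
            (K.star.obj (op b'.1), K.star.obj (op b'.2)) ⟶ (K.star.obj (op b.1), K.star.obj (op b.2)))
        have h₂ := congr_arg (fun t => σ.star.map t.op) (σ.starBox_naturality g)
        simp only [op_comp, Functor.map_comp] at h₂
        change box.map (Prod.mkHom (K.star.map (K.star.map g.1.op).op)
          (K.star.map (K.star.map g.2.op).op)) ≫
            (σ.starBox (K.star.obj (op b'.1), K.star.obj (op b'.2))).inv ≫
            σ.star.map (σ.starBox b').hom.op =
          ((σ.starBox (K.star.obj (op b.1), K.star.obj (op b.2))).inv ≫
            σ.star.map (σ.starBox b).hom.op) ≫ σ.star.map (σ.star.map (box.map g).op).op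
        rw [Category.assoc, h₂, Iso.eq_inv_comp, ← reassoc_of% h₁, Iso.hom_inv_id_assoc]
  obtain ⟨i, _⟩ := h.nonempty_iso e
  exact ⟨i.app X⟩

end StarEquivalence

/-! ### The two Hom pairings as right exact bifunctors -/

section Pairing

variable (k : Type w) [Field k]
variable {D : Type u} [Category.{v} D] [Abelian D] [Linear k D]

/-- `(X, Y) ↦ Hom(X, S(Y))` -/
def homPairing (S : D ⥤ Dᵒᵖ) [S.Additive] : D ⥤ D ⥤ (ModuleCat.{v} k)ᵒᵖ where
  obj X := S ⋙ ((linearCoyoneda k D).obj (op X)).op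
  map f := Functor.whiskerLeft S (NatTrans.op ((linearCoyoneda k D).map f.op))

/-- `(X, Y) ↦ Hom(X ⊗ Y, Z)` -/
def tensorPairing [MonoidalCategory D] (Z : D) : D ⥤ D ⥤ (ModuleCat.{v} k)ᵒᵖ :=
  curriedTensor D ⋙ (Functor.whiskeringRight D D _).obj (homTo k Z)

theorem preservesFiniteColimits_homPairing (S : D ⥤ Dᵒᵖ) [S.Additive] :
    PreservesFiniteColimits (homPairing k S) :=
  preservesFiniteColimits_of_evaluation _ fun Y =>
    (isLinearRightExact_homTo k (S.obj Y).unop).rightExact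

theorem preservesFiniteColimits_homPairing_obj (S : D ⥤ Dᵒᵖ) [S.Additive]
    [PreservesFiniteColimits S] (X : D) : PreservesFiniteColimits ((homPairing k S).obj X) := by
  have := preservesFiniteLimits_linearCoyoneda k X
  have := preservesFiniteColimits_op ((linearCoyoneda k D).obj (op X))
  exact comp_preservesFiniteColimits _ _

theorem preservesFiniteColimits_tensorPairing [MonoidalCategory D] (hD : RightExactTensor D)
    (Z : D) : PreservesFiniteColimits (tensorPairing k Z) :=
  preservesFiniteColimits_of_evaluation _ fun Y =>
    have := (isLinearRightExact_homTo k Z).rightExact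
    have := (hD Y).2
    inferInstanceAs (PreservesFiniteColimits (tensorRight Y ⋙ homTo k Z))

theorem preservesFiniteColimits_tensorPairing_obj [MonoidalCategory D] (hD : RightExactTensor D)
    (Z X : D) : PreservesFiniteColimits ((tensorPairing k Z).obj X) :=
  have := (isLinearRightExact_homTo k Z).rightExact
  have := (hD X).1
  inferInstanceAs (PreservesFiniteColimits (tensorLeft X ⋙ homTo k Z))

end Pairing

/-! ### Conjugates on the Deligne product -/

section Conjugates

variable {k : Type w} [Field k]
variable {C : Type u} [Category.{v} C] [Abelian C] [Linear k C] [MonoidalCategory C]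
  [MonoidalPreadditive C] [MonoidalLinear k C]

/-- `π` is linear. -/
def Conjugates.piLinear (K : Conjugates k C) (U V : C) :
    (U ⟶ K.star.obj (op V)) ≃ₗ[k] (U ⊗ V ⟶ K.star.obj (op (𝟙_ C))) where
  __ := K.π U V
  map_add' f g := by
    have h (f : U ⟶ K.star.obj (op V)) : K.π U V f = f ▷ V ≫ K.π _ V (𝟙 _) := by
      rw [← K.π_natural_left, Category.comp_id]
    change K.π U V _ = K.π U V _ + K.π U V _
    rw [h, h f, h g, MonoidalPreadditive.add_whiskerRight, Preadditive.add_comp]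
  map_smul' c f := by
    have h (f : U ⟶ K.star.obj (op V)) : K.π U V f = f ▷ V ≫ K.π _ V (𝟙 _) := by
      rw [← K.π_natural_left, Category.comp_id]
    change K.π U V _ = c • K.π U V _
    rw [h, h f, MonoidalLinear.smul_whiskerRight, Linear.smul_comp]

variable {K : Conjugates k C}
variable {D : Type u} [Category.{v} D] [Abelian D] [Linear k D] {P : C} {box : C × C ⥤ D}
variable [MonoidalCategory D]

open Functor.LaxMonoidal

/-- The evaluation `(A^* ⊠ B^*) ⊗ (A ⊠ B) → 1^* ⊠ 1^*`. -/
def boxEval (K : Conjugates k C) (box : C × C ⥤ D) [box.LaxMonoidal] (b : C × C) :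
    box.obj (K.star.obj (op b.1), K.star.obj (op b.2)) ⊗ box.obj b ⟶
      box.obj (K.star.obj (op (𝟙_ C)), K.star.obj (op (𝟙_ C))) :=
  μ box (K.star.obj (op b.1), K.star.obj (op b.2)) b ≫
    box.map (Prod.mkHom (K.π _ _ (𝟙 _)) (K.π _ _ (𝟙 _)))

theorem map_whiskerRight_boxEval [box.LaxMonoidal] {U U' : C} (b : C × C)
    (f : U ⟶ K.star.obj (op b.1)) (g : U' ⟶ K.star.obj (op b.2)) :
    box.map (Prod.mkHom f g) ▷ box.obj b ≫ boxEval K box b =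
      μ box (U, U') b ≫ box.map (Prod.mkHom (K.π U b.1 f) (K.π U' b.2 g)) := by
  rw [boxEval, ← Category.assoc, μ_natural_left, Category.assoc]
  congr 1
  refine (map_mkHom_comp box _ _ _ _).trans ?_
  congr 2
  · exact (K.π_natural_left _ _ _).symm.trans (by rw [Category.comp_id])
  · exact (K.π_natural_left _ _ _).symm.trans (by rw [Category.comp_id])

/-- Both sides are `box` of the morphisms `π(g^*)`: on the left by naturality of `π` in its first
variable, on the right in its second. -/
theorem boxEval_dinatural [box.LaxMonoidal] {b b' : C × C} (g : b ⟶ b') :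
    box.map (Prod.mkHom (K.star.map g.1.op) (K.star.map g.2.op)) ▷ box.obj b ≫ boxEval K box b =
      box.obj (K.star.obj (op b'.1), K.star.obj (op b'.2)) ◁ box.map g ≫ boxEval K box b' := by
  rw [map_whiskerRight_boxEval, boxEval, ← Category.assoc _ (μ box _ b'), μ_natural_right,
    Category.assoc]
  congr 1
  refine Eq.trans ?_ (map_mkHom_comp box _ _ _ _).symm
  congr 2
  · exact Eq.trans (by rw [Category.id_comp]) (K.π_natural_right _ _ _)
  · exact Eq.trans (by rw [Category.id_comp]) (K.π_natural_right _ _ _)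

/-- The evaluation `(A ⊠ B)^* ⊗ (A ⊠ B) → 1^* ⊠ 1^*`. -/
def starEval (σ : ProductStar k K box) [box.LaxMonoidal] (b : C × C) :
    σ.star.obj (op (box.obj b)) ⊗ box.obj b ⟶
      box.obj (K.star.obj (op (𝟙_ C)), K.star.obj (op (𝟙_ C))) :=
  (σ.starBox b).hom ▷ _ ≫ boxEval K box b

theorem starEval_dinatural (σ : ProductStar k K box) [box.LaxMonoidal] {b b' : C × C}
    (g : b ⟶ b') : σ.star.map (box.map g).op ▷ box.obj b ≫ starEval σ b =
      σ.star.obj (op (box.obj b')) ◁ box.map g ≫ starEval σ b' := by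
  rw [starEval, starEval, ← comp_whiskerRight_assoc, σ.starBox_naturality, comp_whiskerRight_assoc,
    boxEval_dinatural, whisker_exchange_assoc]

variable [MonoidalPreadditive D] [MonoidalLinear k D]

/-- `Hom(X, (A ⊠ B)^*) → Hom(X ⊗ (A ⊠ B), 1^* ⊠ 1^*)` -/
def starPi (σ : ProductStar k K box) [box.LaxMonoidal] (X : D) (b : C × C) :
    (X ⟶ σ.star.obj (op (box.obj b))) →ₗ[k]
      (X ⊗ box.obj b ⟶ box.obj (K.star.obj (op (𝟙_ C)), K.star.obj (op (𝟙_ C)))) where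
  toFun f := f ▷ box.obj b ≫ starEval σ b
  map_add' f g := by simp
  map_smul' c f := by simp

theorem starPi_natural_left (σ : ProductStar k K box) [box.LaxMonoidal] {X X' : D} (b : C × C)
    (a : X' ⟶ X) (q : X ⟶ σ.star.obj (op (box.obj b))) :
    starPi σ X' b (a ≫ q) = a ▷ box.obj b ≫ starPi σ X b q := by
  simp [starPi]

theorem starPi_natural_right (σ : ProductStar k K box) [box.LaxMonoidal] (X : D) {b b' : C × C}
    (g : b ⟶ b') (q : X ⟶ σ.star.obj (op (box.obj b'))) :
    starPi σ X b (q ≫ σ.star.map (box.map g).op) = X ◁ box.map g ≫ starPi σ X b' q := by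
  change (q ≫ σ.star.map (box.map g).op) ▷ box.obj b ≫ starEval σ b =
    X ◁ box.map g ≫ q ▷ box.obj b' ≫ starEval σ b'
  rw [comp_whiskerRight, Category.assoc, starEval_dinatural, whisker_exchange_assoc]

/-- Source and target are right exact in `X` as functors to the opposite of vector spaces, so the
case `X = P ⊠ P` suffices. There the Hom formula identifies the map with `π ⊗ π`. -/
theorem IsBox.starPi_bijective (h : IsBox k P P box) (hD : RightExactTensor D)
    [box.Monoidal] (σ : ProductStar k K box) (X : D) (b : C × C) :
    Function.Bijective (starPi σ X b) := by
  have hG := (hD.tensorRight (k := k) (box.obj b)).comp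
    (isLinearRightExact_homTo k (box.obj (K.star.obj (op (𝟙_ C)), K.star.obj (op (𝟙_ C)))))
  have hgen : Function.Bijective (starPi σ (box.obj (P, P)) b) := by
    let e₁ := LinearEquiv.ofBijective _
      (h.homMap_bijective P (K.star.obj (op b.1)) P (K.star.obj (op b.2)))
    let e₂ := LinearEquiv.ofBijective _
      (h.homMap_bijective (P ⊗ b.1) (K.star.obj (op (𝟙_ C))) (P ⊗ b.2) (K.star.obj (op (𝟙_ C))))
    have key : ∀ x, starPi σ (box.obj (P, P)) b (e₁ x ≫ (σ.starBox b).inv) =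
        μ box (P, P) b ≫ e₂ (TensorProduct.congr (K.piLinear P b.1) (K.piLinear P b.2) x) := by
      intro x
      induction x with
      | zero => simp
      | add x y hx hy => simp only [map_add, Preadditive.add_comp, Preadditive.comp_add, hx, hy]
      | tmul f g =>
        have h₁ : e₁ (f ⊗ₜ g) = box.map (Prod.mkHom f g) := homMap_tmul h.multi f g
        have h₂ : e₂ (K.piLinear P b.1 f ⊗ₜ K.piLinear P b.2 g) =
          box.map (Prod.mkHom (K.π P b.1 f) (K.π P b.2 g)) := homMap_tmul h.multi _ _
        rw [TensorProduct.congr_tmul, h₂, h₁]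
        refine Eq.trans ?_ (map_whiskerRight_boxEval b f g)
        simp [starPi, starEval]
    refine (Function.Bijective.of_comp_iff _
      ((σ.starBox b).symm.homToEquiv.bijective.comp e₁.bijective)).1 ?_
    have : starPi σ (box.obj (P, P)) b ∘ ((σ.starBox b).symm.homToEquiv ∘ e₁) =
        (asIso (μ box (P, P) b)).symm.homFromEquiv ∘ e₂ ∘
          TensorProduct.congr (K.piLinear P b.1) (K.piLinear P b.2) := funext key
    rw [this]
    exact (Equiv.bijective _).comp (e₂.bijective.comp (LinearEquiv.bijective _))
  have := h.gen.isIso_elementHom hG (V := σ.star.obj (op (box.obj b))) (starEval σ b) hgen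
  exact (isIso_ofHom_iff _).1 ((isIso_op_iff (ModuleCat.ofHom
    (pullElement hG (starEval σ b) X))).1
      (NatIso.isIso_app_of_isIso (elementHom hG _) X))

/-- The evaluation is available only on product objects. The bijections `starPi` are therefore
extended to arbitrary second arguments as an isomorphism of right exact bifunctors. -/
theorem IsBox.exists_starPi (h : IsBox k P P box) (hD : RightExactTensor D)
    [box.Monoidal] (σ : ProductStar k K box) (Z : D)
    (hZ : Z = box.obj (K.star.obj (op (𝟙_ C)), K.star.obj (op (𝟙_ C)))) :
    ∃ p : ∀ X Y : D, (X ⟶ σ.star.obj (op Y)) ≃ (X ⊗ Y ⟶ Z),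
      (∀ {X X' : D} (Y : D) (a : X' ⟶ X) (q : X ⟶ σ.star.obj (op Y)),
        p X' Y (a ≫ q) = a ▷ Y ≫ p X Y q) ∧
      ∀ (X : D) {Y Y' : D} (b : Y' ⟶ Y) (q : X ⟶ σ.star.obj (op Y)),
        p X Y' (q ≫ σ.star.map b.op) = X ◁ b ≫ p X Y q := by
  subst hZ
  have := σ.isLinearRightExact.additive
  have := σ.isLinearRightExact.rightExact
  have := preservesFiniteColimits_homPairing k σ.functor
  have := preservesFiniteColimits_tensorPairing k hD
    (box.obj (K.star.obj (op (𝟙_ C)), K.star.obj (op (𝟙_ C))))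
  obtain ⟨α, -⟩ := h.exists_iso₂
    (F := tensorPairing k (box.obj (K.star.obj (op (𝟙_ C)), K.star.obj (op (𝟙_ C)))))
    (F' := homPairing k σ.functor)
    (preservesFiniteColimits_tensorPairing_obj k hD _)
    (preservesFiniteColimits_homPairing_obj k σ.functor)
    (fun a b => (LinearEquiv.ofBijective _ (h.starPi_bijective hD σ (box.obj a) b)).toModuleIso.op)
    (fun {a a'} f b => Quiver.Hom.unop_inj (ModuleCat.hom_ext (LinearMap.ext fun q =>
      (starPi_natural_left σ b (box.map f) q).symm)))
    (fun a {b b'} g => Quiver.Hom.unop_inj (ModuleCat.hom_ext (LinearMap.ext fun q =>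
      (starPi_natural_right σ (box.obj a) g q).symm)))
  refine ⟨fun X Y => ((forget (ModuleCat k)).mapIso ((α.app X).app Y).unop).toEquiv, ?_, ?_⟩
  · intro X X' Y a q
    exact Eq.symm <| congr_arg (fun t => ModuleCat.Hom.hom (Quiver.Hom.unop t) q)
      (congr_app (α.hom.naturality a) Y)
  · intro X Y Y' b q
    exact Eq.symm <| congr_arg (fun t => ModuleCat.Hom.hom (Quiver.Hom.unop t) q)
      ((α.hom.app X).naturality b)

end Conjugates

/-! ### Existence of the representing object -/

section RepresentingObject

variable {k : Type w} [Field k]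

theorem IsProjGen.finiteDimensional_hom' {X : Type u} [Category.{v} X] [Abelian X] [Linear k X]
    {Q : X} (hQ : IsProjGen Q) [FiniteDimensional k (Q ⟶ Q)] (U V : X) :
    FiniteDimensional k (U ⟶ V) := by
  obtain ⟨n, p, _⟩ := hQ.exists_epi U
  have := hQ.finiteDimensional_hom (k := k) V
  let f : (U ⟶ V) →ₗ[k] (Fin n → (Q ⟶ V)) :=
    LinearMap.pi fun i => Linear.leftComp k V (biproduct.ι (fun _ : Fin n => Q) i ≫ p)
  refine FiniteDimensional.of_injective f fun a b hab => ?_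
  rw [← cancel_epi p]
  refine biproduct.hom_ext' _ _ fun i => ?_
  rw [← Category.assoc, ← Category.assoc]
  exact congr_fun hab i

variable {C : Type u} [Category.{v} C] [Abelian C] [Linear k C] [MonoidalCategory C]
variable {D : Type u} [Category.{v} D] [Abelian D] [Linear k D] {P : C} {box : C × C ⥤ D}

/-- Right exactness of `T` makes `X ↦ C(T X, 1^*)` left exact, and its value at the generator is
finite-dimensional. -/
theorem IsBox.exists_represents (h : IsBox k P P box) [FiniteDimensional k (P ⟶ P)]
    (K : Conjugates k C) {T : D ⥤ C} (hT : IsLinearRightExact k T) :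
    ∃ R₁ : D, Nonempty (Represents K T R₁) := by
  have := h.finiteDimensional_hom
  have hG := hT.comp (isLinearRightExact_homTo k (K.star.obj (op (𝟙_ C))))
  obtain ⟨R, ξ, hξ⟩ := h.gen.exists_representing hG (h.left.finiteDimensional_hom' (k := k)
    (T.obj (box.obj (P, P))) (K.star.obj (op (𝟙_ C))))
  have hbij (X : D) : Function.Bijective (pullElement hG ξ X) :=
    (isIso_ofHom_iff _).1 ((isIso_op_iff (ModuleCat.ofHom (pullElement hG ξ X))).1
      (NatIso.isIso_app_of_isIso (elementHom hG ξ) X))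
  exact ⟨R, ⟨{ homEquiv := fun {X} => Equiv.ofBijective _ (hbij X)
               homEquiv_comp := fun f g => pull_comp _ f g ξ }⟩⟩

end RepresentingObject

/-! ### The bijections composing the adjunction -/

section Adjunction

section Internal

variable {D : Type u} [Category.{v} D] [MonoidalCategory D] {star : Dᵒᵖ ⥤ D} {Z : D}
  (p : ∀ X Y : D, (X ⟶ star.obj (op Y)) ≃ (X ⊗ Y ⟶ Z)) {R R' : D} (i : R ≅ star.obj (op R'))

/-- `Hom(X ⊗ W, R) ≅ Hom(X, (W ⊗ R')^*)` if `R ≅ R'^*`. -/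
def internalHomEquiv (X W : D) : (X ⊗ W ⟶ R) ≃ (X ⟶ star.obj (op (W ⊗ R'))) :=
  i.homToEquiv.trans <| (p (X ⊗ W) R').trans <| (α_ X W R').homFromEquiv.trans (p X (W ⊗ R')).symm

theorem internalHomEquiv_natural_left
    (hp : ∀ {X X' : D} (Y : D) (a : X' ⟶ X) (q : X ⟶ star.obj (op Y)),
      p X' Y (a ≫ q) = a ▷ Y ≫ p X Y q) {X X' : D} (W : D) (f : X' ⟶ X) (q : X ⊗ W ⟶ R) :
    internalHomEquiv p i X' W (f ▷ W ≫ q) = f ≫ internalHomEquiv p i X W q := by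
  apply (p X' _).injective
  rw [hp]
  simp [internalHomEquiv, hp]

theorem internalHomEquiv_natural_right
    (hp : ∀ {X X' : D} (Y : D) (a : X' ⟶ X) (q : X ⟶ star.obj (op Y)),
      p X' Y (a ≫ q) = a ▷ Y ≫ p X Y q)
    (hp' : ∀ (X : D) {Y Y' : D} (b : Y' ⟶ Y) (q : X ⟶ star.obj (op Y)),
        p X Y' (q ≫ star.map b.op) = X ◁ b ≫ p X Y q)
    (X : D) {W W' : D} (g : W' ⟶ W) (q : X ⊗ W ⟶ R) :
    internalHomEquiv p i X W' (X ◁ g ≫ q) =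
      internalHomEquiv p i X W q ≫ star.map (g ▷ R').op := by
  apply (p X _).injective
  rw [hp']
  simp [internalHomEquiv, hp]

end Internal

variable {k : Type w} [Field k]
variable {C : Type u} [Category.{v} C] [Abelian C] [Linear k C] [MonoidalCategory C]
  [BraidedCategory C]
variable {D : Type u} [Category.{v} D] [Abelian D] [Linear k D] {box : C × C ⥤ D}
variable [MonoidalCategory D] {S : ProductTensor k box} (T : TensorFunctor k S)

open Functor.LaxMonoidal

/-- `T(U ⊠ 1) ≅ U` -/
def tensorBoxUnit (U : C) : T.functor.obj (box.obj (U, 𝟙_ C)) ≅ U :=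
  T.iso.app (U, 𝟙_ C) ≪≫ ρ_ U

theorem tensorBoxUnit_natural {U U' : C} (u : U ⟶ U') :
    T.functor.map (box.map (Prod.mkHom u (𝟙 (𝟙_ C)))) ≫ (tensorBoxUnit T U').hom =
      (tensorBoxUnit T U).hom ≫ u := by
  have := T.iso.hom.naturality (Prod.mkHom u (𝟙 (𝟙_ C)))
  change T.functor.map (box.map (Prod.mkHom u (𝟙 (𝟙_ C)))) ≫ T.iso.hom.app _ =
    T.iso.hom.app _ ≫ (u ⊗ₘ 𝟙 (𝟙_ C)) at this
  change T.functor.map (box.map (Prod.mkHom u (𝟙 (𝟙_ C)))) ≫ T.iso.hom.app _ ≫ (ρ_ U').hom =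
    (T.iso.hom.app _ ≫ (ρ_ U).hom) ≫ u
  rw [reassoc_of% this, Category.assoc, tensorHom_id, rightUnitor_naturality]

/-- `T(X) ⊗ U ≅ T(X ⊗ (U ⊠ 1))` -/
def tensorObjIso (X : D) (U : C) :
    T.functor.obj X ⊗ U ≅ T.functor.obj (X ⊗ box.obj (U, 𝟙_ C)) :=
  letI := T.monoidal
  whiskerLeftIso _ (tensorBoxUnit T U).symm ≪≫ Functor.Monoidal.μIso T.functor _ _

theorem tensorObjIso_natural_left {X X' : D} (f : X ⟶ X') (U : C) :
    T.functor.map f ▷ U ≫ (tensorObjIso T X' U).hom =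
      (tensorObjIso T X U).hom ≫ T.functor.map (f ▷ box.obj (U, 𝟙_ C)) := by
  let := T.monoidal
  simp only [tensorObjIso, Iso.trans_hom, whiskerLeftIso_hom, Iso.symm_hom,
    Functor.Monoidal.μIso_hom, Category.assoc, ← Functor.LaxMonoidal.μ_natural_left]
  rw [whisker_exchange_assoc]

theorem tensorObjIso_natural_right (X : D) {U U' : C} (u : U ⟶ U') :
    T.functor.obj X ◁ u ≫ (tensorObjIso T X U').hom =
      (tensorObjIso T X U).hom ≫ T.functor.map (X ◁ box.map (Prod.mkHom u (𝟙 (𝟙_ C)))) := by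
  let := T.monoidal
  have h : u ≫ (tensorBoxUnit T U').inv =
      (tensorBoxUnit T U).inv ≫ T.functor.map (box.map (Prod.mkHom u (𝟙 (𝟙_ C)))) := by
    rw [Iso.comp_inv_eq, Category.assoc, tensorBoxUnit_natural, Iso.inv_hom_id_assoc]
  simp only [tensorObjIso, Iso.trans_hom, whiskerLeftIso_hom, Iso.symm_hom,
    Functor.Monoidal.μIso_hom, Category.assoc, ← Functor.LaxMonoidal.μ_natural_right]
  rw [← whiskerLeft_comp_assoc, ← whiskerLeft_comp_assoc, h]

variable {K : Conjugates k C} {R₁ : D}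

/-- `C(T(X), U) ≅ D(X ⊗ (U^* ⊠ 1), R₁)` -/
def tensorHomEquiv (r : Represents K T.functor R₁) (X : D) (U : C) :
    (T.functor.obj X ⟶ U) ≃ (X ⊗ box.obj (K.star.obj (op U), 𝟙_ C) ⟶ R₁) :=
  (K.δ.app U).homToEquiv.trans <| (K.π _ _).trans <|
    (tensorObjIso T X (K.star.obj (op U))).homFromEquiv.trans r.homEquiv.symm

theorem homEquiv_tensorHomEquiv (r : Represents K T.functor R₁) (X : D) (U : C)
    (g : T.functor.obj X ⟶ U) : r.homEquiv (tensorHomEquiv T r X U g) =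
      (tensorObjIso T X (K.star.obj (op U))).inv ≫ K.π _ _ (g ≫ K.δ.hom.app U) :=
  r.homEquiv.apply_symm_apply _

theorem tensorHomEquiv_natural_left (r : Represents K T.functor R₁) {X X' : D} (f : X' ⟶ X) (U : C)
    (g : T.functor.obj X ⟶ U) : tensorHomEquiv T r X' U (T.functor.map f ≫ g) =
      f ▷ box.obj (K.star.obj (op U), 𝟙_ C) ≫ tensorHomEquiv T r X U g := by
  apply r.homEquiv.injective
  rw [r.homEquiv_comp, homEquiv_tensorHomEquiv, homEquiv_tensorHomEquiv, Category.assoc,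
    K.π_natural_left]
  have h := tensorObjIso_natural_left T f (K.star.obj (op U))
  rw [← Iso.inv_comp_eq, ← Category.assoc, ← Iso.eq_comp_inv] at h
  exact (reassoc_of% h) _

theorem tensorHomEquiv_natural_right (r : Represents K T.functor R₁) (X : D) {U U' : C}
    (g : T.functor.obj X ⟶ U) (u : U ⟶ U') : tensorHomEquiv T r X U' (g ≫ u) =
      X ◁ box.map (Prod.mkHom (K.star.map u.op) (𝟙 (𝟙_ C))) ≫ tensorHomEquiv T r X U g := by
  apply r.homEquiv.injective
  have h₁ : (g ≫ u) ≫ K.δ.hom.app U' = (g ≫ K.δ.hom.app U) ≫ K.star.map (K.star.map u.op).op := by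
    have := K.δ.hom.naturality u
    rw [Category.assoc, Category.assoc]
    exact congr_arg (g ≫ ·) this
  rw [r.homEquiv_comp, homEquiv_tensorHomEquiv, homEquiv_tensorHomEquiv, h₁, K.π_natural_right]
  have h := tensorObjIso_natural_right T X (K.star.map u.op)
  rw [← Iso.inv_comp_eq, ← Category.assoc, ← Iso.eq_comp_inv] at h
  exact (reassoc_of% h) _

end Adjunction

/-! ### The adjunction -/

section Conjugates

variable {k : Type w} [Field k]
variable {C : Type u} [Category.{v} C] [Abelian C] [Linear k C] [MonoidalCategory C]
  [MonoidalPreadditive C] [MonoidalLinear k C] [BraidedCategory C]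
variable {D : Type u} [Category.{v} D] [Abelian D] [Linear k D] {P : C} {box : C × C ⥤ D}
variable [MonoidalCategory D] {S : ProductTensor k box} {K : Conjugates k C}

/-- `tensorHomEquiv` moves `U` to the left as `U^* ⊠ 1` and reaches `R₁`; writing `R₁` as a double
dual, `internalHomEquiv` moves everything except `X` back under the dual. Naturality in `X` and `U`
holds for each half. -/
theorem IsBox.nonempty_adjunction (h : IsBox k P P box) [FiniteDimensional k (P ⟶ P)]
    (T : TensorFunctor k S) (σ : ProductStar k K box) {R₁ : D} (r : Represents K T.functor R₁) :
    Nonempty (T.functor ⊣ rightAdjointFunctor K σ R₁) := by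
  have := S.preadditive
  have := S.linear
  let := S.boxMonoidal
  obtain ⟨p, hp, hp'⟩ := h.exists_starPi S.rightExact σ _ rfl
  obtain ⟨i⟩ := h.nonempty_starStar σ R₁
  let e (X : D) (U : C) : (T.functor.obj X ⟶ U) ≃ (X ⟶ (rightAdjointFunctor K σ R₁).obj U) :=
    (tensorHomEquiv T r X U).trans
      (internalHomEquiv p i X (box.obj (K.star.obj (op U), 𝟙_ C)))
  have he {X' X : D} {U : C} (f : X' ⟶ X) (g : T.functor.obj X ⟶ U) :
      e X' U (T.functor.map f ≫ g) = f ≫ e X U g :=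
    (congr_arg _ (tensorHomEquiv_natural_left T r f U g)).trans
      (internalHomEquiv_natural_left p i hp _ f _)
  exact ⟨Adjunction.mkOfHomEquiv
    { homEquiv := e
      homEquiv_naturality_left_symm := fun {X' X U} f g => by
        rw [Equiv.symm_apply_eq, he, Equiv.apply_symm_apply]
      homEquiv_naturality_right := fun {X U U'} g u =>
        (congr_arg _ (tensorHomEquiv_natural_right T r X g u)).trans
          (internalHomEquiv_natural_right p i hp hp' X _ _) }⟩

end Conjugates

/-! ### Lax monoidal functors preserve algebras, units and homomorphisms -/

section LaxMonoidal

open Functor.LaxMonoidal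

variable {M : Type u} [Category.{v} M] [MonoidalCategory M]
variable {N : Type u₁} [Category.{v₁} N] [MonoidalCategory N] (F : M ⥤ N) [F.LaxMonoidal]

theorem IsAlgebra.map {A : M} {m : A ⊗ A ⟶ A} (h : IsAlgebra m) :
    IsAlgebra (μ F A A ≫ F.map m) := by
  unfold IsAlgebra at h ⊢
  simp only [whiskerLeft_comp, comp_whiskerRight, Category.assoc, μ_natural_left_assoc,
    μ_natural_right_assoc, ← F.map_comp, h]
  simp only [F.map_comp, associativity_inv_assoc]

theorem IsAlgebraUnit.map {A : M} {m : A ⊗ A ⟶ A} {e : 𝟙_ M ⟶ A} (h : IsAlgebraUnit m e) :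
    IsAlgebraUnit (μ F A A ≫ F.map m) (ε F ≫ F.map e) := by
  constructor
  · simp only [comp_whiskerRight, Category.assoc, μ_natural_left_assoc, ← F.map_comp, h.1]
    exact (left_unitality F A).symm
  · simp only [whiskerLeft_comp, Category.assoc, μ_natural_right_assoc, ← F.map_comp, h.2]
    exact (right_unitality F A).symm

theorem IsAlgebraHom.map {A A' : M} {m : A ⊗ A ⟶ A} {m' : A' ⊗ A' ⟶ A'} {f : A ⟶ A'}
    (h : IsAlgebraHom m m' f) :
    IsAlgebraHom (μ F A A ≫ F.map m) (μ F A' A' ≫ F.map m') (F.map f) := by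
  unfold IsAlgebraHom at h ⊢
  rw [Category.assoc, ← F.map_comp, h, F.map_comp, μ_natural_assoc]

end LaxMonoidal

theorem ConditionPF.exists_isProjGen {k : Type w} [Field k] {C : Type u} [Category.{v} C]
    [Abelian C] [Linear k C] (h : ConditionPF k C) :
    ∃ P : C, IsProjGen P ∧ FiniteDimensional k (P ⟶ P) := by
  obtain ⟨P, hP, hf, hg⟩ := h
  exact ⟨P, ⟨hP, hg⟩, hf⟩

end DeligneAdjoint

end

/-! ### The main theorem -/

open DeligneAdjoint Functor.LaxMonoidal in
theorem mainTheorem3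
    {k : Type w} [Field k] [CharZero k]
    {C : Type (max u v)} [Category.{v} C] [Abelian C] [Linear k C]
    [MonoidalCategory C] [MonoidalPreadditive C] [MonoidalLinear k C] [BraidedCategory C]
    (hrex : RightExactTensor C) (hPF : ConditionPF k C) (K : Conjugates k C) :
    -- a Deligne product of `C` with itself exists
    (∃ (D : Type (max u v)) (_ : Category.{v} D) (_ : Abelian D) (_ : Linear k D)
      (box : C × C ⥤ D), IsDeligneProduct k box) ∧
    ∀ (D : Type (max u v)) [Category.{v} D] [Abelian D] [Linear k D]
      (box : C × C ⥤ D), IsDeligneProduct k box →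
      -- the induced involution and the induced tensor product exist
      Nonempty (ProductStar k K box) ∧
      (∃ _ : MonoidalCategory D, Nonempty (ProductTensor k box)) ∧
      ∀ [MonoidalCategory D] (S : ProductTensor k box),
        -- the tensor product functor exists, with its strong monoidal structure
        Nonempty (TensorFunctor k S) ∧
        ∀ (T : TensorFunctor k S) (σ : ProductStar k K box),
        -- the representing object exists
        (∃ R₁ : D, Nonempty (Represents K T.functor R₁)) ∧
        ∀ R₁ : D, Nonempty (Represents K T.functor R₁) →
          -- `R` is a right adjoint of `T`
          Nonempty (T.functor ⊣ rightAdjointFunctor K σ R₁) ∧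
          ∀ adj : T.functor ⊣ rightAdjointFunctor K σ R₁,
            letI := T.monoidal
            -- `R` is lax monoidal, with the structure maps induced by the adjunction
            ∃ lax : (rightAdjointFunctor K σ R₁).LaxMonoidal,
              (ε (rightAdjointFunctor K σ R₁) =
                adj.unit.app (𝟙_ D) ≫
                  (rightAdjointFunctor K σ R₁).map (Functor.OplaxMonoidal.η T.functor)) ∧
              (∀ U V : C, μ (rightAdjointFunctor K σ R₁) U V =
                adj.unit.app ((rightAdjointFunctor K σ R₁).obj U ⊗
                    (rightAdjointFunctor K σ R₁).obj V) ≫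
                  (rightAdjointFunctor K σ R₁).map
                    (Functor.OplaxMonoidal.δ T.functor _ _ ≫
                      (adj.counit.app U ⊗ₘ adj.counit.app V))) ∧
              -- `R` sends algebras, units and algebra homomorphisms to such
              (∀ (A : C) (m : A ⊗ A ⟶ A), IsAlgebra m →
                IsAlgebra (μ (rightAdjointFunctor K σ R₁) A A ≫
                  (rightAdjointFunctor K σ R₁).map m) ∧
                ∀ e : 𝟙_ C ⟶ A, IsAlgebraUnit m e →
                  IsAlgebraUnit (μ (rightAdjointFunctor K σ R₁) A A ≫
                      (rightAdjointFunctor K σ R₁).map m)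
                    (ε (rightAdjointFunctor K σ R₁) ≫
                      (rightAdjointFunctor K σ R₁).map e)) ∧
              (∀ (A A' : C) (m : A ⊗ A ⟶ A) (m' : A' ⊗ A' ⟶ A') (f : A ⟶ A'),
                IsAlgebra m → IsAlgebra m' → IsAlgebraHom m m' f →
                IsAlgebraHom
                  (μ (rightAdjointFunctor K σ R₁) A A ≫ (rightAdjointFunctor K σ R₁).map m)
                  (μ (rightAdjointFunctor K σ R₁) A' A' ≫ (rightAdjointFunctor K σ R₁).map m')
                  ((rightAdjointFunctor K σ R₁).map f)) := by
  obtain ⟨P, hP, _⟩ := hPF.exists_isProjGen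
  obtain ⟨D₀, _, _, _, box₀, h₀⟩ := exists_isBox (k := k) hP hP
  refine ⟨⟨D₀, _, _, _, box₀, h₀.isDeligneProduct⟩, fun D _ _ _ box hD => ?_⟩
  -- The criterion is established for the module category and transported to the given product, so
  -- that all later structure is built on an arbitrary Deligne product.
  have h := h₀.of_isDeligneProduct hD
  refine ⟨h.nonempty_productStar K, h.exists_productTensor hrex, fun S =>
    ⟨h.nonempty_tensorFunctor hrex S, fun T σ =>
      ⟨h.exists_represents K T.isLinearRightExact, fun R₁ ⟨r⟩ =>
        ⟨h.nonempty_adjunction T σ r, fun adj => ?_⟩⟩⟩⟩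
  let := T.monoidal
  let := adj.rightAdjointLaxMonoidal
  refine ⟨this, ?_, fun U V => ?_, fun A m hm => ⟨hm.map _, fun e he => he.map _⟩,
    fun A A' m m' f _ _ hf => hf.map _⟩
  -- The lax structure is by definition the transpose under `adj` of the oplax structure of `T`;
  -- expanding the transpose through the unit gives the stated formula.
  · exact adj.homEquiv_unit _ _ _
  · exact adj.homEquiv_unit _ _ _
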